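/- **Notation.** Let $n\ge 1$ be an integer and $\mu_1,\mu_2\in\mathbb R$. Put $\delta=(\mu_1-1)^2-4\mu_2$ and $$\gamma_F(p,\nu)=2-\nu(p-1),\qquad \gamma_S(p,\nu)=2+(\nu+1)p-(\nu-1)p^2,$$ $$p_F(\nu)=\begin{cases}1+\frac2\nu,&\nu>0,\\+\infty,&\nu\le 0,\end{cases}\qquad p_S(\nu)=\begin{cases}\frac{\nu+1+\sqrt{\nu^2+10\nu-7}}{2(\nu-1)},&\nu>1,\\+\infty,&\nu\le1,\end{cases}$$ $$d_*(\nu)=\begin{cases}\frac12\left(-1-\nu+\sqrt{\nu^2+10\nu-7}\right),&\nu>1,\\0,&\nu\le1.\end{cases}$$ For $\delta\ge0$ put $$p_{\mu_1,\delta}(n)=\max\left\{p_F\left(n+\tfrac{\mu_1-1-\sqrt\delta}{2}\right),\,p_S(n+\mu_1)\right\},\qquad p_*=\begin{cases}1+\frac{n-\sqrt\delta+2}{n+\mu_1-1},&n+\mu_1\ne1,\\+\infty,&n+\mu_1=1.\end{cases}$$ Put $\operatorname{sgn}\delta=1$ if $\delta>0$ and $\operatorname{sgn}0=0$. **Equation.**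 Consider $$u_{tt}-\Delta u+\frac{\mu_1}{1+t}u_t+\frac{\mu_2}{(1+t)^2}u=|u|^p \text{ in }\mathbb R^n\times(0,T),\qquad u(x,0)=\varepsilon f(x),\quad u_t(x,0)=\varepsilon g(x).\tag{1}$$ An *energy solution* of (1) on $[0,T)$ is a function $u\in C([0,T),H^1(\mathbb R^n))\cap C^1([0,T),L^2(\mathbb R^n))\cap C((0,T),L^p_{loc}(\mathbb R^n))$ with $|u|^p$ integrable on $K\times(0,t)$ for every compact $K\subset\mathbb R^n$ and every $t<T$, with $u(\cdot,0)=\varepsilon f$ and $u_t(\cdot,0)=\varepsilon g$, such that for every $t\in[0,T)$ and every $\phi\in C_0^\infty(\mathbb R^n\times[0,T))$ $$\int u_t(x,t)\phi(x,t)\,dx-\int\varepsilon g(x)\phi(x,0)\,dx+\int_0^t\!\!\int\{-u_t\phi_t+\nabla u\cdot\nabla\phi\}\,dx\,ds+\int_0^t\!\!\int\left\{\frac{\mu_1}{1+s}u_t\phi+\frac{\mu_2}{(1+s)^2}u\phi\right\}dx\,ds=\int_0^t\!\!\int|u|^p\phi\,dx\,ds .$$ For $R\ge1$ let $T_\varepsilon\in[0,\infty]$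 be the lifespan (blow-up time): the supremum of all $T>0$ such that (1) has an energy solution $u$ on $[0,T)$ with $$\operatorname{supp}u\subset\{(x,t):|x|\le t+R\}.$$ **Theorem.** Let $\mu_1\ge0$, $\mu_2\in\mathbb R$, $\delta\ge0$, $1<p<p_{\mu_1,\delta}(n)$ and $R\ge1$. Let $f\in H^1(\mathbb R^n)$ and $g\in L^2(\mathbb R^n)$ satisfy $f\ge0$, $f\not\equiv0$ (almost everywhere) and $$h:=\frac{\mu_1-1+\sqrt\delta}{2}f+g=0.$$ Then there are constants $\varepsilon_4>0$ and $C>0$, depending only on $n,\mu_1,\mu_2,p,R,f,g$ and not on $\varepsilon$, such that for all $0<\varepsilon\le\varepsilon_4$ the following hold. * If $\sqrt\delta\le n-d_*(n+\mu_1)$, then $T_\varepsilon\le C\varepsilon^{-2p(p-1)/\gamma_S(p,n+\mu_1)}$. * If $n-d_*(n+\mu_1)<\sqrt\delta<n+2$, then $$T_\varepsilon\le\begin{cases}C\varepsilon^{-2p(p-1)/\gamma_S(p,n+\mu_1)}&\text{if }1<p<p_*,\\ C\sigma_*(\varepsilon)&\text{if }p=p_*,\\ C\sigma(\varepsilon)&\text{if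 }p_*<p<p_{\mu_1,\delta}(n).\end{cases}$$ * If $\sqrt\delta\ge n+2$, then $T_\varepsilon\le C\sigma(\varepsilon)$. Here $\sigma=\sigma(\varepsilon)$ and $\sigma_*=\sigma_*(\varepsilon)$ are, in the cases in which they occur, the unique positive solutions of $$\varepsilon^p\,\sigma^{\frac{\gamma_F(p,\,n+(\mu_1-1-\sqrt\delta)/2)}{p-1}}\ln(1+\sigma)^{1-\operatorname{sgn}\delta}=1,\qquad \varepsilon^p\,\sigma_*^{\frac{\gamma_F(p,\,n+(\mu_1-1-\sqrt\delta)/2)}{p-1}}\ln(1+\sigma_*)^{2-\operatorname{sgn}\delta}=1 .$$ * Moreover, if $n=1$, $0\le\delta<1$ and $1<p<r_*(\mu_1,\delta)$, then $$T_\varepsilon\le C\varepsilon^{-(p-1)/\gamma_F(p,(\mu_1+1+\sqrt\delta)/2)},$$ where, with $\theta=1+\frac{\mu_1}2-\frac12\sqrt{\mu_1^2+16}$, $$r_*(\mu_1,\delta)=\begin{cases}1+2\,\frac{2-\sqrt\delta}{1+\mu_1+\sqrt\delta},&\sqrt\delta<\theta,\\[2pt] 1+2\,\frac{2-\theta}{1+\mu_1+\theta}=\frac{2}{1+\theta},&\sqrt\delta=\theta,\\[2pt]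 \frac{2}{1+\sqrt\delta},&\sqrt\delta>\theta.\end{cases}$$ -/

import Mathlib

open MeasureTheory Set Filter Topology
open scoped ContDiff ENNReal

noncomputable section

namespace ScaleInvWave

/-! ### Exponents -/

/-- `γ_F(p,ν) = 2 - ν (p - 1)`. -/
def gammaF (p ν : ℝ) : ℝ := 2 - ν * (p - 1)

/-- `γ_S(p,ν) = 2 + (ν + 1) p - (ν - 1) p²`. -/
def gammaS (p ν : ℝ) : ℝ := 2 + (ν + 1) * p - (ν - 1) * p ^ 2

/-- The Fujita exponent, `+∞` for `ν ≤ 0`. -/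
def pF (ν : ℝ) : EReal :=
  if 0 < ν then ((1 + 2 / ν : ℝ) : EReal) else ⊤

/-- The Strauss exponent, `+∞` for `ν ≤ 1`. -/
def pS (ν : ℝ) : EReal :=
  if 1 < ν then
    (((ν + 1 + Real.sqrt (ν ^ 2 + 10 * ν - 7)) / (2 * (ν - 1)) : ℝ) : EReal)
  else ⊤

/-- `δ(μ₁,μ₂) = (μ₁ - 1)² - 4 μ₂`. -/
def delta (μ₁ μ₂ : ℝ) : ℝ := (μ₁ - 1) ^ 2 - 4 * μ₂

/-- The shifted dimension `n + (μ₁ - 1 - √δ) / 2`. -/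
def heatDim (n : ℕ) (μ₁ δ : ℝ) : ℝ := n + (μ₁ - 1 - Real.sqrt δ) / 2

/-- `p_{μ₁,δ}(n) = max {p_F(n + (μ₁ - 1 - √δ)/2), p_S(n + μ₁)}`. -/
def pCrit (n : ℕ) (μ₁ δ : ℝ) : EReal :=
  max (pF (heatDim n μ₁ δ)) (pS (n + μ₁))

/-- `d_*(ν)`. -/
def dStar (ν : ℝ) : ℝ :=
  if 1 < ν then (-1 - ν + Real.sqrt (ν ^ 2 + 10 * ν - 7)) / 2 else 0

/-- `p_*(n + μ₁, n - √δ)`, equal to `+∞` when `n + μ₁ = 1`. -/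
def pStar (n : ℕ) (μ₁ δ : ℝ) : EReal :=
  if (n : ℝ) + μ₁ = 1 then ⊤
  else ((1 + (n - Real.sqrt δ + 2) / (n + μ₁ - 1) : ℝ) : EReal)

/-- `θ(μ₁)`. -/
def theta (μ₁ : ℝ) : ℝ := 1 + μ₁ / 2 - Real.sqrt (μ₁ ^ 2 + 16) / 2

/-- `r_*(μ₁,δ)`. -/
def rStar (μ₁ δ : ℝ) : ℝ :=
  if Real.sqrt δ < theta μ₁ then
    1 + 2 * ((2 - Real.sqrt δ) / (1 + μ₁ + Real.sqrt δ))
  else if Real.sqrt δ = theta μ₁ then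
    1 + 2 * ((2 - theta μ₁) / (1 + μ₁ + theta μ₁))
  else 2 / (1 + Real.sqrt δ)

/-! ### Function spaces -/

/-- Euclidean space `ℝⁿ`. -/
abbrev Rn (n : ℕ) : Type := EuclideanSpace ℝ (Fin n)

/-- `L²(ℝⁿ)`. -/
abbrev L2 (n : ℕ) : Type := Lp ℝ 2 (volume : Measure (Rn n))

/-- `L²(ℝⁿ; ℝⁿ)`. -/
abbrev L2vec (n : ℕ) : Type := Lp (Rn n) 2 (volume : Measure (Rn n))

/-- `G ∈ L²(ℝⁿ; ℝⁿ)` is the weak (distributional) gradient of `w ∈ L²(ℝⁿ)`. -/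
def IsWeakGradient {n : ℕ} (w : L2 n) (G : L2vec n) : Prop :=
  ∀ η : Rn n → ℝ, ContDiff ℝ ∞ η → HasCompactSupport η → ∀ e : Rn n,
    ∫ x, w x * fderiv ℝ η x e = - ∫ x, inner ℝ (G x) e * η x

/-- `w ∈ H¹(ℝⁿ)`. -/
def MemH1 {n : ℕ} (w : L2 n) : Prop := ∃ G : L2vec n, IsWeakGradient w G

/-- A test function in `C_0^∞(ℝⁿ × [0,T))`, given by a smooth extension to negative times. Its
support may meet the initial hyperplane `t = 0`. -/
structure IsTestFunction {n : ℕ} (T : ℝ) (φ : Rn n × ℝ → ℝ) : Prop where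
  smooth : ContDiff ℝ ∞ φ
  compact : HasCompactSupport φ
  support : tsupport φ ⊆ {z | z.2 < T}

/-! ### Energy solutions -/

/-- `u` is an energy solution over `[0,T)` of
`u_tt - Δu + μ₁/(1+t) u_t + μ₂/(1+t)² u = |u|^p`, `u(0) = ε f`, `u_t(0) = ε g`,
with time derivative `ut` and spatial gradient `Du`. Only the values at times in `[0,T)` matter. -/
structure IsEnergySolution {n : ℕ} (μ₁ μ₂ p : ℝ) (f g : L2 n) (ε T : ℝ)
    (u ut : ℝ → L2 n) (Du : ℝ → L2vec n) : Prop where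
  /-- `u ∈ C([0,T), H¹)`: `Du` is the gradient, and `u`, `Du` are continuous into `L²`. -/
  weak_grad : ∀ t ∈ Ico 0 T, IsWeakGradient (u t) (Du t)
  cont_u : ContinuousOn u (Ico 0 T)
  cont_Du : ContinuousOn Du (Ico 0 T)
  /-- `u ∈ C¹([0,T), L²)`. -/
  hasDeriv : ∀ t ∈ Ico 0 T, HasDerivWithinAt u (ut t) (Ico 0 T) t
  cont_ut : ContinuousOn ut (Ico 0 T)
  /-- `u ∈ C((0,T), L^p_loc)`. -/
  memLp_loc : ∀ t ∈ Ioo 0 T, ∀ K : Set (Rn n), IsCompact K →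
    MemLp (u t) (ENNReal.ofReal p) (volume.restrict K)
  cont_Lp_loc : ∀ t ∈ Ioo 0 T, ∀ K : Set (Rn n), IsCompact K →
    Tendsto (fun s => eLpNorm (fun x => u s x - u t x) (ENNReal.ofReal p) (volume.restrict K))
      (𝓝 t) (𝓝 0)
  /-- The nonlinear term of the weak formulation is an honest (convergent) integral up to time
  zero. -/
  integrable_nonlin : ∀ t ∈ Ioo 0 T, ∀ K : Set (Rn n), IsCompact K →
    IntervalIntegrable (fun s => ∫ x in K, |u s x| ^ p) volume 0 t
  /-- Initial data. -/
  init_u : u 0 = ε • f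
  init_ut : ut 0 = ε • g
  /-- The weak formulation. -/
  weak_eq : ∀ φ : Rn n × ℝ → ℝ, IsTestFunction T φ → ∀ t ∈ Ico 0 T,
    (∫ x, ut t x * φ (x, t)) - (∫ x, ε * g x * φ (x, 0))
      + (∫ s in (0 : ℝ)..t, ∫ x,
          (-(ut s x * deriv (fun r => φ (x, r)) s)
            + fderiv ℝ (fun y => φ (y, s)) x (Du s x)))
      + (∫ s in (0 : ℝ)..t, ∫ x, μ₁ / (1 + s) * ut s x * φ (x, s))
      + (∫ s in (0 : ℝ)..t, ∫ x, μ₂ / (1 + s) ^ 2 * u s x * φ (x, s))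
    = ∫ s in (0 : ℝ)..t, ∫ x, |u s x| ^ p * φ (x, s)

/-- `supp u ⊆ {(x,t) : |x| ≤ t + R}`, for `u` defined on `[0,T)`. -/
def SupportedInCone {n : ℕ} (R T : ℝ) (u : ℝ → L2 n) : Prop :=
  ∀ t ∈ Ico 0 T, ∀ᵐ x : Rn n, t + R < ‖x‖ → u t x = 0

/-- The lifespan (blow-up time) `T_ε ∈ [0,∞]`: the supremum of all times `T > 0` for which some
energy solution on `[0,T)` supported in the cone `|x| ≤ t + R` exists. In particular no such
solution whatsoever exists on `[0,T)` if `T > T_ε`. -/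
def lifespan {n : ℕ} (μ₁ μ₂ p : ℝ) (f g : L2 n) (R ε : ℝ) : ℝ≥0∞ :=
  sSup {τ | ∃ T : ℝ, 0 < T ∧ τ = ENNReal.ofReal T ∧
    ∃ (u ut : ℝ → L2 n) (Du : ℝ → L2vec n),
      IsEnergySolution μ₁ μ₂ p f g ε T u ut Du ∧ SupportedInCone R T u}

/-! ### Lifespan bounds -/

/-- `s` is a positive solution of
`ε^p s^{γ_F(p, n + (μ₁-1-√δ)/2)/(p-1)} (log (1+s))^c = 1`. -/
def IsMixedTime (n : ℕ) (μ₁ δ p c ε s : ℝ) : Prop :=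
  0 < s ∧
    ε ^ p * s ^ (gammaF p (heatDim n μ₁ δ) / (p - 1)) * (Real.log (1 + s)) ^ c = 1

/-- The equation defining `s = s(ε)` has exactly one positive solution, and `Tε ≤ C s(ε)`. -/
def MixedBound (n : ℕ) (μ₁ δ p c C ε : ℝ) (Tε : ℝ≥0∞) : Prop :=
  (∃! s, IsMixedTime n μ₁ δ p c ε s) ∧
    ∀ s, IsMixedTime n μ₁ δ p c ε s → Tε ≤ ENNReal.ofReal (C * s)

/-- `Tε ≤ C ε^{-2p(p-1)/γ_S(p, n+μ₁)}`. -/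
def WaveBound (n : ℕ) (μ₁ p C ε : ℝ) (Tε : ℝ≥0∞) : Prop :=
  Tε ≤ ENNReal.ofReal (C * ε ^ (-(2 * p * (p - 1)) / gammaS p (n + μ₁)))

end ScaleInvWave

end


/-!
Test an energy solution against the exponential weights `exp (ξ · x)`; the support condition makes
cutoffs unnecessary. For `ξ = 0` the mean `Y` satisfies an Euler-type equation with exponents
`(1 - μ₁ ± √δ) / 2`, so `M = (1 + t) ^ ((μ₁ - 1 + √δ) / 2) * Y` obeys the first order system
`M' = (1 + t) ^ (√δ - 1) G`, `G' = (1 + t) ^ k ∫ |u|^p`, and `h = 0` says precisely that `G`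
vanishes initially.

The source has two lower bounds: Hölder's inequality over the ball of radius `R + t` gives a
multiple of `M ^ p`, and averaging the weights over directions `|ξ| = 1`, which concentrates them
at the light cone, gives `ε ^ p (1 + t) ^ (n - 1 - (n + μ₁ - 1) p / 2)`. Inserted into the system,
the second one makes `M` grow beyond its initial value, which is of order `ε`; according to which
integration dominates, it grows at the wave rate, at the heat rate `ε ^ p (1 + t) ^ √δ`, or at the
heat rate with a logarithm for each of a source in the critical case and `√δ = 0`. The first one
then lets `M` double over shorter and shorter times, so that its value at time `τ / 2` is bounded in
terms of `τ` if the solution survives until `τ`. The four bounds on the lifespan come from the four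
lower bounds on this value.
-/
namespace ScaleInvWave

/-! ### Differential inequalities -/

lemma sub_le_sub_of_hasDerivAt_le {f g f' g' : ℝ → ℝ} {a b : ℝ} (hab : a ≤ b)
    (hf : ContinuousOn f (Icc a b)) (hg : ContinuousOn g (Icc a b))
    (hf' : ∀ t ∈ Ioo a b, HasDerivAt f (f' t) t) (hg' : ∀ t ∈ Ioo a b, HasDerivAt g (g' t) t)
    (hle : ∀ t ∈ Ioo a b, f' t ≤ g' t) : f b - f a ≤ g b - g a := by
  have hmono : MonotoneOn (fun t => g t - f t) (Icc a b) := by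
    refine monotoneOn_of_hasDerivWithinAt_nonneg (f' := fun t => g' t - f' t) (convex_Icc a b)
      (hg.sub hf) (fun t ht => ?_) (fun t ht => ?_) <;> rw [interior_Icc] at ht
    · exact ((hg' t ht).sub (hf' t ht)).hasDerivWithinAt
    · exact sub_nonneg.2 (hle t ht)
  have := hmono (left_mem_Icc.2 hab) (right_mem_Icc.2 hab) hab
  linarith

lemma mul_sub_le_of_le_hasDerivAt {f f' : ℝ → ℝ} {a b c : ℝ} (hab : a ≤ b)
    (hf : ContinuousOn f (Icc a b)) (hf' : ∀ t ∈ Ioo a b, HasDerivAt f (f' t) t)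
    (hc : ∀ t ∈ Ioo a b, c ≤ f' t) : c * (b - a) ≤ f b - f a := by
  have := sub_le_sub_of_hasDerivAt_le hab (continuousOn_const.mul continuousOn_id) hf
    (fun t _ => (hasDerivAt_id t).const_mul c) hf' (by simpa using hc)
  simpa [mul_sub] using this

lemma monotoneOn_of_hasDerivAt_nonneg {f f' : ℝ → ℝ} {a b : ℝ} (hf : ContinuousOn f (Icc a b))
    (hf' : ∀ t ∈ Ioo a b, HasDerivAt f (f' t) t) (hnonneg : ∀ t ∈ Ioo a b, 0 ≤ f' t) :
    MonotoneOn f (Icc a b) :=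
  monotoneOn_of_hasDerivWithinAt_nonneg (convex_Icc a b) hf
    (by simpa only [interior_Icc] using fun t ht => (hf' t ht).hasDerivWithinAt)
    (by simpa only [interior_Icc] using hnonneg)

lemma exists_first_nonpos {X : ℝ → ℝ} {a b t : ℝ} (hX : ContinuousOn X (Icc a b))
    (ht : t ∈ Icc a b) (hXt : X t ≤ 0) :
    ∃ c ∈ Icc a b, X c ≤ 0 ∧ ∀ s ∈ Ico a c, 0 < X s := by
  have hcompact : IsCompact (Icc a b ∩ X ⁻¹' Iic 0) :=
    isCompact_Icc.of_isClosed_subset (hX.preimage_isClosed_of_isClosed isClosed_Icc isClosed_Iic)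
      inter_subset_left
  obtain ⟨c, ⟨hc, hXc⟩, hmin⟩ := hcompact.exists_isLeast ⟨t, ht, hXt⟩
  refine ⟨c, hc, hXc, fun s hs => ?_⟩
  by_contra! hXs
  exact absurd (hmin ⟨⟨hs.1, hs.2.le.trans hc.2⟩, hXs⟩) (not_le.2 hs.2)

lemma monotoneOn_of_cooperative {X W X' W' : ℝ → ℝ} {a b : ℝ}
    (hX : ContinuousOn X (Icc a b)) (hW : ContinuousOn W (Icc a b))
    (hX' : ∀ t ∈ Ioo a b, HasDerivAt X (X' t) t) (hW' : ∀ t ∈ Ioo a b, HasDerivAt W (W' t) t)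
    (hXW : ∀ t ∈ Ioo a b, 0 ≤ W t → 0 ≤ X' t) (hWX : ∀ t ∈ Ioo a b, 0 < X t → 0 ≤ W' t)
    (hXa : 0 < X a) (hWa : 0 ≤ W a) :
    MonotoneOn X (Icc a b) ∧ MonotoneOn W (Icc a b) := by
  have monotone_while_pos : ∀ c ∈ Icc a b, (∀ t ∈ Ico a c, 0 < X t) →
      MonotoneOn X (Icc a c) ∧ MonotoneOn W (Icc a c) := by
    intro c hc hpos
    have hsub : Ioo a c ⊆ Ioo a b := Ioo_subset_Ioo_right hc.2
    have hWmono : MonotoneOn W (Icc a c) :=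
      monotoneOn_of_hasDerivAt_nonneg (hW.mono (Icc_subset_Icc_right hc.2))
        (fun t ht => hW' t (hsub ht)) (fun t ht => hWX t (hsub ht) (hpos t ⟨ht.1.le, ht.2⟩))
    have hWnonneg : ∀ t ∈ Ioo a c, 0 ≤ W t := fun t ht =>
      hWa.trans (hWmono ⟨le_rfl, hc.1⟩ ⟨ht.1.le, ht.2.le⟩ ht.1.le)
    exact ⟨monotoneOn_of_hasDerivAt_nonneg (hX.mono (Icc_subset_Icc_right hc.2))
      (fun t ht => hX' t (hsub ht)) (fun t ht => hXW t (hsub ht) (hWnonneg t ht)), hWmono⟩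
  rcases lt_or_ge b a with hba | hab
  · simp [Icc_eq_empty_of_lt hba, MonotoneOn]
  refine monotone_while_pos b ⟨hab, le_rfl⟩ ?_
  by_contra! hneg
  obtain ⟨t, ht, hXt⟩ := hneg
  obtain ⟨c, hc, hXc, hpos⟩ := exists_first_nonpos hX (Ico_subset_Icc_self ht) hXt
  have := (monotone_while_pos c hc hpos).1 ⟨le_rfl, hc.1⟩ ⟨hc.1, le_rfl⟩ hc.1
  linarith

/-! ### Powers and logarithms of `1 + t` -/

lemma hasDerivAt_one_add_rpow {t : ℝ} (ht : 0 ≤ t) (e : ℝ) :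
    HasDerivAt (fun s : ℝ => (1 + s) ^ e) (e * (1 + t) ^ (e - 1)) t := by
  simpa using ((hasDerivAt_id t).const_add 1).rpow_const (p := e) (Or.inl (by simp; linarith))

lemma hasDerivAt_log_one_add {t : ℝ} (ht : 0 ≤ t) :
    HasDerivAt (fun s : ℝ => Real.log (1 + s)) ((1 + t) ^ (-1 : ℝ)) t := by
  simpa [Real.rpow_neg_one] using
    ((hasDerivAt_id t).const_add 1).log (f := fun s => 1 + s) (by simp; linarith)

lemma continuousOn_log_one_add {a b : ℝ} (ha : 0 ≤ a) :
    ContinuousOn (fun s : ℝ => Real.log (1 + s)) (Icc a b) := fun _ hs =>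
  (hasDerivAt_log_one_add (ha.trans hs.1)).continuousAt.continuousWithinAt

lemma min_one_rpow_le {t s e : ℝ} (ht : 0 ≤ t) (hts : t ≤ s) :
    min 1 ((1 + s) ^ e) ≤ (1 + t) ^ e := by
  rcases le_total 0 e with he | he
  · exact (min_le_left _ _).trans (Real.one_le_rpow (by linarith) he)
  · exact (min_le_right _ _).trans (Real.rpow_le_rpow_of_nonpos (by linarith) (by linarith) he)

lemma four_rpow_neg_abs_mul_rpow_le (e : ℝ) {t τ : ℝ} (ht : 0 ≤ t) (h1 : τ / 4 ≤ t) (h2 : t ≤ τ) :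
    (4 : ℝ) ^ (-|e|) * (1 + τ) ^ e ≤ (1 + t) ^ e := by
  have hτ : 0 ≤ τ := ht.trans h2
  rcases le_total 0 e with he | he
  · rw [abs_of_nonneg he, Real.rpow_neg (by norm_num), mul_comm, ← div_eq_mul_inv,
      ← Real.div_rpow (by linarith) (by norm_num)]
    exact Real.rpow_le_rpow (by positivity) (by linarith) he
  · have h4 : (4 : ℝ) ^ (-|e|) ≤ 1 :=
      Real.rpow_le_one_of_one_le_of_nonpos (by norm_num) (by simp)
    exact (mul_le_of_le_one_left (by positivity) h4).trans
      (Real.rpow_le_rpow_of_nonpos (by linarith) (by linarith) he)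

lemma log_one_add_le_mul_log {m : ℕ} {τ : ℝ} (hτ : 0 ≤ τ) (hm : 0 < m) :
    Real.log (1 + τ) ≤ m * Real.log (1 + τ / m) := by
  have hbernoulli : 1 + m * (τ / m) ≤ (1 + τ / m) ^ m :=
    one_add_mul_le_pow (by linarith [div_nonneg hτ (Nat.cast_nonneg (α := ℝ) m)]) m
  rw [mul_div_cancel₀ _ (by positivity)] at hbernoulli
  simpa only [Real.log_pow] using Real.log_le_log (by linarith) hbernoulli

/-! ### Momentum systems -/

/-- The first order form `M' = (1+t)^j G`, `G' = (1+t)^k N` on `[0,τ]` of a scale-invariantly damped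
second order equation for `M` with source `N`; `G` is the momentum. The source only has to be
nonnegative while `M` is positive, which covers a source containing `M` itself. -/
structure IsMomentumSystem (j k τ : ℝ) (M G N : ℝ → ℝ) : Prop where
  contM : ContinuousOn M (Icc 0 τ)
  contG : ContinuousOn G (Icc 0 τ)
  derivM : ∀ t ∈ Ioo 0 τ, HasDerivAt M ((1 + t) ^ j * G t) t
  derivG : ∀ t ∈ Ioo 0 τ, HasDerivAt G ((1 + t) ^ k * N t) t
  source_nonneg : ∀ t ∈ Ioo 0 τ, 0 < M t → 0 ≤ N t
  posM : 0 < M 0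
  nonnegG : 0 ≤ G 0

namespace IsMomentumSystem

variable {j k τ : ℝ} {M G N : ℝ → ℝ}

lemma monotoneOn (h : IsMomentumSystem j k τ M G N) :
    MonotoneOn M (Icc 0 τ) ∧ MonotoneOn G (Icc 0 τ) :=
  monotoneOn_of_cooperative h.contM h.contG h.derivM h.derivG
    (fun t ht hG => mul_nonneg (Real.rpow_nonneg (by linarith [ht.1]) _) hG)
    (fun t ht hM => mul_nonneg (Real.rpow_nonneg (by linarith [ht.1]) _) (h.source_nonneg t ht hM))
    h.posM h.nonnegG

lemma M_le (h : IsMomentumSystem j k τ M G N) {s t : ℝ} (hs : 0 ≤ s) (hst : s ≤ t) (ht : t ≤ τ) :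
    M s ≤ M t :=
  h.monotoneOn.1 ⟨hs, hst.trans ht⟩ ⟨hs.trans hst, ht⟩ hst

lemma G_le (h : IsMomentumSystem j k τ M G N) {s t : ℝ} (hs : 0 ≤ s) (hst : s ≤ t) (ht : t ≤ τ) :
    G s ≤ G t :=
  h.monotoneOn.2 ⟨hs, hst.trans ht⟩ ⟨hs.trans hst, ht⟩ hst

lemma M_pos (h : IsMomentumSystem j k τ M G N) {t : ℝ} (h0 : 0 ≤ t) (ht : t ≤ τ) : 0 < M t :=
  h.posM.trans_le (h.M_le le_rfl h0 ht)

lemma G_nonneg (h : IsMomentumSystem j k τ M G N) {t : ℝ} (h0 : 0 ≤ t) (ht : t ≤ τ) : 0 ≤ G t :=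
  h.nonnegG.trans (h.G_le le_rfl h0 ht)

lemma sub_le_M_sub (h : IsMomentumSystem j k τ M G N) {a b : ℝ} {g g' : ℝ → ℝ} (ha : 0 ≤ a)
    (hab : a ≤ b) (hb : b ≤ τ) (hg : ContinuousOn g (Icc a b))
    (hg' : ∀ t ∈ Ioo a b, HasDerivAt g (g' t) t) (hle : ∀ t ∈ Ioo a b, g' t ≤ (1 + t) ^ j * G t) :
    g b - g a ≤ M b - M a :=
  sub_le_sub_of_hasDerivAt_le hab hg (h.contM.mono (Icc_subset_Icc ha hb)) hg'
    (fun t ht => h.derivM t ⟨ha.trans_lt ht.1, ht.2.trans_le hb⟩) hle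

lemma sub_le_G_sub (h : IsMomentumSystem j k τ M G N) {a b : ℝ} {g g' : ℝ → ℝ} (ha : 0 ≤ a)
    (hab : a ≤ b) (hb : b ≤ τ) (hg : ContinuousOn g (Icc a b))
    (hg' : ∀ t ∈ Ioo a b, HasDerivAt g (g' t) t) (hle : ∀ t ∈ Ioo a b, g' t ≤ (1 + t) ^ k * N t) :
    g b - g a ≤ G b - G a :=
  sub_le_sub_of_hasDerivAt_le hab hg (h.contG.mono (Icc_subset_Icc ha hb)) hg'
    (fun t ht => h.derivG t ⟨ha.trans_lt ht.1, ht.2.trans_le hb⟩) hle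

lemma mul_le_M_sub (h : IsMomentumSystem j k τ M G N) {a b c : ℝ} (ha : 0 ≤ a) (hab : a ≤ b)
    (hb : b ≤ τ) (hc : ∀ t ∈ Ioo a b, c ≤ (1 + t) ^ j * G t) : c * (b - a) ≤ M b - M a :=
  mul_sub_le_of_le_hasDerivAt hab (h.contM.mono (Icc_subset_Icc ha hb))
    (fun t ht => h.derivM t ⟨ha.trans_lt ht.1, ht.2.trans_le hb⟩) hc

lemma mul_le_G_sub (h : IsMomentumSystem j k τ M G N) {a b c : ℝ} (ha : 0 ≤ a) (hab : a ≤ b)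
    (hb : b ≤ τ) (hc : ∀ t ∈ Ioo a b, c ≤ (1 + t) ^ k * N t) : c * (b - a) ≤ G b - G a :=
  mul_sub_le_of_le_hasDerivAt hab (h.contG.mono (Icc_subset_Icc ha hb))
    (fun t ht => h.derivG t ⟨ha.trans_lt ht.1, ht.2.trans_le hb⟩) hc

end IsMomentumSystem

/-! ### Exponential growth under the source `M` -/

/-- An explicit subsolution of `((1+t)^(2m) M')' = (1+t)^(2m) M` with the sharp growth
`(1+t)^(-m) e^t`; the correction `a/(1+t)` in the exponent absorbs the lower order terms at large
times when `a` is large. -/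
noncomputable def waveSubsolution (m a t : ℝ) : ℝ := (1 + t) ^ (-m) * Real.exp (t + a / (1 + t))

/-- The momentum `(1+t)^(2m) M'` of `M = waveSubsolution m a`. -/
noncomputable def waveSubmomentum (m a t : ℝ) : ℝ :=
  (1 + t) ^ m * (1 - a / (1 + t) ^ 2 - m / (1 + t)) * Real.exp (t + a / (1 + t))

section waveSubsolution

variable {m a t : ℝ}

lemma hasDerivAt_one_add (t : ℝ) : HasDerivAt (fun s : ℝ => 1 + s) 1 t :=
  (hasDerivAt_id t).const_add 1

lemma hasDerivAt_exp_add_div (a : ℝ) (ht : 0 ≤ t) :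
    HasDerivAt (fun s : ℝ => Real.exp (s + a / (1 + s)))
      (Real.exp (t + a / (1 + t)) * (1 - a / (1 + t) ^ 2)) t := by
  have h1 : 1 + t ≠ 0 := by linarith
  refine ((hasDerivAt_id t).add
    ((hasDerivAt_const t a).div (hasDerivAt_one_add t) h1)).exp.congr_deriv ?_
  simp only [id, Pi.add_apply, Pi.div_apply]
  field_simp
  ring

lemma hasDerivAt_waveSubsolution (m a : ℝ) (ht : 0 ≤ t) :
    HasDerivAt (waveSubsolution m a) ((1 + t) ^ (-(2 * m)) * waveSubmomentum m a t) t := by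
  have h1 : 0 < 1 + t := by linarith
  have hsplit : (1 + t) ^ (-(2 * m)) * (1 + t) ^ m = (1 + t) ^ (-m) := by
    rw [← Real.rpow_add h1]; congr 1; ring
  refine ((hasDerivAt_one_add_rpow ht (-m)).mul (hasDerivAt_exp_add_div a ht)).congr_deriv ?_
  rw [waveSubmomentum, Real.rpow_sub_one h1.ne', ← hsplit]
  ring

lemma hasDerivAt_waveSubmomentum (m a : ℝ) (ht : 0 ≤ t) :
    HasDerivAt (waveSubmomentum m a)
      ((1 + t) ^ m * ((1 - a / (1 + t) ^ 2) ^ 2 + 2 * a / (1 + t) ^ 3 - m * (m - 1) / (1 + t) ^ 2)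
        * Real.exp (t + a / (1 + t))) t := by
  have h1 : 1 + t ≠ 0 := by linarith
  have hfactor : HasDerivAt (fun s : ℝ => 1 - a / (1 + s) ^ 2 - m / (1 + s))
      (2 * a / (1 + t) ^ 3 + m / (1 + t) ^ 2) t := by
    refine ((((hasDerivAt_const t a).div ((hasDerivAt_one_add t).pow 2)
      (pow_ne_zero 2 h1)).const_sub 1).sub
        ((hasDerivAt_const t m).div (hasDerivAt_one_add t) h1)).congr_deriv ?_
    simp only [Pi.pow_apply]
    field_simp
    ring
  refine (((hasDerivAt_one_add_rpow ht m).mul hfactor).mul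
    (hasDerivAt_exp_add_div a ht)).congr_deriv ?_
  simp only [Pi.mul_apply]
  rw [Real.rpow_sub_one h1]
  field_simp
  ring

lemma subsolution_coefficient_le_one {x : ℝ} (ha : |m * (m - 1)| + 1 ≤ a) (hx : 4 * a ≤ x) :
    (1 - a / x ^ 2) ^ 2 + 2 * a / x ^ 3 - m * (m - 1) / x ^ 2 ≤ 1 := by
  have hneg := neg_abs_le (m * (m - 1))
  have habs := abs_nonneg (m * (m - 1))
  have hx0 : 0 < x := by linarith
  have hexpand : (1 - a / x ^ 2) ^ 2 + 2 * a / x ^ 3 - m * (m - 1) / x ^ 2 - 1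
      = (-2 * a + a * (a / x ^ 2) + 2 * (a / x) - m * (m - 1)) / x ^ 2 := by
    field_simp; ring
  have h1 : a / x ≤ 1 / 4 := by rw [div_le_iff₀ hx0]; linarith
  have h2 : a / x ^ 2 ≤ 1 / 4 := by rw [div_le_iff₀ (by positivity)]; nlinarith
  have : (-2 * a + a * (a / x ^ 2) + 2 * (a / x) - m * (m - 1)) / x ^ 2 ≤ 0 :=
    div_nonpos_of_nonpos_of_nonneg (by nlinarith) (by positivity)
  linarith

lemma exists_hasDerivAt_waveSubmomentum_le (ha : |m * (m - 1)| + 1 ≤ a) (hat : 4 * a ≤ t) :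
    ∃ G' : ℝ, HasDerivAt (waveSubmomentum m a) G' t ∧
      G' ≤ (1 + t) ^ (2 * m) * waveSubsolution m a t := by
  have ha1 : 1 ≤ a := by linarith [abs_nonneg (m * (m - 1))]
  have h1 : 0 < 1 + t := by linarith
  have hsplit : (1 + t) ^ (2 * m) * (1 + t) ^ (-m) = (1 + t) ^ m := by
    rw [← Real.rpow_add h1]; congr 1; ring
  refine ⟨_, hasDerivAt_waveSubmomentum m a (by linarith), ?_⟩
  rw [waveSubsolution, ← mul_assoc, hsplit]
  gcongr
  exact mul_le_of_le_one_right (by positivity)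
    (subsolution_coefficient_le_one ha (x := 1 + t) (by linarith))

lemma rpow_mul_exp_le_waveSubsolution (ha : 0 ≤ a) (ht : 0 ≤ t) :
    (1 + t) ^ (-m) * Real.exp t ≤ waveSubsolution m a t := by
  have : 0 ≤ a / (1 + t) := by positivity
  rw [waveSubsolution]
  gcongr
  linarith

lemma continuousOn_waveSubsolution (m a : ℝ) {x y : ℝ} (hx : 0 ≤ x) :
    ContinuousOn (waveSubsolution m a) (Icc x y) := fun _ ht =>
  (hasDerivAt_waveSubsolution m a (hx.trans ht.1)).continuousAt.continuousWithinAt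

lemma continuousOn_waveSubmomentum (m a : ℝ) {x y : ℝ} (hx : 0 ≤ x) :
    ContinuousOn (waveSubmomentum m a) (Icc x y) := fun _ ht =>
  (hasDerivAt_waveSubmomentum m a (hx.trans ht.1)).continuousAt.continuousWithinAt

end waveSubsolution

lemma IsMomentumSystem.mul_waveSubsolution_le {m a κ t₀ t τ : ℝ} {M G N : ℝ → ℝ}
    (h : IsMomentumSystem (-(2 * m)) (2 * m) τ M G N) (hMN : ∀ s ∈ Ioo 0 τ, M s ≤ N s)
    (ha : |m * (m - 1)| + 1 ≤ a) (hat : 4 * a ≤ t₀) (hκ : 0 ≤ κ)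
    (hM : κ * waveSubsolution m a t₀ < M t₀) (hG : κ * waveSubmomentum m a t₀ ≤ G t₀)
    (ht : t ∈ Icc t₀ τ) : κ * waveSubsolution m a t ≤ M t := by
  have ht₀ : 0 < t₀ := by linarith [ha, abs_nonneg (m * (m - 1))]
  have hsub : Icc t₀ τ ⊆ Icc 0 τ := Icc_subset_Icc_left ht₀.le
  have hsub' : Ioo t₀ τ ⊆ Ioo 0 τ := Ioo_subset_Ioo_left ht₀.le
  choose! G' hG' hG'le using fun s (hs : 4 * a ≤ s) => exists_hasDerivAt_waveSubmomentum_le ha hs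
  have h4a {s : ℝ} (hs : s ∈ Ioo t₀ τ) : 4 * a ≤ s := hat.trans hs.1.le
  have hmono := (monotoneOn_of_cooperative
    (X := fun s => M s - κ * waveSubsolution m a s) (W := fun s => G s - κ * waveSubmomentum m a s)
    ((h.contM.mono hsub).sub (continuousOn_const.mul (continuousOn_waveSubsolution m a ht₀.le)))
    ((h.contG.mono hsub).sub (continuousOn_const.mul (continuousOn_waveSubmomentum m a ht₀.le)))
    (fun s hs => (h.derivM s (hsub' hs)).sub
      ((hasDerivAt_waveSubsolution m a (hsub' hs).1.le).const_mul κ))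
    (fun s hs => (h.derivG s (hsub' hs)).sub ((hG' s (h4a hs)).const_mul κ))
    (fun s hs hW => ?_) (fun s hs hX => ?_) (sub_pos.2 hM) (sub_nonneg.2 hG)).1
  · linarith [hmono ⟨le_rfl, ht.1.trans ht.2⟩ ht ht.1]
  · have hpos : 0 < 1 + s := by linarith [(hsub' hs).1]
    have := mul_nonneg (Real.rpow_nonneg hpos.le (-(2 * m))) hW
    linarith
  · have hpos : 0 < 1 + s := by linarith [(hsub' hs).1]
    have hN : (1 + s) ^ (2 * m) * (κ * waveSubsolution m a s) ≤ (1 + s) ^ (2 * m) * N s := by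
      gcongr
      linarith [hMN s (hsub' hs)]
    linarith [mul_le_mul_of_nonneg_left (hG'le s (h4a hs)) hκ]

lemma IsMomentumSystem.mul_le_momentum {m t₀ τ : ℝ} {M G N : ℝ → ℝ}
    (h : IsMomentumSystem (-(2 * m)) (2 * m) τ M G N) (hMN : ∀ s ∈ Ioo 0 τ, M s ≤ N s)
    (ht₀ : t₀ ∈ Icc 0 τ) : min 1 ((1 + t₀) ^ (2 * m)) * M 0 * t₀ ≤ G t₀ := by
  have hgrowth := h.mul_le_G_sub (c := min 1 ((1 + t₀) ^ (2 * m)) * M 0) le_rfl ht₀.1 ht₀.2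
    fun s hs => mul_le_mul (min_one_rpow_le hs.1.le hs.2.le)
      ((h.M_le le_rfl hs.1.le (hs.2.le.trans ht₀.2)).trans
        (hMN s ⟨hs.1, hs.2.trans_le ht₀.2⟩))
      h.posM.le (Real.rpow_nonneg (by linarith [hs.1]) _)
  linarith [h.nonnegG]

lemma exists_mul_exp_le_of_momentumSystem (m : ℝ) : ∃ c : ℝ, 0 < c ∧
    ∀ (τ : ℝ) (M G N : ℝ → ℝ), IsMomentumSystem (-(2 * m)) (2 * m) τ M G N →
      (∀ t ∈ Ioo 0 τ, M t ≤ N t) →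
      ∀ t ∈ Icc 0 τ, c * M 0 * ((1 + t) ^ (-m) * Real.exp t) ≤ M t := by
  set a : ℝ := |m * (m - 1)| + 1 with ha
  have ha1 : 1 ≤ a := by linarith [ha, abs_nonneg (m * (m - 1))]
  set t₀ : ℝ := 4 * a with ht₀
  have ht₀0 : 0 < t₀ := by linarith [ht₀]
  set b : ℝ := min 1 ((1 + t₀) ^ (2 * m))
  have hb0 : 0 < b := lt_min one_pos (by positivity)
  obtain ⟨K, hK⟩ := isCompact_Icc.exists_bound_of_continuousOn
    (continuousOn_waveSubsolution m a le_rfl (y := t₀))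
  -- `D` dominates the subsolution on `[0, t₀]` and its momentum at `t₀`.
  set D : ℝ := 1 + |K| + |waveSubmomentum m a t₀| / (b * t₀) with hD
  have hquot : 0 ≤ |waveSubmomentum m a t₀| / (b * t₀) := by positivity
  have hD0 : 0 < D := by linarith [hD, abs_nonneg K]
  have hsub_lt : ∀ t ∈ Icc 0 t₀, waveSubsolution m a t < D := fun t ht => by
    linarith [(le_abs_self _).trans (hK t ht), le_abs_self K]
  have hsubmom_le : waveSubmomentum m a t₀ ≤ D * (b * t₀) := by
    refine (le_abs_self _).trans ((div_le_iff₀ (by positivity)).1 ?_)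
    linarith [abs_nonneg K]
  refine ⟨D⁻¹, by positivity, fun τ M G N h hMN t ht => ?_⟩
  have hκ : 0 < D⁻¹ * M 0 := mul_pos (inv_pos.2 hD0) h.posM
  have hearly : ∀ s ∈ Icc 0 τ, s ≤ t₀ → D⁻¹ * M 0 * waveSubsolution m a s < M s := fun s hs hst =>
    calc D⁻¹ * M 0 * waveSubsolution m a s < D⁻¹ * M 0 * D := by
          gcongr
          exact hsub_lt s ⟨hs.1, hst⟩
      _ = M 0 := by field_simp
      _ ≤ M s := h.M_le le_rfl hs.1 hs.2
  refine (mul_le_mul_of_nonneg_left (rpow_mul_exp_le_waveSubsolution (zero_le_one.trans ha1) ht.1)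
    hκ.le).trans ?_
  rcases le_total t t₀ with htt | htt
  · exact (hearly t ht htt).le
  have ht₀τ : t₀ ∈ Icc 0 τ := ⟨ht₀0.le, htt.trans ht.2⟩
  refine h.mul_waveSubsolution_le hMN le_rfl le_rfl hκ.le (hearly t₀ ht₀τ le_rfl) ?_ ⟨htt, ht.2⟩
  calc D⁻¹ * M 0 * waveSubmomentum m a t₀ ≤ D⁻¹ * M 0 * (D * (b * t₀)) := by gcongr
    _ = b * M 0 * t₀ := by field_simp
    _ ≤ G t₀ := h.mul_le_momentum hMN ht₀τ

/-! ### Kato's lemma -/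

/-- Integrated form, over `[s,τ]`, of the differential inequalities `X' ≥ a Y`, `Y' ≥ b X^p` for
functions that increase: each increment is controlled by the value at its left endpoint. -/
structure IsKatoPair (a b p s τ : ℝ) (X Y : ℝ → ℝ) : Prop where
  growthX : ∀ t₁ t₂, s ≤ t₁ → t₁ ≤ t₂ → t₂ ≤ τ → a * (t₂ - t₁) * Y t₁ ≤ X t₂ - X t₁
  growthY : ∀ t₁ t₂, s ≤ t₁ → t₁ ≤ t₂ → t₂ ≤ τ → b * (t₂ - t₁) * X t₁ ^ p ≤ Y t₂ - Y t₁

/-- A time within which a Kato pair doubles its first component from the value `y`. -/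
noncomputable def doublingTime (a b p y : ℝ) : ℝ := 2 / √(a * b * y ^ (p - 1))

/-- The factor by which the doubling time shrinks at each doubling. -/
noncomputable def doublingRatio (p : ℝ) : ℝ := (√(2 ^ (p - 1)))⁻¹

lemma doublingRatio_lt_one {p : ℝ} (hp : 1 < p) : doublingRatio p < 1 :=
  inv_lt_one_of_one_lt₀ (Real.lt_sqrt_of_sq_lt
    (by simpa using Real.one_lt_rpow one_lt_two (sub_pos.2 hp)))

section Kato

variable {a b p s τ t y : ℝ} {X Y : ℝ → ℝ}

lemma doublingTime_pos (ha : 0 < a) (hb : 0 < b) (hy : 0 < y) : 0 < doublingTime a b p y := by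
  unfold doublingTime; positivity

lemma mul_doublingTime_sq (ha : 0 < a) (hb : 0 < b) (hy : 0 < y) :
    a * b * y ^ (p - 1) * doublingTime a b p y ^ 2 = 4 := by
  rw [doublingTime, div_pow, Real.sq_sqrt (by positivity)]
  field_simp
  norm_num

lemma doublingTime_two_mul (hy : 0 < y) :
    doublingTime a b p (2 * y) = doublingRatio p * doublingTime a b p y := by
  have h2 : (0 : ℝ) ≤ 2 ^ (p - 1) := by positivity
  rw [doublingTime, doublingTime, doublingRatio, Real.mul_rpow two_pos.le hy.le, mul_left_comm,
    Real.sqrt_mul h2, div_mul_eq_div_div, div_right_comm, div_eq_inv_mul]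

lemma IsKatoPair.doubling (h : IsKatoPair a b p s τ X Y) (ha : 0 < a) (hb : 0 < b) (hp : 0 ≤ p)
    (hy : 0 < y) (hst : s ≤ t) (htτ : t + doublingTime a b p y ≤ τ) (hX : y ≤ X t)
    (hY : 0 ≤ Y t) :
    2 * y ≤ X (t + doublingTime a b p y) ∧ 0 ≤ Y (t + doublingTime a b p y) := by
  have hdpos := doublingTime_pos (p := p) ha hb hy
  have hd2 := mul_doublingTime_sq (p := p) ha hb hy
  set d := doublingTime a b p y
  have hXp : y ^ p ≤ X t ^ p := Real.rpow_le_rpow hy.le hX hp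
  have hyp : y ^ p = y ^ (p - 1) * y := by rw [← Real.rpow_add_one hy.ne']; simp
  have hYgrow (r : ℝ) (hr : 0 ≤ r) (hrd : r ≤ d) : b * r * y ^ p ≤ Y (t + r) := by
    have := h.growthY t (t + r) hst (by linarith) (by linarith)
    rw [add_sub_cancel_left] at this
    have : b * r * y ^ p ≤ b * r * X t ^ p := by gcongr
    linarith
  have hXstart := h.growthX t (t + d / 2) hst (by linarith) (by linarith)
  have hXend := h.growthX (t + d / 2) (t + d) (by linarith) (by linarith) htτ
  rw [show t + d / 2 - t = d / 2 by ring] at hXstart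
  rw [show t + d - (t + d / 2) = d / 2 by ring] at hXend
  refine ⟨?_, (by positivity : 0 ≤ b * d * y ^ p).trans (hYgrow d hdpos.le le_rfl)⟩
  have hXstart0 : 0 ≤ a * (d / 2) * Y t := by positivity
  have hgain : y ≤ a * (d / 2) * Y (t + d / 2) :=
    calc y = a * (d / 2) * (b * (d / 2) * y ^ p) := by
          rw [hyp]; linear_combination (-(y / 4)) * hd2
      _ ≤ a * (d / 2) * Y (t + d / 2) := by
          gcongr; exact hYgrow (d / 2) (by linarith) (by linarith)
  linarith

/-- The successive doubling times form a geometric series with sum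
`doublingTime / (1 - doublingRatio)`; if it fitted into `[s,τ]`, then `X τ` would be infinite. -/
lemma IsKatoPair.length_lt (h : IsKatoPair a b p s τ X Y) (ha : 0 < a) (hb : 0 < b) (hp : 1 < p)
    (hy : 0 < y) (hX : y ≤ X s) (hY : 0 ≤ Y s) :
    τ - s < doublingTime a b p y / (1 - doublingRatio p) := by
  by_contra! hfit
  have hr : 0 < 1 - doublingRatio p := sub_pos.2 (doublingRatio_lt_one hp)
  have hiterate (j : ℕ) : ∃ t, s ≤ t ∧ 2 ^ j * y ≤ X t ∧ 0 ≤ Y t ∧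
      doublingTime a b p (2 ^ j * y) / (1 - doublingRatio p) ≤ τ - t := by
    induction j with
    | zero => exact ⟨s, le_rfl, by simpa, hY, by simpa⟩
    | succ j ih =>
      obtain ⟨t, hst, hXt, hYt, hroom⟩ := ih
      have hz : 0 < 2 ^ j * y := by positivity
      have hdpos := doublingTime_pos (p := p) ha hb hz
      have hsplit : doublingTime a b p (2 ^ j * y) / (1 - doublingRatio p)
          = doublingTime a b p (2 ^ j * y)
            + doublingTime a b p (2 * (2 ^ j * y)) / (1 - doublingRatio p) := by
        rw [doublingTime_two_mul hz]; field_simp; ring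
      have hrest :=
        div_pos (doublingTime_pos (p := p) ha hb (by positivity : 0 < 2 * (2 ^ j * y))) hr
      obtain ⟨hX', hY'⟩ := h.doubling ha hb (by linarith) hz hst (by linarith) hXt hYt
      rw [pow_succ', mul_assoc]
      exact ⟨_, by linarith, hX', hY', by linarith⟩
  obtain ⟨j, hj⟩ := pow_unbounded_of_one_lt (X τ / y) one_lt_two
  rw [div_lt_iff₀ hy] at hj
  obtain ⟨t, hst, hXt, hYt, hroom⟩ := hiterate j
  have htτ : 0 < τ - t :=
    (div_pos (doublingTime_pos (p := p) ha hb (by positivity : 0 < 2 ^ j * y)) hr).trans_le hroom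
  have hgrow := h.growthX t τ hst (by linarith) le_rfl
  have : 0 ≤ a * (τ - t) * Y t := by positivity
  linarith

lemma IsKatoPair.mul_rpow_mul_sq_le (h : IsKatoPair a b p s τ X Y) (ha : 0 < a) (hb : 0 < b)
    (hp : 1 < p) (hsτ : s ≤ τ) (hX : 0 < X s) (hY : 0 ≤ Y s) :
    a * b * X s ^ (p - 1) * (τ - s) ^ 2 ≤ 4 / (1 - doublingRatio p) ^ 2 := by
  have hlen := h.length_lt ha hb hp hX le_rfl hY
  have := sub_nonneg.2 hsτ
  calc a * b * X s ^ (p - 1) * (τ - s) ^ 2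
      ≤ a * b * X s ^ (p - 1) * (doublingTime a b p (X s) / (1 - doublingRatio p)) ^ 2 := by gcongr
    _ = 4 / (1 - doublingRatio p) ^ 2 := by
      rw [div_pow, ← mul_div_assoc, mul_doublingTime_sq ha hb hX]

end Kato

/-! ### Momentum systems with a power source -/

namespace IsMomentumSystem

variable {j k e d p c A B τ : ℝ} {M G N : ℝ → ℝ}

lemma rpow_mul_le_M_sub (h : IsMomentumSystem j k τ M G N) (hτ : 0 ≤ τ) {t₁ t₂ : ℝ}
    (h0 : τ / 4 ≤ t₁) (h1 : t₁ ≤ t₂) (h2 : t₂ ≤ τ) :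
    4 ^ (-|j|) * (1 + τ) ^ j * (t₂ - t₁) * G t₁ ≤ M t₂ - M t₁ := by
  have ht₁ : 0 ≤ t₁ := by linarith
  have := h.mul_le_M_sub (c := 4 ^ (-|j|) * (1 + τ) ^ j * G t₁) ht₁ h1 h2 fun t ht =>
    mul_le_mul
      (four_rpow_neg_abs_mul_rpow_le j (ht₁.trans ht.1.le) (h0.trans ht.1.le) (ht.2.le.trans h2))
      (h.G_le ht₁ ht.1.le (ht.2.le.trans h2)) (h.G_nonneg ht₁ (h1.trans h2))
      (Real.rpow_nonneg (by linarith [ht.1]) _)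
  linarith

lemma rpow_mul_le_G_sub (h : IsMomentumSystem j k τ M G N) (hτ : 0 ≤ τ) (hB : 0 ≤ B) {t₁ t₂ : ℝ}
    (h0 : τ / 4 ≤ t₁) (h1 : t₁ ≤ t₂) (h2 : t₂ ≤ τ) (hN : ∀ t ∈ Ioo t₁ t₂, B * (1 + t) ^ e ≤ N t) :
    4 ^ (-|k + e|) * (1 + τ) ^ (k + e) * (t₂ - t₁) * B ≤ G t₂ - G t₁ := by
  have ht₁ : 0 ≤ t₁ := by linarith
  have := h.mul_le_G_sub (c := 4 ^ (-|k + e|) * (1 + τ) ^ (k + e) * B) ht₁ h1 h2 fun t ht => by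
    have ht0 : 0 < 1 + t := by linarith [ht.1]
    calc 4 ^ (-|k + e|) * (1 + τ) ^ (k + e) * B ≤ (1 + t) ^ (k + e) * B := by
          gcongr
          exact four_rpow_neg_abs_mul_rpow_le _ (ht₁.trans ht.1.le) (h0.trans ht.1.le)
            (ht.2.le.trans h2)
      _ = (1 + t) ^ k * (B * (1 + t) ^ e) := by rw [Real.rpow_add ht0]; ring
      _ ≤ (1 + t) ^ k * N t := by gcongr; exact hN t ht
  linarith

lemma isKatoPair (h : IsMomentumSystem j k τ M G N) (hτ : 0 ≤ τ) (hp : 0 ≤ p) (hc : 0 ≤ c)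
    (hN : ∀ t ∈ Ioo 0 τ, c * (1 + t) ^ e * M t ^ p ≤ N t) :
    IsKatoPair (4 ^ (-|j|) * (1 + τ) ^ j) (4 ^ (-|k + e|) * (1 + τ) ^ (k + e) * c) p (τ / 2) τ
      M G where
  growthX _ _ h0 h1 h2 := h.rpow_mul_le_M_sub hτ (by linarith) h1 h2
  growthY t₁ t₂ h0 h1 h2 := by
    have ht₁ : 0 ≤ t₁ := by linarith
    have hM₁ : 0 ≤ M t₁ := (h.M_pos ht₁ (h1.trans h2)).le
    have := h.rpow_mul_le_G_sub (e := e) (B := c * M t₁ ^ p) hτ (by positivity) (by linarith) h1 h2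
      fun t ht => by
        have ht0 : 0 ≤ 1 + t := by linarith [ht.1]
        calc c * M t₁ ^ p * (1 + t) ^ e = c * (1 + t) ^ e * M t₁ ^ p := by ring
          _ ≤ c * (1 + t) ^ e * M t ^ p := by
            gcongr
            exact h.M_le ht₁ ht.1.le (ht.2.le.trans h2)
          _ ≤ N t := hN t ⟨ht₁.trans_lt ht.1, ht.2.trans_le h2⟩
    linarith

lemma exists_M_half_mul_rpow_le (j k e : ℝ) (hp : 1 < p) (hc : 0 < c) :
    ∃ C : ℝ, ∀ (τ : ℝ) (M G N : ℝ → ℝ), 1 ≤ τ → IsMomentumSystem j k τ M G N →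
      (∀ t ∈ Ioo 0 τ, c * (1 + t) ^ e * M t ^ p ≤ N t) →
      M (τ / 2) * (1 + τ) ^ ((j + 2 + k + e) / (p - 1)) ≤ C := by
  have hp1 : 0 < p - 1 := by linarith
  have : 0 < 1 - doublingRatio p := sub_pos.2 (doublingRatio_lt_one hp)
  set K := 4 / (1 - doublingRatio p) ^ 2
  set a : ℝ := 4 ^ (-|j|)
  set b : ℝ := 4 ^ (-|k + e|)
  have : 0 < a := by positivity
  have : 0 < b := by positivity
  refine ⟨(16 * K / (a * b * c)) ^ (p - 1)⁻¹, fun τ M G N hτ h hN => ?_⟩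
  have hS : 0 < 1 + τ := by linarith
  have hM : 0 < M (τ / 2) := h.M_pos (by linarith) (by linarith)
  have hkato := (h.isKatoPair (by linarith) (by linarith) hc.le hN).mul_rpow_mul_sq_le
    (by positivity) (by positivity) hp (by linarith) hM (h.G_nonneg (by linarith) (by linarith))
  have hexp : (1 + τ) ^ j * (1 + τ) ^ (k + e) * (1 + τ) ^ 2 = (1 + τ) ^ (j + 2 + k + e) := by
    rw [← Real.rpow_natCast, ← Real.rpow_add hS, ← Real.rpow_add hS]
    congr 1; push_cast; ring
  have hpow : M (τ / 2) ^ (p - 1) * (1 + τ) ^ (j + 2 + k + e) ≤ 16 * K / (a * b * c) := by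
    rw [le_div_iff₀ (by positivity), ← hexp]
    calc M (τ / 2) ^ (p - 1) * ((1 + τ) ^ j * (1 + τ) ^ (k + e) * (1 + τ) ^ 2) * (a * b * c)
        = a * (1 + τ) ^ j * (b * (1 + τ) ^ (k + e) * c) * M (τ / 2) ^ (p - 1) * (1 + τ) ^ 2 := by
          ring
      _ ≤ a * (1 + τ) ^ j * (b * (1 + τ) ^ (k + e) * c) * M (τ / 2) ^ (p - 1)
            * (16 * (τ - τ / 2) ^ 2) := by gcongr; nlinarith
      _ ≤ 16 * K := by linarith
  calc M (τ / 2) * (1 + τ) ^ ((j + 2 + k + e) / (p - 1))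
      = (M (τ / 2) ^ (p - 1) * (1 + τ) ^ (j + 2 + k + e)) ^ (p - 1)⁻¹ := by
        rw [Real.mul_rpow (by positivity) (by positivity), Real.rpow_rpow_inv hM.le hp1.ne',
          ← Real.rpow_mul hS.le, div_eq_mul_inv (j + 2 + k + e)]
    _ ≤ (16 * K / (a * b * c)) ^ (p - 1)⁻¹ := by gcongr

lemma mul_rpow_le_M_half (h : IsMomentumSystem j k τ M G N) (hτ : 1 ≤ τ) (hA : 0 ≤ A)
    (hN : ∀ t ∈ Ioo 0 τ, A * (1 + t) ^ d ≤ N t) :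
    4 ^ (-|j|) * 4 ^ (-|k + d|) / 256 * (A * (1 + τ) ^ (k + d + j + 2)) ≤ M (τ / 2) := by
  have hS : 0 < 1 + τ := by linarith
  have hG := h.rpow_mul_le_G_sub (t₁ := τ / 4) (t₂ := 3 * τ / 8) (by linarith) hA le_rfl
    (by linarith) (by linarith) fun t ht => hN t ⟨by linarith [ht.1], by linarith [ht.2]⟩
  have hM := h.rpow_mul_le_M_sub (t₁ := 3 * τ / 8) (t₂ := τ / 2) (by linarith) (by linarith)
    (by linarith) (by linarith)
  have hG0 := h.G_nonneg (t := τ / 4) (by linarith) (by linarith)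
  have hM0 := h.M_pos (t := 3 * τ / 8) (by linarith) (by linarith)
  rw [show 3 * τ / 8 - τ / 4 = τ / 8 by ring] at hG
  rw [show τ / 2 - 3 * τ / 8 = τ / 8 by ring] at hM
  set a : ℝ := 4 ^ (-|j|)
  set b : ℝ := 4 ^ (-|k + d|)
  have : 0 < a := by positivity
  have : 0 < b := by positivity
  have hexp : (1 + τ) ^ (k + d + j + 2) = (1 + τ) ^ j * (1 + τ) ^ (k + d) * (1 + τ) ^ 2 := by
    rw [← Real.rpow_natCast, ← Real.rpow_add hS, ← Real.rpow_add hS]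
    congr 1; push_cast; ring
  calc a * b / 256 * (A * (1 + τ) ^ (k + d + j + 2))
      = a * b / 256 * A * ((1 + τ) ^ j * (1 + τ) ^ (k + d)) * (1 + τ) ^ 2 := by rw [hexp]; ring
    _ ≤ a * b / 256 * A * ((1 + τ) ^ j * (1 + τ) ^ (k + d)) * (256 * (τ / 8) ^ 2) := by
        gcongr; nlinarith
    _ = a * (1 + τ) ^ j * (τ / 8) * (b * (1 + τ) ^ (k + d) * (τ / 8) * A) := by ring
    _ ≤ a * (1 + τ) ^ j * (τ / 8) * G (3 * τ / 8) := by gcongr; linarith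
    _ ≤ M (τ / 2) := by linarith

lemma mul_rpow_le_M_half_of_le_G (h : IsMomentumSystem j k τ M G N) (hτ : 1 ≤ τ) (hB : 0 ≤ B)
    (hG : B ≤ G (τ / 4)) : 4 ^ (-|j|) / 8 * (B * (1 + τ) ^ (j + 1)) ≤ M (τ / 2) := by
  have hS : 0 < 1 + τ := by linarith
  have hM := h.rpow_mul_le_M_sub (t₁ := τ / 4) (t₂ := τ / 2) (by linarith) (by linarith)
    (by linarith) (by linarith)
  have hM0 := h.M_pos (t := τ / 4) (by linarith) (by linarith)
  rw [show τ / 2 - τ / 4 = τ / 4 by ring] at hM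
  set a : ℝ := 4 ^ (-|j|)
  have : 0 < a := by positivity
  calc a / 8 * (B * (1 + τ) ^ (j + 1)) = a * (1 + τ) ^ j * ((1 + τ) / 8) * B := by
        rw [Real.rpow_add_one hS.ne']; ring
    _ ≤ a * (1 + τ) ^ j * (τ / 4) * G (τ / 4) := by
        have : (1 + τ) / 8 ≤ τ / 4 := by linarith
        gcongr
    _ ≤ M (τ / 2) := by linarith

lemma mul_le_G (h : IsMomentumSystem j k τ M G N) (hA : 0 ≤ A)
    (hN : ∀ t ∈ Ioo 0 τ, A * (1 + t) ^ d ≤ N t) {t : ℝ} (ht : t ∈ Icc 1 τ) :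
    min 1 (2 ^ (k + d)) * A ≤ G t := by
  have hτ : 1 ≤ τ := ht.1.trans ht.2
  have := h.mul_le_G_sub (c := min 1 (2 ^ (k + d)) * A) le_rfl zero_le_one hτ fun s hs => by
    have hs0 : 0 < 1 + s := by linarith [hs.1]
    calc min 1 (2 ^ (k + d)) * A ≤ (1 + s) ^ (k + d) * A := by
          gcongr
          simpa only [one_add_one_eq_two] using min_one_rpow_le (e := k + d) hs.1.le hs.2.le
      _ = (1 + s) ^ k * (A * (1 + s) ^ d) := by rw [Real.rpow_add hs0]; ring
      _ ≤ (1 + s) ^ k * N s := by gcongr; exact hN s ⟨hs.1, hs.2.trans_le hτ⟩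
  linarith [h.nonnegG, h.G_le zero_le_one ht.1 ht.2]

lemma mul_log_le_G (h : IsMomentumSystem j k τ M G N) (hkd : k + d = -1)
    (hN : ∀ t ∈ Ioo 0 τ, A * (1 + t) ^ d ≤ N t) {t : ℝ} (ht : t ∈ Icc 0 τ) :
    A * Real.log (1 + t) ≤ G t := by
  have := h.sub_le_G_sub (g := fun s => A * Real.log (1 + s)) le_rfl ht.1 ht.2
    (continuousOn_const.mul (continuousOn_log_one_add le_rfl))
    (fun s hs => (hasDerivAt_log_one_add hs.1.le).const_mul A) fun s hs => by
      have hs0 : 0 < 1 + s := by linarith [hs.1]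
      calc A * (1 + s) ^ (-1 : ℝ) = (1 + s) ^ k * (A * (1 + s) ^ d) := by
            rw [← hkd, Real.rpow_add hs0]; ring
        _ ≤ (1 + s) ^ k * N s := by gcongr; exact hN s ⟨hs.1, hs.2.trans_le ht.2⟩
  simp only [add_zero, Real.log_one, mul_zero, sub_zero] at this
  linarith [h.nonnegG]

lemma mul_log_le_M_half (h : IsMomentumSystem (-1) k τ M G N) (hτ : 15 ≤ τ) (hB : 0 ≤ B)
    (hG : ∀ t ∈ Icc 1 τ, B ≤ G t) : B * Real.log (1 + τ) / 4 ≤ M (τ / 2) := by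
  have hgrow := h.sub_le_M_sub (a := 1) (b := τ / 2) (g := fun s => B * Real.log (1 + s))
    zero_le_one (by linarith) (by linarith)
    (continuousOn_const.mul (continuousOn_log_one_add zero_le_one))
    (fun s hs => (hasDerivAt_log_one_add (by linarith [hs.1])).const_mul B) fun s hs => by
      rw [mul_comm]
      have hs0 : 0 ≤ 1 + s := by linarith [hs.1]
      gcongr
      exact hG s ⟨hs.1.le, by linarith [hs.2]⟩
  have hhalf := log_one_add_le_mul_log (by linarith : 0 ≤ τ) two_pos
  have hsixteen : 4 * Real.log 2 ≤ Real.log (1 + τ) := by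
    simpa using Real.log_le_log (by norm_num) (show (2 : ℝ) ^ 4 ≤ 1 + τ by linarith)
  rw [one_add_one_eq_two] at hgrow
  push_cast at hhalf
  have : B * (Real.log (1 + τ) / 4) ≤ B * (Real.log (1 + τ / 2) - Real.log 2) := by
    gcongr; linarith
  linarith [h.M_pos zero_le_one (by linarith : (1 : ℝ) ≤ τ)]

lemma mul_log_sq_le_M_half (h : IsMomentumSystem (-1) k τ M G N) (hτ : 0 ≤ τ) (hA : 0 ≤ A)
    (hG : ∀ t ∈ Icc 0 τ, A * Real.log (1 + t) ≤ G t) :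
    A * Real.log (1 + τ) ^ 2 / 8 ≤ M (τ / 2) := by
  have hgrow := h.sub_le_M_sub (a := 0) (b := τ / 2) (g := fun s => A / 2 * Real.log (1 + s) ^ 2)
    le_rfl (by linarith) (by linarith)
    (continuousOn_const.mul ((continuousOn_log_one_add le_rfl).pow 2))
    (fun s hs => ((hasDerivAt_log_one_add hs.1.le).pow 2).const_mul (A / 2)) fun s hs => by
      have hs0 : 0 ≤ 1 + s := by linarith [hs.1]
      calc A / 2 * ((2 : ℕ) * Real.log (1 + s) ^ (2 - 1) * (1 + s) ^ (-1 : ℝ))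
          = (1 + s) ^ (-1 : ℝ) * (A * Real.log (1 + s)) := by push_cast; ring
        _ ≤ (1 + s) ^ (-1 : ℝ) * G s := by gcongr; exact hG s ⟨hs.1.le, by linarith [hs.2]⟩
  have hhalf := log_one_add_le_mul_log hτ two_pos
  push_cast at hhalf
  have hlog : 0 ≤ Real.log (1 + τ) := Real.log_nonneg (by linarith)
  have hsq : A * Real.log (1 + τ) ^ 2 ≤ A * (2 * Real.log (1 + τ / 2)) ^ 2 := by gcongr
  simp only [add_zero, Real.log_one, ne_eq, OfNat.ofNat_ne_zero, not_false_eq_true, zero_pow,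
    mul_zero, sub_zero] at hgrow
  linarith [h.posM]

end IsMomentumSystem

section Heat

variable {σ : ℝ}

lemma exists_mul_rpow_mul_log_le_M_half (k d : ℝ) (hσ : 0 ≤ σ) : ∃ c : ℝ, 0 < c ∧
    ∀ (τ A : ℝ) (M G N : ℝ → ℝ), 15 ≤ τ → 0 ≤ A → IsMomentumSystem (σ - 1) k τ M G N →
      (∀ t ∈ Ioo 0 τ, A * (1 + t) ^ d ≤ N t) →
      c * (A * (1 + τ) ^ σ * Real.log (1 + τ) ^ (1 - Real.sign σ)) ≤ M (τ / 2) := by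
  set b : ℝ := min 1 (2 ^ (k + d))
  have : 0 < b := by positivity
  rcases hσ.eq_or_lt with rfl | hσ0
  · refine ⟨b / 4, by positivity, fun τ A M G N hτ hA h hN => ?_⟩
    rw [zero_sub] at h
    rw [Real.sign_zero, sub_zero, Real.rpow_one, Real.rpow_zero, mul_one]
    have := h.mul_log_le_M_half hτ (B := b * A) (by positivity) fun t ht => h.mul_le_G hA hN ht
    linarith
  · refine ⟨4 ^ (-|σ - 1|) / 8 * b, by positivity, fun τ A M G N hτ hA h hN => ?_⟩
    rw [Real.sign_of_pos hσ0, sub_self, Real.rpow_zero, mul_one]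
    have := h.mul_rpow_le_M_half_of_le_G (by linarith) (B := b * A) (by positivity)
      (h.mul_le_G hA hN ⟨by linarith, by linarith⟩)
    rw [sub_add_cancel] at this
    linarith

lemma exists_mul_rpow_mul_log_le_M_half_of_add_eq (k d : ℝ) (hσ : 0 ≤ σ) (hkd : k + d = -1) :
    ∃ c : ℝ, 0 < c ∧
    ∀ (τ A : ℝ) (M G N : ℝ → ℝ), 15 ≤ τ → 0 ≤ A → IsMomentumSystem (σ - 1) k τ M G N →
      (∀ t ∈ Ioo 0 τ, A * (1 + t) ^ d ≤ N t) →
      c * (A * (1 + τ) ^ σ * Real.log (1 + τ) ^ (2 - Real.sign σ)) ≤ M (τ / 2) := by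
  rcases hσ.eq_or_lt with rfl | hσ0
  · refine ⟨1 / 8, by norm_num, fun τ A M G N hτ hA h hN => ?_⟩
    rw [zero_sub] at h
    rw [Real.sign_zero, sub_zero, Real.rpow_two, Real.rpow_zero, mul_one]
    have := h.mul_log_sq_le_M_half (by linarith) hA fun t ht => h.mul_log_le_G hkd hN ht
    linarith
  · refine ⟨4 ^ (-|σ - 1|) / 8 / 4, by positivity, fun τ A M G N hτ hA h hN => ?_⟩
    rw [Real.sign_of_pos hσ0, show (2 : ℝ) - 1 = 1 by norm_num, Real.rpow_one]
    have hquarter : A * Real.log (1 + τ) / 4 ≤ A * Real.log (1 + τ / 4) := by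
      have := mul_le_mul_of_nonneg_left
        (log_one_add_le_mul_log (by linarith : 0 ≤ τ) four_pos) hA
      push_cast at this
      linarith
    have hlog : 0 ≤ Real.log (1 + τ) := Real.log_nonneg (by linarith)
    have := h.mul_rpow_le_M_half_of_le_G (by linarith) (B := A * Real.log (1 + τ) / 4)
      (by positivity) (hquarter.trans (h.mul_log_le_G hkd hN ⟨by linarith, by linarith⟩))
    rw [sub_add_cancel] at this
    linarith

end Heat

/-- A momentum system `M' = (1+t)^(σ-1) G`, `G' = (1+t)^k N` whose source is bounded below by
`(1+t)^e M^p`, as for a spatial mean of a solution of size `ε` spread over a ball of radius `1 + t`,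
and by `ε^p (1+t)^d`, as caused by the part of that solution near the light cone. -/
structure IsBlowupSystem (σ k d e p c ε τ : ℝ) (M G N : ℝ → ℝ) : Prop
    extends IsMomentumSystem (σ - 1) k τ M G N where
  init_ge : c * ε ≤ M 0
  source_ge_rpow : ∀ t ∈ Ioo 0 τ, c * (1 + t) ^ e * M t ^ p ≤ N t
  source_ge : ∀ t ∈ Ioo 0 τ, c * ε ^ p * (1 + t) ^ d ≤ N t

section IsBlowupSystem

variable {σ p c : ℝ}

lemma IsBlowupSystem.exists_mul_rpow_le (σ k d e : ℝ) (hp : 1 < p) (hc : 0 < c) {c' : ℝ}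
    (hc' : 0 < c') : ∃ C : ℝ, ∀ (ε τ x : ℝ) (M G N : ℝ → ℝ), 1 ≤ τ →
      IsBlowupSystem σ k d e p c ε τ M G N → c' * x ≤ M (τ / 2) →
      x * (1 + τ) ^ ((σ + 1 + k + e) / (p - 1)) ≤ C := by
  obtain ⟨C, hupper⟩ := IsMomentumSystem.exists_M_half_mul_rpow_le (σ - 1) k e hp hc
  refine ⟨C / c', fun ε τ x M G N hτ h hx => ?_⟩
  have hM := hupper τ M G N hτ h.toIsMomentumSystem h.source_ge_rpow
  rw [show σ - 1 + 2 + k + e = σ + 1 + k + e by ring] at hM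
  rw [le_div_iff₀ hc']
  calc x * (1 + τ) ^ ((σ + 1 + k + e) / (p - 1)) * c'
      = c' * x * (1 + τ) ^ ((σ + 1 + k + e) / (p - 1)) := by ring
    _ ≤ M (τ / 2) * (1 + τ) ^ ((σ + 1 + k + e) / (p - 1)) := by gcongr
    _ ≤ C := hM

lemma IsBlowupSystem.exists_linear_bound (σ k d e : ℝ) (hp : 1 < p) (hc : 0 < c) :
    ∃ C : ℝ, ∀ (ε τ : ℝ) (M G N : ℝ → ℝ), 1 ≤ τ →
      IsBlowupSystem σ k d e p c ε τ M G N →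
      ε * (1 + τ) ^ ((σ + 1 + k + e) / (p - 1)) ≤ C := by
  obtain ⟨C, hbound⟩ := IsBlowupSystem.exists_mul_rpow_le σ k d e hp hc hc
  exact ⟨C, fun ε τ M G N hτ h => hbound ε τ ε M G N hτ h
    (h.init_ge.trans (h.M_le le_rfl (by linarith) (by linarith)))⟩

lemma IsBlowupSystem.exists_wave_bound (σ k d e : ℝ) (hp : 1 < p) (hc : 0 < c) :
    ∃ C : ℝ, ∀ (ε τ : ℝ) (M G N : ℝ → ℝ), 0 ≤ ε → 1 ≤ τ →
      IsBlowupSystem σ k d e p c ε τ M G N →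
      ε ^ p * (1 + τ) ^ (k + d + σ + 1 + (σ + 1 + k + e) / (p - 1)) ≤ C := by
  obtain ⟨C, hbound⟩ := IsBlowupSystem.exists_mul_rpow_le σ k d e hp hc
    (c' := 4 ^ (-|σ - 1|) * 4 ^ (-|k + d|) / 256 * c) (by positivity)
  refine ⟨C, fun ε τ M G N hε hτ h => ?_⟩
  have hM := h.mul_rpow_le_M_half hτ (by positivity) h.source_ge
  rw [show k + d + (σ - 1) + 2 = k + d + σ + 1 by ring] at hM
  rw [Real.rpow_add (by linarith), ← mul_assoc]
  exact hbound ε τ _ M G N hτ h (by linarith)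

lemma IsBlowupSystem.exists_heat_bound (k d e : ℝ) (hσ : 0 ≤ σ) (hp : 1 < p) (hc : 0 < c) :
    ∃ C : ℝ, ∀ (ε τ : ℝ) (M G N : ℝ → ℝ), 0 ≤ ε → 15 ≤ τ →
      IsBlowupSystem σ k d e p c ε τ M G N →
      ε ^ p * (1 + τ) ^ (σ + (σ + 1 + k + e) / (p - 1)) * Real.log (1 + τ) ^ (1 - Real.sign σ)
        ≤ C := by
  obtain ⟨c', hc', hlower⟩ := exists_mul_rpow_mul_log_le_M_half k d hσ
  obtain ⟨C, hbound⟩ := IsBlowupSystem.exists_mul_rpow_le σ k d e hp hc (mul_pos hc' hc)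
  refine ⟨C, fun ε τ M G N hε hτ h => ?_⟩
  have hM := hlower τ (c * ε ^ p) M G N hτ (by positivity) h.toIsMomentumSystem h.source_ge
  rw [Real.rpow_add (by linarith), ← mul_assoc, mul_right_comm]
  exact hbound ε τ _ M G N (by linarith) h (by linarith)

lemma IsBlowupSystem.exists_critical_bound {k d : ℝ} (e : ℝ) (hσ : 0 ≤ σ) (hp : 1 < p) (hc : 0 < c)
    (hkd : k + d = -1) :
    ∃ C : ℝ, ∀ (ε τ : ℝ) (M G N : ℝ → ℝ), 0 ≤ ε → 15 ≤ τ →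
      IsBlowupSystem σ k d e p c ε τ M G N →
      ε ^ p * (1 + τ) ^ (σ + (σ + 1 + k + e) / (p - 1)) * Real.log (1 + τ) ^ (2 - Real.sign σ)
        ≤ C := by
  obtain ⟨c', hc', hlower⟩ := exists_mul_rpow_mul_log_le_M_half_of_add_eq k d hσ hkd
  obtain ⟨C, hbound⟩ := IsBlowupSystem.exists_mul_rpow_le σ k d e hp hc (mul_pos hc' hc)
  refine ⟨C, fun ε τ M G N hε hτ h => ?_⟩
  have hM := hlower τ (c * ε ^ p) M G N hτ (by positivity) h.toIsMomentumSystem h.source_ge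
  rw [Real.rpow_add (by linarith), ← mul_assoc, mul_right_comm]
  exact hbound ε τ _ M G N (by linarith) h (by linarith)

end IsBlowupSystem

/-! ### Averages of plane waves -/

section PlaneWaveAverage

variable {n : ℕ}

/-- `Φ(x) = ∫_{|y|<1} exp (x · y/|y|) dy`, a multiple of the spherical average of the plane waves
`exp (x · ω)`, `|ω| = 1`, in a form that needs no surface measure. It satisfies `ΔΦ = Φ`. -/
noncomputable def waveAvg (x : Rn n) : ℝ :=
  ∫ y in Metric.ball (0 : Rn n) 1, Real.exp (inner ℝ x (NormedSpace.normalize y))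

lemma waveAvg_nonneg (x : Rn n) : 0 ≤ waveAvg x :=
  integral_nonneg fun _ => (Real.exp_pos _).le

lemma norm_normalize_le_one (y : Rn n) : ‖NormedSpace.normalize y‖ ≤ 1 := by
  rw [NormedSpace.normalize, norm_smul, norm_inv, norm_norm]
  exact inv_mul_le_one

lemma measurable_normalize : Measurable (NormedSpace.normalize : Rn n → Rn n) :=
  measurable_norm.inv.smul measurable_id

lemma abs_inner_normalize_le (x y : Rn n) : |inner ℝ x (NormedSpace.normalize y)| ≤ ‖x‖ :=
  (abs_real_inner_le_norm _ _).trans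
    (mul_le_of_le_one_right (norm_nonneg x) (norm_normalize_le_one y))

lemma inner_normalize_le (x y : Rn n) : inner ℝ x (NormedSpace.normalize y) ≤ ‖x‖ :=
  (abs_le.1 (abs_inner_normalize_le x y)).2

lemma inner_normalize_sub_one_le {e y : Rn n} (he : ‖e‖ = 1) (hy : ‖y‖ ≤ 1) :
    inner ℝ e (NormedSpace.normalize y) - 1 ≤ -(‖y‖ ^ 2 - inner ℝ e y ^ 2) / 2 := by
  set c := inner ℝ e (NormedSpace.normalize y)
  have hinner : inner ℝ e y = ‖y‖ * c := by
    conv_lhs => rw [← NormedSpace.norm_smul_normalize y, inner_smul_right]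
  obtain ⟨hc_ge, hc_le⟩ := abs_le.1 (he ▸ abs_inner_normalize_le e y : |c| ≤ 1)
  have hc : 0 ≤ (1 - c) * (1 + c) := mul_nonneg (by linarith) (by linarith)
  have := mul_le_of_le_one_left hc (pow_le_one₀ (n := 2) (norm_nonneg y) hy)
  rw [hinner]
  nlinarith

lemma exists_orthonormalBasis_apply_eq (i : Fin n) {e : Rn n} (he : ‖e‖ = 1) :
    ∃ b : OrthonormalBasis (Fin n) ℝ (Rn n), b i = e := by
  have ho : Orthonormal ℝ (({i} : Set (Fin n)).domRestrict fun _ : Fin n => e) :=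
    ⟨fun _ => by simpa using he, fun j k hjk => absurd (Subsingleton.elim j k) hjk⟩
  obtain ⟨b, hb⟩ := ho.exists_orthonormalBasis_extension_of_card_eq (by simp)
  exact ⟨b, hb i rfl⟩

lemma integrable_and_integral_gaussian_repr (b : OrthonormalBasis (Fin n) ℝ (Rn n)) {c : Fin n → ℝ}
    (hc : ∀ i, 0 < c i) :
    Integrable (fun y : Rn n => Real.exp (-∑ i, c i * b.repr y i ^ 2)) ∧
      ∫ y : Rn n, Real.exp (-∑ i, c i * b.repr y i ^ 2) = ∏ i, √(Real.pi / c i) := by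
  have hexp (z : Fin n → ℝ) :
      Real.exp (-∑ i, c i * z i ^ 2) = ∏ i, Real.exp (-c i * z i ^ 2) := by
    simp only [← Real.exp_sum, neg_mul, Finset.sum_neg_distrib]
  let coords : Rn n → Fin n → ℝ := fun y => (MeasurableEquiv.toLp 2 (Fin n → ℝ)).symm (b.repr y)
  have hmp : MeasurePreserving coords volume volume :=
    (EuclideanSpace.volume_preserving_symm_measurableEquiv_toLp (Fin n)).comp
      b.measurePreserving_repr
  have hemb : MeasurableEmbedding coords :=
    (MeasurableEquiv.toLp 2 (Fin n → ℝ)).symm.measurableEmbedding.comp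
      b.repr.toHomeomorph.toMeasurableEquiv.measurableEmbedding
  have hint : Integrable (fun z : Fin n → ℝ => ∏ i, Real.exp (-c i * z i ^ 2)) :=
    Integrable.fintype_prod (f := fun i (x : ℝ) => Real.exp (-c i * x ^ 2))
      fun i => integrable_exp_neg_mul_sq (hc i)
  simp only [hexp]
  refine ⟨(hmp.integrable_comp_emb hemb).2 hint, ?_⟩
  refine (hmp.integral_comp hemb fun z : Fin n → ℝ => ∏ i, Real.exp (-c i * z i ^ 2)).trans ?_
  rw [integral_fintype_prod_volume_eq_prod fun i (x : ℝ) => Real.exp (-c i * x ^ 2)]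
  simp_rw [integral_gaussian]

lemma integrable_and_integral_gaussian_axial (hn : 1 ≤ n) {e : Rn n} (he : ‖e‖ = 1) {α β : ℝ}
    (hα : 0 < α) (hβ : 0 < β) :
    Integrable (fun y : Rn n => Real.exp (-(β * (‖y‖ ^ 2 - inner ℝ e y ^ 2) + α * inner ℝ e y ^ 2)))
      ∧ ∫ y : Rn n, Real.exp (-(β * (‖y‖ ^ 2 - inner ℝ e y ^ 2) + α * inner ℝ e y ^ 2)) =
        √(Real.pi / α) * √(Real.pi / β) ^ (n - 1) := by
  let i₀ : Fin n := ⟨0, hn⟩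
  obtain ⟨b, hb⟩ := exists_orthonormalBasis_apply_eq i₀ he
  have hsplit (y : Rn n) : β * (‖y‖ ^ 2 - inner ℝ e y ^ 2) + α * inner ℝ e y ^ 2 =
      ∑ i, (if i = i₀ then α else β) * b.repr y i ^ 2 := by
    have hnorm : ‖y‖ ^ 2 = ∑ i, b.repr y i ^ 2 := by
      simp only [← b.repr.norm_map y, EuclideanSpace.norm_sq_eq, Real.norm_eq_abs, sq_abs]
    have hinner : inner ℝ e y = b.repr y i₀ := by rw [← hb, b.repr_apply_apply]
    have hothers : ∑ i ∈ Finset.univ.erase i₀, (if i = i₀ then α else β) * b.repr y i ^ 2 =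
        β * ∑ i ∈ Finset.univ.erase i₀, b.repr y i ^ 2 := by
      rw [Finset.mul_sum]
      exact Finset.sum_congr rfl fun i hi => by rw [if_neg (Finset.ne_of_mem_erase hi)]
    simp only [hnorm, hinner, ← Finset.add_sum_erase _ _ (Finset.mem_univ i₀), if_true, hothers]
    ring
  simp only [hsplit]
  obtain ⟨hint, hval⟩ := integrable_and_integral_gaussian_repr b
    (c := fun i => if i = i₀ then α else β) fun i => by split_ifs <;> assumption
  refine ⟨hint, hval.trans ?_⟩
  rw [← Finset.mul_prod_erase _ _ (Finset.mem_univ i₀), if_pos rfl,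
    Finset.prod_congr rfl fun i hi => by rw [if_neg (Finset.ne_of_mem_erase hi)], Finset.prod_const,
    Finset.card_erase_of_mem (Finset.mem_univ _), Finset.card_univ, Fintype.card_fin]

lemma exists_norm_eq_one_smul_eq (hn : 1 ≤ n) (x : Rn n) : ∃ e : Rn n, ‖e‖ = 1 ∧ ‖x‖ • e = x := by
  rcases eq_or_ne x 0 with rfl | hx
  · exact ⟨EuclideanSpace.single ⟨0, hn⟩ 1, by simp, by simp⟩
  · exact ⟨NormedSpace.normalize x, NormedSpace.norm_normalize_eq_one_iff.2 hx,
      NormedSpace.norm_smul_normalize x⟩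

lemma sqrt_mul_sqrt_div_pow_eq_rpow {a s : ℝ} (ha : 0 ≤ a) (hs : 0 < s) (hn : 1 ≤ n) :
    √a * √(a / s) ^ (n - 1) = √a ^ n * s ^ (-((n : ℝ) - 1) / 2) := by
  have hpow : s ^ (-((n : ℝ) - 1) / 2) = (√s ^ (n - 1))⁻¹ := by
    rw [Real.sqrt_eq_rpow, ← Real.rpow_mul_natCast hs.le, ← Real.rpow_neg hs.le]
    push_cast [hn]
    ring_nf
  rw [Real.sqrt_div ha, div_pow, hpow, ← Nat.sub_add_cancel hn, pow_succ, Nat.add_sub_cancel]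
  ring

lemma exists_waveAvg_le (hn : 1 ≤ n) : ∃ C : ℝ, 0 < C ∧ ∀ x : Rn n,
    waveAvg x ≤ C * Real.exp ‖x‖ * (1 + ‖x‖) ^ (-((n : ℝ) - 1) / 2) := by
  refine ⟨Real.exp (1 / 2) * √(2 * Real.pi) ^ n, by positivity, fun x => ?_⟩
  obtain ⟨e, he, hxe⟩ := exists_norm_eq_one_smul_eq hn x
  have hr0 : 0 ≤ ‖x‖ := norm_nonneg x
  set r := ‖x‖
  let Q : Rn n → ℝ := fun y =>
    (1 + r) / 2 * (‖y‖ ^ 2 - inner ℝ e y ^ 2) + 1 / 2 * inner ℝ e y ^ 2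
  obtain ⟨hint, hval⟩ := integrable_and_integral_gaussian_axial hn he (α := 1 / 2)
    (β := (1 + r) / 2) (by norm_num) (by positivity)
  have hpt : ∀ y ∈ Metric.ball (0 : Rn n) 1, Real.exp (inner ℝ x (NormedSpace.normalize y)) ≤
      Real.exp (r + 1 / 2) * Real.exp (-Q y) := fun y hy => by
    have hy1 : ‖y‖ ≤ 1 := (mem_ball_zero_iff.1 hy).le
    rw [← Real.exp_add, ← hxe, real_inner_smul_left]
    have := mul_le_mul_of_nonneg_left (inner_normalize_sub_one_le he hy1) hr0
    have := pow_le_one₀ (n := 2) (norm_nonneg y) hy1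
    exact Real.exp_le_exp.2 (by simp only [Q]; linarith)
  calc waveAvg x
      ≤ ∫ y in Metric.ball (0 : Rn n) 1, Real.exp (r + 1 / 2) * Real.exp (-Q y) :=
        integral_mono_of_nonneg (ae_of_all _ fun _ => (Real.exp_pos _).le)
          (hint.const_mul _).integrableOn (ae_restrict_of_forall_mem measurableSet_ball hpt)
    _ ≤ ∫ y : Rn n, Real.exp (r + 1 / 2) * Real.exp (-Q y) :=
        setIntegral_le_integral (hint.const_mul _) (ae_of_all _ fun y => by positivity)
    _ = Real.exp (r + 1 / 2) * (√(2 * Real.pi) * √(2 * Real.pi / (1 + r)) ^ (n - 1)) := by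
        rw [integral_const_mul, hval]
        congr 4 <;> field_simp
    _ = _ := by
        rw [sqrt_mul_sqrt_div_pow_eq_rpow (by positivity) (by positivity) hn, Real.exp_add]
        ring

lemma continuous_waveAvg : Continuous (waveAvg : Rn n → ℝ) := by
  refine continuous_iff_continuousAt.2 fun x₀ =>
    continuousAt_of_dominated (bound := fun _ => Real.exp (‖x₀‖ + 1))
      (Eventually.of_forall fun x => ?_) ?_ (integrableOn_const (hs := measure_ball_lt_top.ne))
      (ae_of_all _ fun y => by fun_prop)
  · exact (Real.measurable_exp.comp
      (measurable_const.inner measurable_normalize)).aestronglyMeasurable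
  · filter_upwards [Metric.ball_mem_nhds x₀ one_pos] with x hx
    refine ae_of_all _ fun y => ?_
    rw [Real.norm_eq_abs, Real.abs_exp]
    refine Real.exp_le_exp.2 ((inner_normalize_le x y).trans ?_)
    linarith [norm_sub_norm_le x x₀, mem_ball_iff_norm.1 hx]

lemma exists_one_add_rpow_le_exp (a : ℝ) {b : ℝ} (hb : 0 < b) :
    ∃ C : ℝ, 0 < C ∧ ∀ s : ℝ, 0 ≤ s → (1 + s) ^ a ≤ C * Real.exp (b * s) := by
  rcases le_or_gt a 0 with ha | ha
  · refine ⟨1, one_pos, fun s hs => ?_⟩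
    rw [one_mul]
    exact (Real.rpow_le_one_of_one_le_of_nonpos (by linarith) ha).trans
      (Real.one_le_exp (by positivity))
  · refine ⟨Real.exp (b - a * (Real.log (b / a) + 1)), by positivity, fun s hs => ?_⟩
    have hlog := Real.log_le_sub_one_of_pos (x := b / a * (1 + s)) (by positivity)
    rw [Real.log_mul (by positivity) (by positivity), div_mul_eq_mul_div] at hlog
    have := mul_le_mul_of_nonneg_left hlog ha.le
    rw [mul_sub, mul_div_cancel₀ _ ha.ne'] at this
    rw [Real.rpow_def_of_pos (by linarith), ← Real.exp_add]
    exact Real.exp_le_exp.2 (by linarith)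

lemma integral_pow_mul_exp_sub_le (k : ℕ) {A : ℝ} (hA : 0 ≤ A) :
    ∫ r in Ioc 0 A, r ^ k * Real.exp (r - A) ≤ A ^ k := by
  rw [← intervalIntegral.integral_of_le hA]
  calc ∫ r in 0..A, r ^ k * Real.exp (r - A) ≤ ∫ r in 0..A, A ^ k * Real.exp (r - A) :=
        intervalIntegral.integral_mono_on hA
          (Continuous.intervalIntegrable (by fun_prop) _ _)
          (Continuous.intervalIntegrable (by fun_prop) _ _) fun r hr => by
            gcongr
            exacts [hr.1, hr.2]
    _ = A ^ k * (1 - Real.exp (-A)) := by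
        rw [intervalIntegral.integral_const_mul,
          intervalIntegral.integral_comp_sub_right (fun r => Real.exp r), integral_exp]
        simp
    _ ≤ A ^ k := mul_le_of_le_one_right (by positivity) (by linarith [Real.exp_pos (-A)])

lemma integral_closedBall_exp_norm_sub_le (hn : 1 ≤ n) {A : ℝ} (hA : 0 ≤ A) :
    ∫ x in Metric.closedBall (0 : Rn n) A, Real.exp (‖x‖ - A)
      ≤ n * volume.real (Metric.ball (0 : Rn n) 1) * A ^ (n - 1) := by
  have : Nonempty (Fin n) := ⟨⟨0, hn⟩⟩
  have : Nontrivial (Rn n) := inferInstance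
  have hradial : ∫ x in Metric.closedBall (0 : Rn n) A, Real.exp (‖x‖ - A) =
      ∫ x : Rn n, (Iic A).indicator (fun r => Real.exp (r - A)) ‖x‖ := by
    rw [← integral_indicator measurableSet_closedBall]
    simp only [indicator, mem_closedBall_zero_iff, mem_Iic]
  have hpolar : ∫ r in Ioi (0 : ℝ), r ^ (n - 1) • (Iic A).indicator (fun r => Real.exp (r - A)) r =
      ∫ r in Ioc 0 A, r ^ (n - 1) * Real.exp (r - A) := by
    simp only [← indicator_smul_apply (Iic A) (fun r : ℝ => r ^ (n - 1)), smul_eq_mul]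
    rw [setIntegral_indicator measurableSet_Iic, Ioi_inter_Iic]
  rw [hradial, integral_fun_norm_addHaar, finrank_euclideanSpace_fin, hpolar, nsmul_eq_mul,
    smul_eq_mul, mul_assoc]
  gcongr
  exact integral_pow_mul_exp_sub_le (n - 1) hA

lemma one_add_rpow_neg_le_mul {r A b : ℝ} (hr : 0 ≤ r) (hrA : r ≤ A) (hb : 0 ≤ b) :
    (1 + r) ^ (-b) ≤ (1 + A) ^ (-b) * (1 + (A - r)) ^ b := by
  have hA : 0 < 1 + A := by linarith
  rw [Real.rpow_neg (by linarith), Real.rpow_neg hA.le, inv_mul_eq_div, inv_eq_one_div,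
    div_le_div_iff₀ (by positivity) (by positivity), one_mul,
    ← Real.mul_rpow (by linarith) (by linarith)]
  exact Real.rpow_le_rpow hA.le (by nlinarith [mul_nonneg hr (sub_nonneg.2 hrA)]) hb

lemma exists_waveAvg_rpow_le (hn : 1 ≤ n) {q : ℝ} (hq : 1 < q) :
    ∃ C : ℝ, 0 < C ∧ ∀ (A : ℝ) (x : Rn n), ‖x‖ ≤ A → waveAvg x ^ q ≤
      C * Real.exp (q * A) * (1 + A) ^ (-(q * (((n : ℝ) - 1) / 2))) * Real.exp (‖x‖ - A) := by
  obtain ⟨C₁, hC₁, hΦ⟩ := exists_waveAvg_le hn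
  set β := ((n : ℝ) - 1) / 2 with hβ
  have hβ0 : 0 ≤ β := by
    rw [hβ]
    linarith [(Nat.one_le_cast (α := ℝ)).2 hn]
  obtain ⟨C₂, hC₂, hexp⟩ := exists_one_add_rpow_le_exp (q * β) (b := q - 1) (by linarith)
  refine ⟨C₁ ^ q * C₂, by positivity, fun A x hxA => ?_⟩
  have hr0 := norm_nonneg x
  set r := ‖x‖
  have hA1 : 0 < 1 + A := by linarith
  calc waveAvg x ^ q ≤ (C₁ * Real.exp r * (1 + r) ^ (-((n : ℝ) - 1) / 2)) ^ q :=
        Real.rpow_le_rpow (waveAvg_nonneg x) (hΦ x) (by linarith)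
    _ = C₁ ^ q * Real.exp (q * r) * (1 + r) ^ (-(q * β)) := by
        rw [Real.mul_rpow (by positivity) (by positivity), Real.mul_rpow hC₁.le (by positivity),
          ← Real.exp_mul, ← Real.rpow_mul (by positivity), mul_comm r q,
          show -((n : ℝ) - 1) / 2 * q = -(q * β) by rw [hβ]; ring]
    _ ≤ C₁ ^ q * Real.exp (q * r) * ((1 + A) ^ (-(q * β)) *
          (C₂ * Real.exp ((q - 1) * (A - r)))) := by
        gcongr
        refine (one_add_rpow_neg_le_mul hr0 hxA (by positivity)).trans ?_
        gcongr
        exact hexp (A - r) (by linarith)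
    _ = C₁ ^ q * C₂ * (1 + A) ^ (-(q * β)) *
          Real.exp (q * r + (q - 1) * (A - r)) := by
        rw [Real.exp_add]
        ring
    _ = _ := by
        rw [show q * r + (q - 1) * (A - r) = q * A + (r - A) by ring, Real.exp_add]
        ring

lemma volume_real_unitBall_pos (n : ℕ) : 0 < volume.real (Metric.ball (0 : Rn n) 1) :=
  ENNReal.toReal_pos (Metric.measure_ball_pos _ _ one_pos).ne' measure_ball_lt_top.ne

lemma exists_integral_waveAvg_rpow_le (hn : 1 ≤ n) {q : ℝ} (hq : 1 < q) :
    ∃ C : ℝ, 0 < C ∧ ∀ A : ℝ, 0 ≤ A →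
      ∫ x in Metric.closedBall (0 : Rn n) A, waveAvg x ^ q
        ≤ C * Real.exp (q * A) * (1 + A) ^ (((n : ℝ) - 1) * (1 - q / 2)) := by
  obtain ⟨C, hC, hpt⟩ := exists_waveAvg_rpow_le hn hq
  have hvol := volume_real_unitBall_pos n
  refine ⟨C * (n * volume.real (Metric.ball (0 : Rn n) 1)), by positivity, fun A hA => ?_⟩
  have hA1 : 0 < 1 + A := by linarith
  set β := ((n : ℝ) - 1) / 2 with hβ
  have hcompact := isCompact_closedBall (0 : Rn n) A
  calc _ ≤ ∫ x in Metric.closedBall (0 : Rn n) A,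
        C * Real.exp (q * A) * (1 + A) ^ (-(q * β)) * Real.exp (‖x‖ - A) :=
        setIntegral_mono_on
          ((continuous_waveAvg.rpow_const fun _ => Or.inr (by linarith)).continuousOn
            |>.integrableOn_compact hcompact)
          (Continuous.continuousOn (by fun_prop) |>.integrableOn_compact hcompact)
          measurableSet_closedBall fun x hx => hpt A x (mem_closedBall_zero_iff.1 hx)
    _ ≤ C * Real.exp (q * A) * (1 + A) ^ (-(q * β)) *
        (n * volume.real (Metric.ball (0 : Rn n) 1) * (1 + A) ^ (n - 1)) := by
        rw [integral_const_mul]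
        gcongr
        refine (integral_closedBall_exp_norm_sub_le hn hA).trans ?_
        gcongr
        linarith
    _ = C * (n * volume.real (Metric.ball (0 : Rn n) 1)) * Real.exp (q * A) *
        ((1 + A) ^ (-(q * β)) * (1 + A) ^ ((n : ℝ) - 1)) := by
        rw [← Real.rpow_natCast (1 + A), Nat.cast_sub hn, Nat.cast_one]
        ring
    _ = _ := by
        rw [← Real.rpow_add hA1, hβ]
        ring_nf

end PlaneWaveAverage

/-! ### Test weights -/

open scoped Laplacian

section TestWeight

variable {n : ℕ} {ψ φ : Rn n → ℝ} {A : ℝ} {w : L2 n}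

/-- A nonnegative test function of the space variable, used as a weight in spatial averages. -/
structure IsTestWeight (ψ : Rn n → ℝ) : Prop where
  contDiff : ContDiff ℝ ∞ ψ
  hasCompactSupport : HasCompactSupport ψ
  nonneg : ∀ x, 0 ≤ ψ x

/-- The average `∫ w ψ`, the functional of a solution that is shown to blow up. -/
noncomputable def pairing (ψ : Rn n → ℝ) (w : L2 n) : ℝ := ∫ x, w x * ψ x

/-- The average `∫ |w|^p ψ` of the nonlinearity. -/
noncomputable def source (p : ℝ) (ψ : Rn n → ℝ) (w : L2 n) : ℝ := ∫ x, |w x| ^ p * ψ x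

/-- The essential support of `w` lies in the closed ball of radius `A` about the origin. -/
def SupportedInBall (A : ℝ) (w : L2 n) : Prop := ∀ᵐ x : Rn n, A < ‖x‖ → w x = 0

/-- The exponential `x ↦ exp (ξ · x)`. The choice `ξ = 0` gives the constant weight `1`. -/
noncomputable def planeWave (ξ x : Rn n) : ℝ := Real.exp (inner ℝ ξ x)

lemma planeWave_pos (ξ x : Rn n) : 0 < planeWave ξ x := Real.exp_pos _

lemma contDiff_planeWave (ξ : Rn n) : ContDiff ℝ ∞ (planeWave ξ) :=
  Real.contDiff_exp.comp (contDiff_const.inner ℝ contDiff_id)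

lemma laplacian_planeWave (ξ : Rn n) : Δ (planeWave ξ) = fun x => ‖ξ‖ ^ 2 * planeWave ξ x := by
  have hfderiv (x : Rn n) : HasFDerivAt (planeWave ξ) (planeWave ξ x • innerSL ℝ ξ) x :=
    ((innerSL ℝ ξ).hasFDerivAt (x := x)).exp
  have hfderiv₂ (x : Rn n) :
      fderiv ℝ (fderiv ℝ (planeWave ξ)) x =
        (planeWave ξ x • innerSL ℝ ξ).smulRight (innerSL ℝ ξ) := by
    rw [show fderiv ℝ (planeWave ξ) = fun y => planeWave ξ y • innerSL ℝ ξ from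
      funext fun y => (hfderiv y).fderiv]
    exact ((hfderiv x).smul_const (innerSL ℝ ξ)).fderiv
  funext x
  simp only [InnerProductSpace.laplacian_eq_iteratedFDeriv_orthonormalBasis _
    (EuclideanSpace.basisFun (Fin n) ℝ), iteratedFDeriv_two_apply, hfderiv₂]
  simp only [EuclideanSpace.norm_sq_eq, Finset.sum_mul]
  refine Finset.sum_congr rfl fun i _ => ?_
  simp [EuclideanSpace.inner_single_right]
  ring

lemma IsTestWeight.continuous (hψ : IsTestWeight ψ) : Continuous ψ := hψ.contDiff.continuous

lemma IsTestWeight.memLp (hψ : IsTestWeight ψ) (q : ℝ≥0∞) : MemLp ψ q :=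
  hψ.continuous.memLp_of_hasCompactSupport hψ.hasCompactSupport

lemma IsTestWeight.exists_le (hψ : IsTestWeight ψ) : ∃ c, 0 < c ∧ ∀ x, ψ x ≤ c := by
  obtain ⟨c, hc⟩ := hψ.hasCompactSupport.exists_bound_of_continuous hψ.continuous
  exact ⟨|c| + 1, by positivity, fun x =>
    (le_abs_self _).trans ((hc x).trans (by linarith [le_abs_self c]))⟩

lemma IsTestWeight.memLp_laplacian (hψ : IsTestWeight ψ) (q : ℝ≥0∞) : MemLp (Δ ψ) q := by
  rw [InnerProductSpace.laplacian_eq_iteratedFDeriv_orthonormalBasis _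
    (EuclideanSpace.basisFun (Fin n) ℝ)]
  have hcont := (contDiff_infty.1 hψ.contDiff 2).continuous_iteratedFDeriv le_rfl
  refine memLp_finsetSum _ fun i _ => Continuous.memLp_of_hasCompactSupport
    ((ContinuousMultilinearMap.apply ℝ (fun _ : Fin 2 => Rn n) ℝ _).continuous.comp hcont) ?_
  exact (hψ.hasCompactSupport.iteratedFDeriv 2).comp_left
    (g := ContinuousMultilinearMap.apply ℝ (fun _ : Fin 2 => Rn n) ℝ _) (map_zero _)

lemma exists_isTestWeight_eqOn_planeWave (A : ℝ) (ξ : Rn n) :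
    ∃ ψ, IsTestWeight ψ ∧ EqOn ψ (planeWave ξ) (Metric.ball 0 A) := by
  let χ : ContDiffBump (0 : Rn n) :=
    ⟨|A| + 1, |A| + 2, by positivity, by linarith⟩
  refine ⟨fun x => planeWave ξ x * χ x, ⟨(contDiff_planeWave ξ).mul χ.contDiff,
    χ.hasCompactSupport.mul_left, fun x => mul_nonneg (planeWave_pos ξ x).le χ.nonneg⟩,
    fun x hx => ?_⟩
  have hx' : x ∈ Metric.closedBall (0 : Rn n) χ.rIn :=
    mem_closedBall_zero_iff.2 (by
      change ‖x‖ ≤ |A| + 1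
      linarith [mem_ball_zero_iff.1 hx, le_abs_self A])
  simp only [χ.one_of_mem_closedBall hx', mul_one]

lemma IsWeakGradient.integral_fderiv_eq {G : L2vec n} (hG : IsWeakGradient w G)
    (hψ : IsTestWeight ψ) : ∫ x, fderiv ℝ ψ x (G x) = -∫ x, w x * Δ ψ x := by
  let b := EuclideanSpace.basisFun (Fin n) ℝ
  let η (i : Fin n) (x : Rn n) : ℝ := fderiv ℝ ψ x (b i)
  have hfderiv : ContDiff ℝ ∞ (fderiv ℝ ψ) := hψ.contDiff.fderiv_right (by simp)
  have hη (i) : ContDiff ℝ ∞ (η i) := hfderiv.clm_apply contDiff_const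
  have hηc (i) : HasCompactSupport (η i) := hψ.hasCompactSupport.fderiv_apply (𝕜 := ℝ) (b i)
  have hgrad_int (i) : Integrable fun x => inner ℝ (G x) (b i) * η i x :=
    MemLp.integrable_mul (p := 2) (q := 2) ((Lp.memLp G).inner_const (b i))
      ((hη i).continuous.memLp_of_hasCompactSupport (hηc i))
  have hdiv_int (i) : Integrable fun x => w x * fderiv ℝ (η i) x (b i) :=
    MemLp.integrable_mul (p := 2) (q := 2) (Lp.memLp w)
      ((((hη i).continuous_fderiv (by simp)).clm_apply
        continuous_const).memLp_of_hasCompactSupport ((hηc i).fderiv_apply (𝕜 := ℝ) (b i)))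
  have hgrad (x) : fderiv ℝ ψ x (G x) = ∑ i, inner ℝ (G x) (b i) * η i x := by
    conv_lhs => rw [← b.sum_repr (G x)]
    simp only [map_sum, map_smul, smul_eq_mul, b.repr_apply_apply, real_inner_comm, η]
  have hdiv (x) : Δ ψ x = ∑ i, fderiv ℝ (η i) x (b i) := by
    rw [InnerProductSpace.laplacian_eq_iteratedFDeriv_orthonormalBasis _ b]
    refine Finset.sum_congr rfl fun i _ => ?_
    simp [η, iteratedFDeriv_two_apply,
      fderiv_clm_apply (hfderiv.differentiable (by simp) x) (differentiableAt_const _)]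
  calc ∫ x, fderiv ℝ ψ x (G x) = ∑ i, ∫ x, inner ℝ (G x) (b i) * η i x := by
        simp only [hgrad, integral_finsetSum _ fun i _ => hgrad_int i]
    _ = -∑ i, ∫ x, w x * fderiv ℝ (η i) x (b i) := by
        simp only [hG _ (hη _) (hηc _), Finset.sum_neg_distrib, neg_neg]
    _ = -∫ x, w x * Δ ψ x := by
        simp only [hdiv, Finset.mul_sum, integral_finsetSum _ fun i _ => hdiv_int i]

lemma pairing_eq_innerSL (hψ : MemLp ψ 2) (w : L2 n) :
    pairing ψ w = innerSL ℝ (hψ.toLp ψ) w := by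
  rw [innerSL_apply_apply, L2.inner_def]
  refine integral_congr_ae ?_
  filter_upwards [hψ.coeFn_toLp] with x hx
  simp [hx]

lemma pairing_smul (ψ : Rn n → ℝ) (c : ℝ) (w : L2 n) : pairing ψ (c • w) = c * pairing ψ w := by
  rw [pairing, pairing, ← integral_const_mul]
  refine integral_congr_ae ?_
  filter_upwards [Lp.coeFn_smul c w] with x hx
  simp [hx, mul_assoc]

lemma SupportedInBall.pairing_congr (hw : SupportedInBall A w)
    (h : EqOn ψ φ (Metric.closedBall 0 A)) : pairing ψ w = pairing φ w := by
  refine integral_congr_ae ?_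
  filter_upwards [hw] with x hx
  rcases le_or_gt ‖x‖ A with hA | hA
  · rw [h (mem_closedBall_zero_iff.2 hA)]
  · simp only [hx hA, zero_mul]

lemma SupportedInBall.source_congr {p : ℝ} (hp : p ≠ 0) (hw : SupportedInBall A w)
    (h : EqOn ψ φ (Metric.closedBall 0 A)) : source p ψ w = source p φ w := by
  refine integral_congr_ae ?_
  filter_upwards [hw] with x hx
  rcases le_or_gt ‖x‖ A with hA | hA
  · rw [h (mem_closedBall_zero_iff.2 hA)]
  · simp only [hx hA, abs_zero, Real.zero_rpow hp, zero_mul]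

lemma source_nonneg (p : ℝ) (hψ : ∀ x, 0 ≤ ψ x) (w : L2 n) : 0 ≤ source p ψ w :=
  integral_nonneg fun x => mul_nonneg (Real.rpow_nonneg (abs_nonneg _) _) (hψ x)

lemma IsTestWeight.isTestFunction_mul_bump (hψ : IsTestWeight ψ) {T : ℝ} (θ : ContDiffBump (0 : ℝ))
    (hθ : θ.rOut < T) : IsTestFunction T fun z : Rn n × ℝ => ψ z.1 * θ z.2 where
  smooth := (hψ.contDiff.comp contDiff_fst).mul (θ.contDiff.comp contDiff_snd)
  compact := by
    refine HasCompactSupport.intro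
      (hψ.hasCompactSupport.prod (isCompact_closedBall (0 : ℝ) θ.rOut)) fun z hz => ?_
    rw [mem_prod, not_and_or] at hz
    rcases hz with hz | hz
    · rw [image_eq_zero_of_notMem_tsupport hz, zero_mul]
    · rw [θ.zero_of_le_dist (not_le.1 hz).le, mul_zero]
  support := by
    have hclosed : IsClosed {z : Rn n × ℝ | z.2 ≤ θ.rOut} :=
      isClosed_le continuous_snd continuous_const
    refine (closure_minimal (fun z hz => ?_) hclosed).trans fun z hz => lt_of_le_of_lt hz hθ
    by_contra hlt
    refine right_ne_zero_of_mul hz (θ.zero_of_le_dist ?_)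
    rw [Real.dist_eq, sub_zero]
    exact (not_le.1 hlt).le.trans (le_abs_self _)

end TestWeight

/-! ### Spatial averages of energy solutions -/

section WeightMeasure

variable {n : ℕ} {ψ : Rn n → ℝ} {p : ℝ} {w : L2 n}

/-- The measure `ψ dx`, which turns `source p ψ` into the `p`-th power of an `L^p` norm. -/
noncomputable def weightMeasure (ψ : Rn n → ℝ) : Measure (Rn n) :=
  volume.withDensity fun x => ENNReal.ofReal (ψ x)

lemma weightMeasure_le {c : ℝ} (hc : ∀ x, ψ x ≤ c) :
    weightMeasure ψ ≤ ENNReal.ofReal c • volume.restrict (tsupport ψ) := by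
  refine Measure.le_iff.2 fun s hs => ?_
  rw [weightMeasure, withDensity_apply _ hs, Measure.smul_apply, Measure.restrict_apply hs,
    inter_comm, ← Measure.restrict_apply (isClosed_tsupport ψ).measurableSet, smul_eq_mul,
    ← lintegral_indicator_const (isClosed_tsupport ψ).measurableSet]
  refine lintegral_mono fun x => ?_
  by_cases hx : x ∈ tsupport ψ
  · rw [indicator_of_mem hx]
    exact ENNReal.ofReal_le_ofReal (hc x)
  · rw [image_eq_zero_of_notMem_tsupport hx, ENNReal.ofReal_zero]
    exact zero_le

lemma IsTestWeight.source_eq_integral (hψ : IsTestWeight ψ) (p : ℝ) (w : L2 n) :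
    source p ψ w = ∫ x, |w x| ^ p ∂weightMeasure ψ := by
  rw [weightMeasure, integral_withDensity_eq_integral_toReal_smul
    hψ.continuous.measurable.ennreal_ofReal (ae_of_all _ fun _ => ENNReal.ofReal_lt_top), source]
  simp only [ENNReal.toReal_ofReal (hψ.nonneg _), smul_eq_mul, mul_comm]

lemma IsTestWeight.source_eq_eLpNorm_rpow (hψ : IsTestWeight ψ) (hp : 0 < p)
    (hw : MemLp w (ENNReal.ofReal p) (weightMeasure ψ)) :
    source p ψ w = (eLpNorm w (ENNReal.ofReal p) (weightMeasure ψ)).toReal ^ p := by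
  rw [hw.eLpNorm_eq_integral_rpow_norm (by simpa using hp) ENNReal.ofReal_ne_top,
    ENNReal.toReal_ofReal hp.le, ENNReal.toReal_ofReal (by positivity), ← Real.rpow_mul
    (integral_nonneg fun _ => by positivity), inv_mul_cancel₀ hp.ne', Real.rpow_one,
    hψ.source_eq_integral]
  simp only [Real.norm_eq_abs]

lemma abs_toReal_eLpNorm_sub_le {α : Type*} [MeasurableSpace α] {q : ℝ≥0∞} (hq : 1 ≤ q)
    {μ : Measure α} {v w : α → ℝ} (hv : MemLp v q μ) (hw : MemLp w q μ) :
    |(eLpNorm v q μ).toReal - (eLpNorm w q μ).toReal| ≤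
      (eLpNorm (fun x => v x - w x) q μ).toReal := by
  have : Fact (1 ≤ q) := ⟨hq⟩
  have h := abs_norm_sub_norm_le (hv.toLp v) (hw.toLp w)
  rwa [← MemLp.toLp_sub, Lp.norm_toLp, Lp.norm_toLp, Lp.norm_toLp] at h

end WeightMeasure

lemma hasDerivAt_integral_of_continuousOn_Ico {F : ℝ → ℝ} {T t : ℝ} (hF : ContinuousOn F (Ico 0 T))
    (ht : t ∈ Ioo 0 T) : HasDerivAt (fun r => ∫ s in (0 : ℝ)..r, F s) (F t) t := by
  refine intervalIntegral.integral_hasDerivAt_right ?_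
    ((hF.mono Ioo_subset_Ico_self).stronglyMeasurableAtFilter isOpen_Ioo t ht)
    (hF.continuousAt (Ico_mem_nhds ht.1 ht.2))
  refine (hF.mono ?_).intervalIntegrable
  rw [uIcc_of_le ht.1.le]
  exact fun s hs => ⟨hs.1, hs.2.trans_lt ht.2⟩

lemma exists_bump_eventuallyEq_one {t T : ℝ} (ht : 0 ≤ t) (htT : t < T) :
    ∃ θ : ContDiffBump (0 : ℝ), θ.rOut < T ∧ ∀ s ∈ Icc 0 t, θ =ᶠ[𝓝 s] fun _ => 1 := by
  let θ : ContDiffBump (0 : ℝ) := ⟨(2 * t + T) / 3, (t + 2 * T) / 3, by linarith, by linarith⟩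
  refine ⟨θ, show (t + 2 * T) / 3 < T by linarith, fun s hs => θ.eventuallyEq_one_of_mem_ball ?_⟩
  rw [Metric.mem_ball, Real.dist_eq, sub_zero, abs_of_nonneg hs.1]
  change s < (2 * t + T) / 3
  linarith [hs.2]

namespace IsEnergySolution

variable {n : ℕ} {μ₁ μ₂ p : ℝ} {f g : L2 n} {ε T t : ℝ} {u ut : ℝ → L2 n} {Du : ℝ → L2vec n}
  {ψ : Rn n → ℝ}

lemma continuousOn_pairing (h : IsEnergySolution μ₁ μ₂ p f g ε T u ut Du) (hψ : MemLp ψ 2) :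
    ContinuousOn (fun t => pairing ψ (u t)) (Ico 0 T) := by
  simp_rw [pairing_eq_innerSL hψ]
  exact (ContinuousLinearMap.continuous _).comp_continuousOn h.cont_u

lemma continuousOn_pairing_ut (h : IsEnergySolution μ₁ μ₂ p f g ε T u ut Du) (hψ : MemLp ψ 2) :
    ContinuousOn (fun t => pairing ψ (ut t)) (Ico 0 T) := by
  simp_rw [pairing_eq_innerSL hψ]
  exact (ContinuousLinearMap.continuous _).comp_continuousOn h.cont_ut

lemma hasDerivAt_pairing (h : IsEnergySolution μ₁ μ₂ p f g ε T u ut Du) (hψ : MemLp ψ 2)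
    (ht : t ∈ Ioo 0 T) : HasDerivAt (fun t => pairing ψ (u t)) (pairing ψ (ut t)) t := by
  simp_rw [pairing_eq_innerSL hψ]
  exact (ContinuousLinearMap.hasFDerivAt _).comp_hasDerivAt t
    ((h.hasDeriv t ⟨ht.1.le, ht.2⟩).hasDerivAt (Ico_mem_nhds ht.1 ht.2))

lemma memLp_weightMeasure (h : IsEnergySolution μ₁ μ₂ p f g ε T u ut Du) (hψ : IsTestWeight ψ)
    (ht : t ∈ Ioo 0 T) : MemLp (u t) (ENNReal.ofReal p) (weightMeasure ψ) :=
  have ⟨_, _, hc⟩ := hψ.exists_le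
  (h.memLp_loc t ht _ hψ.hasCompactSupport).of_measure_le_smul ENNReal.ofReal_ne_top
    (weightMeasure_le hc)

lemma continuousOn_source (h : IsEnergySolution μ₁ μ₂ p f g ε T u ut Du) (hp : 1 < p)
    (hψ : IsTestWeight ψ) : ContinuousOn (fun t => source p ψ (u t)) (Ioo 0 T) := by
  obtain ⟨c, -, hc⟩ := hψ.exists_le
  refine ContinuousOn.congr (ContinuousOn.rpow_const (fun t ht => ?_) fun _ _ => Or.inr ?_)
    fun t ht => hψ.source_eq_eLpNorm_rpow (by linarith) (h.memLp_weightMeasure hψ ht)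
  · refine ContinuousAt.continuousWithinAt ?_
    have hdiff : Tendsto (fun s => eLpNorm (fun x => u s x - u t x) (ENNReal.ofReal p)
        (weightMeasure ψ)) (𝓝 t) (𝓝 0) := by
      refine tendsto_of_tendsto_of_tendsto_of_le_of_le tendsto_const_nhds
        (mul_zero (_ : ℝ≥0∞) ▸ ENNReal.Tendsto.const_mul
          (h.cont_Lp_loc t ht _ hψ.hasCompactSupport) (Or.inr ?_))
        (fun _ => zero_le) fun s => eLpNorm_le_of_measure_le_smul (weightMeasure_le hc)
      exact ENNReal.rpow_ne_top_of_nonneg ENNReal.toReal_nonneg ENNReal.ofReal_ne_top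
    rw [ContinuousAt, tendsto_iff_norm_sub_tendsto_zero]
    refine squeeze_zero' (Eventually.of_forall fun _ => norm_nonneg _) ?_
      ((ENNReal.tendsto_toReal ENNReal.zero_ne_top).comp hdiff)
    filter_upwards [Ioo_mem_nhds ht.1 ht.2] with s hs
    exact abs_toReal_eLpNorm_sub_le (ENNReal.one_le_ofReal.2 hp.le)
      (h.memLp_weightMeasure hψ hs) (h.memLp_weightMeasure hψ ht)
  · linarith

lemma intervalIntegrable_source (h : IsEnergySolution μ₁ μ₂ p f g ε T u ut Du) (hp : 1 < p)
    (hψ : IsTestWeight ψ) (ht : t ∈ Ioo 0 T) :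
    IntervalIntegrable (fun s => source p ψ (u s)) volume 0 t := by
  obtain ⟨c, hc0, hc⟩ := hψ.exists_le
  have hp0 : 0 < p := by linarith
  have hsub : Ioc 0 t ⊆ Ioo 0 T := fun s hs => ⟨hs.1, hs.2.trans_lt ht.2⟩
  refine ((h.integrable_nonlin t ht _ hψ.hasCompactSupport).const_mul c).mono_fun' ?_ ?_
  · rw [uIoc_of_le ht.1.le]
    exact ((h.continuousOn_source hp hψ).mono hsub).aestronglyMeasurable measurableSet_Ioc
  · rw [uIoc_of_le ht.1.le]
    refine ae_restrict_of_forall_mem measurableSet_Ioc fun s hs => ?_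
    beta_reduce
    rw [Real.norm_of_nonneg (source_nonneg p hψ.nonneg _), hψ.source_eq_integral]
    have hint : Integrable (fun x => |u s x| ^ p) (volume.restrict (tsupport ψ)) := by
      simpa [ENNReal.toReal_ofReal hp0.le] using
        (h.memLp_loc s (hsub hs) _ hψ.hasCompactSupport).integrable_norm_rpow (by simpa using hp0)
          ENNReal.ofReal_ne_top
    refine (integral_mono_measure (weightMeasure_le hc)
      (ae_of_all _ fun _ => Real.rpow_nonneg (abs_nonneg _) _)
      (hint.smul_measure ENNReal.ofReal_ne_top)).trans_eq ?_
    rw [integral_smul_measure, ENNReal.toReal_ofReal hc0.le, smul_eq_mul]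

lemma pairing_ut_eq (h : IsEnergySolution μ₁ μ₂ p f g ε T u ut Du) (hψ : IsTestWeight ψ)
    (ht : t ∈ Ico 0 T) :
    pairing ψ (ut t) - pairing ψ (ut 0) + (∫ s in (0 : ℝ)..t, -pairing (Δ ψ) (u s))
      + (∫ s in (0 : ℝ)..t, μ₁ / (1 + s) * pairing ψ (ut s))
      + (∫ s in (0 : ℝ)..t, μ₂ / (1 + s) ^ 2 * pairing ψ (u s))
    = ∫ s in (0 : ℝ)..t, source p ψ (u s) := by
  obtain ⟨θ, hθT, hθ⟩ := exists_bump_eventuallyEq_one ht.1 ht.2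
  have hθ1 : ∀ s ∈ uIcc 0 t, θ s = 1 := fun s hs =>
    (hθ s (uIcc_of_le ht.1 ▸ hs)).self_of_nhds
  have hderiv : ∀ s ∈ uIcc 0 t, ∀ x, deriv (fun r => ψ x * θ r) s = 0 := by
    intro s hs x
    have hconst : (fun r => ψ x * θ r) =ᶠ[𝓝 s] fun _ => ψ x := by
      filter_upwards [hθ s (uIcc_of_le ht.1 ▸ hs)] with r hr
      rw [hr, mul_one]
    rw [hconst.deriv_eq, deriv_const]
  have hweak := h.weak_eq _ (hψ.isTestFunction_mul_bump θ hθT) t ht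
  have hslice {F : ℝ → Rn n → ℝ} :
      ∫ s in (0 : ℝ)..t, ∫ x, F s x * (ψ x * θ s) = ∫ s in (0 : ℝ)..t, ∫ x, F s x * ψ x :=
    intervalIntegral.integral_congr fun s hs => by simp only [hθ1 s hs, mul_one]
  have hgrad : (∫ s in (0 : ℝ)..t, ∫ x, (-(ut s x * deriv (fun r => ψ x * θ r) s)
      + fderiv ℝ (fun y => ψ y * θ s) x (Du s x)))
      = ∫ s in (0 : ℝ)..t, -pairing (Δ ψ) (u s) := by
    refine intervalIntegral.integral_congr fun s hs => ?_
    have hsT : s ∈ Ico 0 T := by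
      rw [uIcc_of_le ht.1] at hs
      exact ⟨hs.1, hs.2.trans_lt ht.2⟩
    simp only [hderiv s hs, mul_zero, neg_zero, zero_add, hθ1 s hs, mul_one]
    exact (h.weak_grad s hsT).integral_fderiv_eq hψ
  have hdata : ∫ x, ε * g x * ψ x = pairing ψ (ut 0) := by
    rw [h.init_ut, pairing_smul, pairing, ← integral_const_mul]
    simp only [mul_assoc]
  rw [hgrad, hslice, hslice, hslice] at hweak
  simp only [hθ1 0 left_mem_uIcc, hθ1 t right_mem_uIcc, mul_one, hdata] at hweak
  simpa only [pairing, source, mul_assoc, integral_const_mul] using hweak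

lemma hasDerivAt_pairing_ut (h : IsEnergySolution μ₁ μ₂ p f g ε T u ut Du) (hp : 1 < p)
    (hψ : IsTestWeight ψ) (ht : t ∈ Ioo 0 T) :
    HasDerivAt (fun t => pairing ψ (ut t))
      (source p ψ (u t) + pairing (Δ ψ) (u t)
        - μ₁ / (1 + t) * pairing ψ (ut t) - μ₂ / (1 + t) ^ 2 * pairing ψ (u t)) t := by
  have hu := h.continuousOn_pairing (hψ.memLp 2)
  have hut := h.continuousOn_pairing_ut (hψ.memLp 2)
  have hsource := h.continuousOn_source hp hψ
  have hcoeff (a : ℝ) (k : ℕ) : ContinuousOn (fun s : ℝ => a / (1 + s) ^ k) (Ico 0 T) :=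
    continuousOn_const.div (by fun_prop) fun s hs => pow_ne_zero k (by linarith [hs.1])
  have d_laplacian := hasDerivAt_integral_of_continuousOn_Ico
    (h.continuousOn_pairing (hψ.memLp_laplacian 2)).fun_neg ht
  have d_damping := hasDerivAt_integral_of_continuousOn_Ico ((hcoeff μ₁ 1).fun_mul hut) ht
  have d_mass := hasDerivAt_integral_of_continuousOn_Ico ((hcoeff μ₂ 2).fun_mul hu) ht
  have d_source : HasDerivAt (fun r => ∫ s in (0 : ℝ)..r, source p ψ (u s)) (source p ψ (u t)) t :=
    intervalIntegral.integral_hasDerivAt_right (h.intervalIntegrable_source hp hψ ht)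
      (hsource.stronglyMeasurableAtFilter isOpen_Ioo t ht)
      (hsource.continuousAt (Ioo_mem_nhds ht.1 ht.2))
  simp only [pow_one] at d_damping
  refine ((((d_source.sub d_laplacian).sub d_damping).sub d_mass).add_const
    (pairing ψ (ut 0))).congr_of_eventuallyEq ?_ |>.congr_deriv (by ring)
  filter_upwards [Ioo_mem_nhds ht.1 ht.2] with r hr
  have := h.pairing_ut_eq hψ ⟨hr.1.le, hr.2⟩
  simp only [Pi.sub_apply]
  linarith

end IsEnergySolution

section DampedEquation

variable {μ₁ μ₂ σ N t : ℝ} {Y Z : ℝ → ℝ}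

lemma hasDerivAt_rpow_mul_of_damped (ht : 0 ≤ t) (hY : HasDerivAt Y (Z t) t) :
    HasDerivAt (fun s => (1 + s) ^ ((μ₁ - 1 + σ) / 2) * Y s)
      ((1 + t) ^ (σ - 1) * ((1 + t) ^ ((1 + μ₁ - σ) / 2) * Z t
        + (μ₁ - 1 + σ) / 2 * (1 + t) ^ ((1 + μ₁ - σ) / 2 - 1) * Y t)) t := by
  have h1 : 0 < 1 + t := by linarith
  refine ((hasDerivAt_one_add_rpow ht _).mul hY).congr_deriv ?_
  have hexp : (1 + t) ^ ((μ₁ - 1 + σ) / 2) = (1 + t) ^ (σ - 1) * (1 + t) ^ ((1 + μ₁ - σ) / 2) := by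
    rw [← Real.rpow_add h1]
    congr 1
    ring
  rw [Real.rpow_sub_one h1.ne', Real.rpow_sub_one h1.ne' ((1 + μ₁ - σ) / 2), hexp]
  field_simp
  ring

/-- The powers of `1 + t` are those for which `μ₂ = ((μ₁ - 1)² - σ²) / 4` removes `Y` from the
derivative of the momentum. -/
lemma hasDerivAt_momentum_of_damped (ht : 0 ≤ t) (hσ : σ ^ 2 = (μ₁ - 1) ^ 2 - 4 * μ₂)
    (hY : HasDerivAt Y (Z t) t)
    (hZ : HasDerivAt Z (N - μ₁ / (1 + t) * Z t - μ₂ / (1 + t) ^ 2 * Y t) t) :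
    HasDerivAt (fun s => (1 + s) ^ ((1 + μ₁ - σ) / 2) * Z s
        + (μ₁ - 1 + σ) / 2 * (1 + s) ^ ((1 + μ₁ - σ) / 2 - 1) * Y s)
      ((1 + t) ^ ((1 + μ₁ - σ) / 2) * N) t := by
  have h1 : 0 < 1 + t := by linarith
  refine (((hasDerivAt_one_add_rpow ht _).mul hZ).add
    (((hasDerivAt_one_add_rpow ht ((1 + μ₁ - σ) / 2 - 1)).const_mul
      ((μ₁ - 1 + σ) / 2)).mul hY)).congr_deriv ?_
  rw [Real.rpow_sub_one h1.ne' ((1 + μ₁ - σ) / 2 - 1), Real.rpow_sub_one h1.ne',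
    show μ₂ = ((μ₁ - 1) ^ 2 - σ ^ 2) / 4 by linarith]
  field_simp
  ring

end DampedEquation

lemma IsMomentumSystem.shift_source {j k τ : ℝ} {M G N : ℝ → ℝ} (h : IsMomentumSystem j k τ M G N)
    (a : ℝ) : IsMomentumSystem j (k - a) τ M G fun t => (1 + t) ^ a * N t where
  contM := h.contM
  contG := h.contG
  derivM := h.derivM
  derivG t ht := by
    have ht1 : 0 < 1 + t := by linarith [ht.1]
    have hexp : (1 + t) ^ (k - a) * ((1 + t) ^ a * N t) = (1 + t) ^ k * N t := by
      rw [← mul_assoc, ← Real.rpow_add ht1, sub_add_cancel]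
    exact hexp ▸ h.derivG t ht
  source_nonneg t ht hM :=
    mul_nonneg (Real.rpow_nonneg (by linarith [ht.1]) _) (h.source_nonneg t ht hM)
  posM := h.posM
  nonnegG := h.nonnegG

namespace IsEnergySolution

variable {n : ℕ} {μ₁ μ₂ σ p : ℝ} {f g : L2 n} {ε R T τ : ℝ} {u ut : ℝ → L2 n} {Du : ℝ → L2vec n}

lemma ut_zero_eq (h : IsEnergySolution μ₁ μ₂ p f g ε T u ut Du) {a : ℝ} (hfg : a • f + g = 0) :
    ut 0 = (-a) • u 0 := by
  rw [h.init_ut, h.init_u, eq_neg_of_add_eq_zero_right hfg, smul_comm, neg_smul, smul_neg]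

/-- Plane waves need no cutoff thanks to the support condition. -/
lemma exists_isTestWeight_eq_planeWave (hp : 1 < p) (hu : SupportedInCone R T u) (hτT : τ < T)
    (ξ : Rn n) : ∃ ψ, IsTestWeight ψ ∧ ∀ t ∈ Icc 0 τ,
      pairing ψ (u t) = pairing (planeWave ξ) (u t) ∧
      source p ψ (u t) = source p (planeWave ξ) (u t) ∧
      pairing (Δ ψ) (u t) = ‖ξ‖ ^ 2 * pairing (planeWave ξ) (u t) := by
  obtain ⟨ψ, hψ, hψξ⟩ := exists_isTestWeight_eqOn_planeWave (τ + R + 1) ξ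
  have hball : Metric.closedBall (0 : Rn n) (τ + R) ⊆ Metric.ball 0 (τ + R + 1) :=
    Metric.closedBall_subset_ball (by linarith)
  have hΔ : EqOn (Δ ψ) (‖ξ‖ ^ 2 • planeWave ξ) (Metric.closedBall 0 (τ + R)) := fun x hx =>
    (InnerProductSpace.laplacian_congr_nhds (hψξ.eventuallyEq_of_mem
      (Metric.isOpen_ball.mem_nhds (hball hx)))).self_of_nhds.trans
      (congrFun (laplacian_planeWave ξ) x)
  refine ⟨ψ, hψ, fun t ht => ?_⟩
  have hsupp : SupportedInBall (τ + R) (u t) := by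
    filter_upwards [hu t ⟨ht.1, ht.2.trans_lt hτT⟩] with x hx hlt
    exact hx (by linarith [ht.2])
  refine ⟨hsupp.pairing_congr (hψξ.mono hball),
    hsupp.source_congr (by linarith) (hψξ.mono hball), (hsupp.pairing_congr hΔ).trans ?_⟩
  rw [pairing, pairing, ← integral_const_mul]
  exact integral_congr_ae (.of_forall fun x => mul_left_comm _ _ _)

lemma exists_isMomentumSystem (h : IsEnergySolution μ₁ μ₂ p f g ε T u ut Du) (hp : 1 < p)
    (hu : SupportedInCone R T u) (hσ : σ ^ 2 = (μ₁ - 1) ^ 2 - 4 * μ₂)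
    (hfg : ((μ₁ - 1 + σ) / 2) • f + g = 0) (hτT : τ < T) (ξ : Rn n)
    (hpos : 0 < pairing (planeWave ξ) (u 0)) :
    ∃ G, IsMomentumSystem (σ - 1) ((1 + μ₁ - σ) / 2) τ
      (fun t => (1 + t) ^ ((μ₁ - 1 + σ) / 2) * pairing (planeWave ξ) (u t)) G
      (fun t => source p (planeWave ξ) (u t) + ‖ξ‖ ^ 2 * pairing (planeWave ξ) (u t)) := by
  obtain ⟨ψ, hψ, hψξ⟩ := exists_isTestWeight_eq_planeWave hp hu hτT ξ
  have hIcc : Icc 0 τ ⊆ Ico 0 T := fun t ht => ⟨ht.1, ht.2.trans_lt hτT⟩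
  have hIoo : Ioo 0 τ ⊆ Ioo 0 T := Ioo_subset_Ioo_right hτT.le
  have hcont (e : ℝ) : ContinuousOn (fun t : ℝ => (1 + t) ^ e) (Icc 0 τ) := fun t ht =>
    (hasDerivAt_one_add_rpow ht.1 e).continuousAt.continuousWithinAt
  have hY := (h.continuousOn_pairing (hψ.memLp 2)).mono hIcc
  have hderivY {t : ℝ} (ht : t ∈ Ioo 0 τ) := h.hasDerivAt_pairing (hψ.memLp 2) (hIoo ht)
  refine ⟨fun t => (1 + t) ^ ((1 + μ₁ - σ) / 2) * pairing ψ (ut t)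
    + (μ₁ - 1 + σ) / 2 * (1 + t) ^ ((1 + μ₁ - σ) / 2 - 1) * pairing ψ (u t), ?_⟩
  refine {
    contM := ((hcont _).mul hY).congr fun t ht =>
      congrArg ((1 + t) ^ ((μ₁ - 1 + σ) / 2) * ·) (hψξ t ht).1.symm
    contG := ((hcont _).mul ((h.continuousOn_pairing_ut (hψ.memLp 2)).mono hIcc)).add
      ((continuousOn_const.mul (hcont _)).mul hY)
    derivM := fun t ht => ?_
    derivG := fun t ht => hasDerivAt_momentum_of_damped ht.1.le hσ (hderivY ht) ?_
    source_nonneg := fun t ht hM => ?_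
    posM := by simpa using hpos
    nonnegG := ?_ }
  · refine (hasDerivAt_rpow_mul_of_damped (Z := fun s => pairing ψ (ut s)) ht.1.le
      (hderivY ht)).congr_of_eventuallyEq ?_
    filter_upwards [Icc_mem_nhds ht.1 ht.2] with s hs
    rw [(hψξ s hs).1]
  · convert h.hasDerivAt_pairing_ut hp hψ (hIoo ht) using 1
    rw [(hψξ t (Ioo_subset_Icc_self ht)).2.1, (hψξ t (Ioo_subset_Icc_self ht)).2.2]
  · have hpos_t : 0 < (1 + t) ^ ((μ₁ - 1 + σ) / 2) := Real.rpow_pos_of_pos (by linarith [ht.1]) _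
    exact add_nonneg (source_nonneg p (fun x => (planeWave_pos ξ x).le) _)
      (mul_nonneg (sq_nonneg _) (pos_of_mul_pos_right hM hpos_t.le).le)
  · refine le_of_eq ?_
    rw [h.ut_zero_eq hfg, pairing_smul]
    simp

lemma exists_le_pairing_planeWave (μ₁ σ : ℝ) : ∃ c, 0 < c ∧
    ∀ {n : ℕ} {μ₂ p : ℝ} {f g : L2 n} {ε R T : ℝ} {u ut : ℝ → L2 n} {Du : ℝ → L2vec n} {ξ : Rn n}
      {t : ℝ}, IsEnergySolution μ₁ μ₂ p f g ε T u ut Du → 1 < p → SupportedInCone R T u →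
      σ ^ 2 = (μ₁ - 1) ^ 2 - 4 * μ₂ → ((μ₁ - 1 + σ) / 2) • f + g = 0 → ‖ξ‖ = 1 →
      0 < pairing (planeWave ξ) (u 0) → t ∈ Ico 0 T →
      c * pairing (planeWave ξ) (u 0) * ((1 + t) ^ (-(μ₁ / 2)) * Real.exp t)
        ≤ pairing (planeWave ξ) (u t) := by
  obtain ⟨c, hc, hgrowth⟩ := exists_mul_exp_le_of_momentumSystem ((1 - σ) / 2)
  refine ⟨c, hc, fun {n μ₂ p f g ε R T u ut Du ξ t} h hp hu hσ hfg hξ hpos ht => ?_⟩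
  obtain ⟨G, hG⟩ := h.exists_isMomentumSystem hp hu hσ hfg ht.2 ξ hpos
  have hsystem := hG.shift_source ((μ₁ - 1 + σ) / 2)
  rw [show σ - 1 = -(2 * ((1 - σ) / 2)) by ring,
    show (1 + μ₁ - σ) / 2 - (μ₁ - 1 + σ) / 2 = 2 * ((1 - σ) / 2) by ring] at hsystem
  have ht1 : 0 < 1 + t := by linarith [ht.1]
  have hle := hgrowth _ _ _ _ hsystem (fun s hs => ?_) t ⟨ht.1, le_rfl⟩
  · have hexp : (1 + t) ^ (-((1 - σ) / 2))
        = (1 + t) ^ ((μ₁ - 1 + σ) / 2) * (1 + t) ^ (-(μ₁ / 2)) := by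
      rw [← Real.rpow_add ht1]
      congr 1
      ring
    rw [hexp, add_zero, Real.one_rpow, one_mul] at hle
    refine le_of_mul_le_mul_left (le_trans (le_of_eq ?_) hle)
      (Real.rpow_pos_of_pos ht1 ((μ₁ - 1 + σ) / 2))
    ring
  · have hs1 : 0 ≤ (1 + s) ^ ((μ₁ - 1 + σ) / 2) := Real.rpow_nonneg (by linarith [hs.1]) _
    refine mul_le_mul_of_nonneg_left ?_ hs1
    rw [hξ, one_pow, one_mul]
    exact le_add_of_nonneg_left (source_nonneg p (fun x => (planeWave_pos ξ x).le) _)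

end IsEnergySolution

/-! ### Lower bounds for the nonlinear term -/

section SupportedInBall

variable {n : ℕ} {A p q : ℝ} {w : L2 n} {Φ : Rn n → ℝ}

lemma integrableOn_closedBall (w : L2 n) (A : ℝ) : IntegrableOn w (Metric.closedBall 0 A) :=
  ((Lp.memLp w).locallyIntegrable one_le_two).integrableOn_isCompact (isCompact_closedBall 0 A)

lemma SupportedInBall.pairing_eq_setIntegral (hw : SupportedInBall A w) (Φ : Rn n → ℝ) :
    pairing Φ w = ∫ x in Metric.closedBall 0 A, w x * Φ x := by
  refine (setIntegral_eq_integral_of_ae_compl_eq_zero ?_).symm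
  filter_upwards [hw] with x hx hxA
  rw [hx (by simpa using hxA), zero_mul]

lemma SupportedInBall.integrable_mul (hw : SupportedInBall A w) (hΦ : Continuous Φ) :
    Integrable fun x => w x * Φ x := by
  refine ((integrableOn_closedBall w A).mul_continuousOn hΦ.continuousOn
    (isCompact_closedBall 0 A)).integrable_of_ae_notMem_eq_zero ?_
  filter_upwards [hw] with x hx hxA
  rw [hx (by simpa using hxA), zero_mul]

lemma SupportedInBall.source_eq_setIntegral (hw : SupportedInBall A w) (hp : p ≠ 0) :
    source p (planeWave 0) w = ∫ x in Metric.closedBall 0 A, |w x| ^ p := by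
  simp only [source, planeWave, inner_zero_left, Real.exp_zero, mul_one]
  refine (setIntegral_eq_integral_of_ae_compl_eq_zero ?_).symm
  filter_upwards [hw] with x hx hxA
  rw [hx (by simpa using hxA), abs_zero, Real.zero_rpow hp]

lemma SupportedInBall.pairing_pos (hw : SupportedInBall A w) (hw0 : 0 ≤ w) (hne : w ≠ 0)
    (hΦ : Continuous Φ) (hpos : ∀ x, 0 < Φ x) : 0 < pairing Φ w := by
  have hw0' : ∀ᵐ x, 0 ≤ w x := (Lp.coeFn_nonneg w).2 hw0
  have hnonneg : 0 ≤ᵐ[volume] fun x => w x * Φ x :=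
    hw0'.mono fun x hx => mul_nonneg hx (hpos x).le
  refine (integral_nonneg_of_ae hnonneg).lt_of_ne fun hzero => hne (Lp.eq_zero_iff_ae_eq_zero.2 ?_)
  filter_upwards [(integral_eq_zero_iff_of_nonneg_ae hnonneg (hw.integrable_mul hΦ)).1 hzero.symm]
    with x hx
  exact (mul_eq_zero.1 hx).resolve_right (hpos x).ne'

lemma continuous_planeWave (ξ : Rn n) : Continuous (planeWave ξ) :=
  (contDiff_planeWave ξ).continuous

lemma SupportedInBall.exp_neg_mul_pairing_le (hw : SupportedInBall A w) (hw0 : 0 ≤ w) {ξ : Rn n}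
    (hξ : ‖ξ‖ ≤ 1) : Real.exp (-A) * pairing (planeWave 0) w ≤ pairing (planeWave ξ) w := by
  rw [pairing, pairing, ← integral_const_mul]
  refine integral_mono_ae ((hw.integrable_mul (continuous_planeWave 0)).const_mul _)
    (hw.integrable_mul (continuous_planeWave ξ)) ?_
  filter_upwards [hw, (Lp.coeFn_nonneg w).2 hw0] with x hx hx0
  rcases le_or_gt ‖x‖ A with hxA | hxA
  · have hinner : |inner ℝ ξ x| ≤ A := by
      refine (abs_real_inner_le_norm ξ x).trans ?_
      nlinarith [norm_nonneg x]
    simp only [planeWave, inner_zero_left, Real.exp_zero, mul_one]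
    rw [mul_comm]
    exact mul_le_mul_of_nonneg_left (Real.exp_le_exp.2 (by linarith [(abs_le.1 hinner).1])) hx0
  · simp only [hx hxA, zero_mul, mul_zero, le_refl]

lemma rpow_abs_integral_mul_le {α : Type*} [MeasurableSpace α] {ν : Measure α} {v Φ : α → ℝ}
    (hpq : p.HolderConjugate q) (hv : MemLp v (ENNReal.ofReal p) ν)
    (hΦ : MemLp Φ (ENNReal.ofReal q) ν) (hΦ0 : ∀ x, 0 ≤ Φ x) :
    |∫ x, v x * Φ x ∂ν| ^ p ≤ (∫ x, |v x| ^ p ∂ν) * (∫ x, Φ x ^ q ∂ν) ^ (p - 1) := by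
  have hI : 0 ≤ ∫ x, |v x| ^ p ∂ν := integral_nonneg fun _ => Real.rpow_nonneg (abs_nonneg _) _
  have hJ : 0 ≤ ∫ x, Φ x ^ q ∂ν := integral_nonneg fun x => Real.rpow_nonneg (hΦ0 x) _
  have hHolder : |∫ x, v x * Φ x ∂ν|
      ≤ (∫ x, |v x| ^ p ∂ν) ^ (1 / p) * (∫ x, Φ x ^ q ∂ν) ^ (1 / q) :=
    calc |∫ x, v x * Φ x ∂ν| ≤ ∫ x, |v x * Φ x| ∂ν := abs_integral_le_integral_abs
      _ = ∫ x, |v x| * Φ x ∂ν := by simp only [abs_mul, abs_of_nonneg (hΦ0 _)]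
      _ ≤ _ := integral_mul_le_Lp_mul_Lq_of_nonneg hpq (ae_of_all _ fun _ => abs_nonneg _)
          (ae_of_all _ hΦ0) hv.abs hΦ
  have hexp : 1 / q * p = p - 1 := by
    have := hpq.sub_one_mul_conj
    have := hpq.symm.pos
    field_simp
    linarith
  calc |∫ x, v x * Φ x ∂ν| ^ p
      ≤ ((∫ x, |v x| ^ p ∂ν) ^ (1 / p) * (∫ x, Φ x ^ q ∂ν) ^ (1 / q)) ^ p :=
        Real.rpow_le_rpow (abs_nonneg _) hHolder hpq.nonneg
    _ = (∫ x, |v x| ^ p ∂ν) * (∫ x, Φ x ^ q ∂ν) ^ (p - 1) := by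
      rw [Real.mul_rpow (by positivity) (by positivity), ← Real.rpow_mul hI,
        one_div_mul_cancel hpq.ne_zero, Real.rpow_one, ← Real.rpow_mul hJ, hexp]

lemma SupportedInBall.rpow_abs_pairing_le (hw : SupportedInBall A w) (hpq : p.HolderConjugate q)
    (hwp : MemLp w (ENNReal.ofReal p) (volume.restrict (Metric.closedBall 0 A)))
    (hΦ : Continuous Φ) (hΦ0 : ∀ x, 0 ≤ Φ x) :
    |pairing Φ w| ^ p
      ≤ source p (planeWave 0) w * (∫ x in Metric.closedBall 0 A, Φ x ^ q) ^ (p - 1) := by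
  have : IsFiniteMeasure (volume.restrict (Metric.closedBall (0 : Rn n) A)) :=
    isFiniteMeasure_restrict.2 measure_closedBall_lt_top.ne
  obtain ⟨K, hK⟩ := (isCompact_closedBall (0 : Rn n) A).exists_bound_of_continuousOn hΦ.continuousOn
  rw [hw.pairing_eq_setIntegral, hw.source_eq_setIntegral hpq.ne_zero]
  exact rpow_abs_integral_mul_le hpq hwp (MemLp.of_bound hΦ.aestronglyMeasurable K
    (ae_restrict_of_forall_mem measurableSet_closedBall hK)) hΦ0

lemma SupportedInBall.integral_pairing_normalize (hw : SupportedInBall A w) :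
    IntegrableOn (fun y => pairing (planeWave (NormedSpace.normalize y)) w) (Metric.ball 0 1) ∧
      ∫ y in Metric.ball 0 1, pairing (planeWave (NormedSpace.normalize y)) w
        = pairing waveAvg w := by
  let ν := volume.restrict (Metric.ball (0 : Rn n) 1)
  let κ := volume.restrict (Metric.closedBall (0 : Rn n) A)
  have : IsFiniteMeasure ν := isFiniteMeasure_restrict.2 measure_ball_lt_top.ne
  have hmeas : Measurable fun z : Rn n × Rn n => planeWave (NormedSpace.normalize z.1) z.2 :=
    Real.measurable_exp.comp ((measurable_normalize.comp measurable_fst).inner measurable_snd)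
  have hbound : ∀ᵐ z ∂ν.prod κ, ‖planeWave (NormedSpace.normalize z.1) z.2‖ ≤ Real.exp A := by
    rw [Measure.prod_restrict]
    refine ae_restrict_of_forall_mem (measurableSet_ball.prod measurableSet_closedBall)
      fun z hz => ?_
    rw [planeWave, Real.norm_eq_abs, Real.abs_exp, real_inner_comm]
    exact Real.exp_le_exp.2 ((inner_normalize_le _ _).trans (mem_closedBall_zero_iff.1 hz.2))
  have hint : Integrable (Function.uncurry fun y x => w x * planeWave (NormedSpace.normalize y) x)
      (ν.prod κ) :=
    (Integrable.comp_snd (integrableOn_closedBall w A) ν).mul_bdd hmeas.aestronglyMeasurable hbound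
  simp only [hw.pairing_eq_setIntegral]
  refine ⟨hint.integral_prod_left, (integral_integral_swap hint).trans ?_⟩
  simp only [integral_const_mul, waveAvg, planeWave, real_inner_comm, ν, κ]

end SupportedInBall

lemma exists_one_add_add_rpow_le (e : ℝ) {R : ℝ} (hR : 0 ≤ R) :
    ∃ C : ℝ, 0 < C ∧ ∀ t : ℝ, 0 ≤ t → (1 + (t + R)) ^ e ≤ C * (1 + t) ^ e := by
  refine ⟨max 1 ((1 + R) ^ e), by positivity, fun t ht => ?_⟩
  rcases le_total 0 e with he | he
  · calc (1 + (t + R)) ^ e ≤ ((1 + R) * (1 + t)) ^ e :=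
          Real.rpow_le_rpow (by linarith) (by nlinarith) he
      _ = (1 + R) ^ e * (1 + t) ^ e := Real.mul_rpow (by linarith) (by linarith)
      _ ≤ _ := by gcongr; exact le_max_right _ _
  · calc (1 + (t + R)) ^ e ≤ 1 * (1 + t) ^ e := by
          rw [one_mul]
          exact Real.rpow_le_rpow_of_nonpos (by linarith) (by linarith) he
      _ ≤ _ := by gcongr; exact le_max_left _ _

lemma rpow_mul_exp_rpow_eq {n : ℕ} {p q : ℝ} (hpq : p.HolderConjugate q) (μ : ℝ) {t : ℝ}
    (ht : 0 ≤ t) :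
    ((1 + t) ^ (-(μ / 2)) * Real.exp t) ^ p = (1 + t) ^ ((n : ℝ) - 1 - (n + μ - 1) * p / 2) *
      (Real.exp (q * t) * (1 + t) ^ (((n : ℝ) - 1) * (1 - q / 2))) ^ (p - 1) := by
  have ht1 : 0 < 1 + t := by linarith
  rw [Real.mul_rpow (by positivity) (Real.exp_pos t).le,
    Real.mul_rpow (Real.exp_pos _).le (by positivity), ← Real.exp_mul, ← Real.exp_mul,
    ← Real.rpow_mul ht1.le, ← Real.rpow_mul ht1.le, mul_left_comm, ← Real.rpow_add ht1, mul_comm]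
  congr 2
  · linear_combination -t * hpq.sub_one_mul_conj
  · linear_combination ((n : ℝ) - 1) / 2 * hpq.sub_one_mul_conj

lemma exists_integral_waveAvg_rpow_add_le {n : ℕ} (hn : 1 ≤ n) {q R : ℝ} (hq : 1 < q) (hR : 0 ≤ R) :
    ∃ D : ℝ, 0 < D ∧ ∀ t : ℝ, 0 ≤ t →
      ∫ x in Metric.closedBall (0 : Rn n) (t + R), waveAvg x ^ q
        ≤ D * (Real.exp (q * t) * (1 + t) ^ (((n : ℝ) - 1) * (1 - q / 2))) := by
  obtain ⟨C, hC, hwave⟩ := exists_integral_waveAvg_rpow_le hn hq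
  obtain ⟨C', hC', hshift⟩ := exists_one_add_add_rpow_le (((n : ℝ) - 1) * (1 - q / 2)) hR
  refine ⟨C * Real.exp (q * R) * C', by positivity, fun t ht => ?_⟩
  calc _ ≤ C * Real.exp (q * (t + R)) * (1 + (t + R)) ^ (((n : ℝ) - 1) * (1 - q / 2)) :=
        hwave _ (add_nonneg ht hR)
    _ ≤ C * Real.exp (q * (t + R)) * (C' * (1 + t) ^ (((n : ℝ) - 1) * (1 - q / 2))) :=
        mul_le_mul_of_nonneg_left (hshift t ht) (by positivity)
    _ = _ := by rw [mul_add, Real.exp_add]; ring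

namespace IsEnergySolution

variable {n : ℕ} {μ₁ μ₂ σ p : ℝ} {f g : L2 n} {ε R T τ : ℝ} {u ut : ℝ → L2 n} {Du : ℝ → L2vec n}

lemma supportedInBall_init (h : IsEnergySolution μ₁ μ₂ p f g ε T u ut Du) (hT : 0 < T)
    (hu : SupportedInCone R T u) (hε : ε ≠ 0) : SupportedInBall R f := by
  have hu0 := hu 0 ⟨le_rfl, hT⟩
  rw [h.init_u] at hu0
  filter_upwards [hu0, Lp.coeFn_smul ε f] with x hx hsmul hxR
  have hx0 := hx (by rwa [zero_add])
  rw [hsmul, Pi.smul_apply, smul_eq_mul] at hx0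
  exact (mul_eq_zero.1 hx0).resolve_left hε

lemma mul_exp_neg_mul_pairing_le (h : IsEnergySolution μ₁ μ₂ p f g ε T u ut Du) (hε : 0 ≤ ε)
    (hf : 0 ≤ f) (hfR : SupportedInBall R f) {ξ : Rn n} (hξ : ‖ξ‖ ≤ 1) :
    ε * (Real.exp (-R) * pairing (planeWave 0) f) ≤ pairing (planeWave ξ) (u 0) := by
  rw [h.init_u, pairing_smul]
  exact mul_le_mul_of_nonneg_left (hfR.exp_neg_mul_pairing_le hf hξ) hε

/-- Plane waves in all directions are averaged. -/
lemma exists_le_pairing_waveAvg (hn : 1 ≤ n) (hσ : σ ^ 2 = (μ₁ - 1) ^ 2 - 4 * μ₂)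
    (hfg : ((μ₁ - 1 + σ) / 2) • f + g = 0) (hf : 0 ≤ f) (hf_ne : f ≠ 0)
    (hfR : SupportedInBall R f) : ∃ c, 0 < c ∧
      ∀ {p ε T : ℝ} {u ut : ℝ → L2 n} {Du : ℝ → L2vec n} {t : ℝ},
        IsEnergySolution μ₁ μ₂ p f g ε T u ut Du → 1 < p → SupportedInCone R T u → 0 < ε →
        t ∈ Ico 0 T → c * ε * ((1 + t) ^ (-(μ₁ / 2)) * Real.exp t) ≤ pairing waveAvg (u t) := by
  obtain ⟨c, hc, hgrowth⟩ := exists_le_pairing_planeWave μ₁ σ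
  set I := Real.exp (-R) * pairing (planeWave 0) f
  have hI : 0 < I :=
    mul_pos (Real.exp_pos _) (hfR.pairing_pos hf hf_ne (continuous_planeWave 0) (planeWave_pos 0))
  have hvol := volume_real_unitBall_pos n
  refine ⟨volume.real (Metric.ball (0 : Rn n) 1) * (c * I), by positivity,
    fun {p ε T u ut Du t} h hp hu hε ht => ?_⟩
  obtain ⟨hint, havg⟩ := SupportedInBall.integral_pairing_normalize (hu t ht)
  have ht1 : 0 < 1 + t := by linarith [ht.1]
  have hle (y : Rn n) (hy : y ≠ 0) : c * (ε * I) * ((1 + t) ^ (-(μ₁ / 2)) * Real.exp t)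
      ≤ pairing (planeWave (NormedSpace.normalize y)) (u t) := by
    have hdata := h.mul_exp_neg_mul_pairing_le hε.le hf hfR (norm_normalize_le_one y)
    refine le_trans ?_ (hgrowth h hp hu hσ hfg (NormedSpace.norm_normalize_eq_one_iff.2 hy)
      ((mul_pos hε hI).trans_le hdata) ht)
    gcongr
  have : Nonempty (Fin n) := ⟨⟨0, hn⟩⟩
  have hne : ∀ᵐ y : Rn n, y ≠ 0 := by rw [ae_iff]; simp
  calc _ = ∫ _ in Metric.ball (0 : Rn n) 1,
          c * (ε * I) * ((1 + t) ^ (-(μ₁ / 2)) * Real.exp t) := by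
        rw [setIntegral_const, smul_eq_mul]
        ring
    _ ≤ ∫ y in Metric.ball (0 : Rn n) 1, pairing (planeWave (NormedSpace.normalize y)) (u t) :=
        integral_mono_ae (integrableOn_const (hs := measure_ball_lt_top.ne)) hint
          (ae_restrict_of_ae (hne.mono hle))
    _ = pairing waveAvg (u t) := havg

lemma exists_mul_rpow_le_source (hn : 1 ≤ n) (hR : 0 ≤ R) (hp : 1 < p)
    (hσ : σ ^ 2 = (μ₁ - 1) ^ 2 - 4 * μ₂) (hfg : ((μ₁ - 1 + σ) / 2) • f + g = 0) (hf : 0 ≤ f)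
    (hf_ne : f ≠ 0) (hfR : SupportedInBall R f) : ∃ c, 0 < c ∧
      ∀ {ε T : ℝ} {u ut : ℝ → L2 n} {Du : ℝ → L2vec n} {t : ℝ},
        IsEnergySolution μ₁ μ₂ p f g ε T u ut Du → SupportedInCone R T u → 0 < ε → t ∈ Ioo 0 T →
        c * ε ^ p * (1 + t) ^ ((n : ℝ) - 1 - (n + μ₁ - 1) * p / 2)
          ≤ source p (planeWave 0) (u t) := by
  have hpq : p.HolderConjugate p.conjExponent := Real.HolderConjugate.conjExponent hp
  obtain ⟨c, hc, hlower⟩ := exists_le_pairing_waveAvg hn hσ hfg hf hf_ne hfR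
  obtain ⟨D, hD, hupper⟩ := exists_integral_waveAvg_rpow_add_le hn hpq.symm.lt hR
  refine ⟨c ^ p / D ^ (p - 1), by positivity, fun {ε T u ut Du t} h hu hε ht => ?_⟩
  have ht1 : 0 < 1 + t := by linarith [ht.1]
  have ht' : t ∈ Ico 0 T := Ioo_subset_Ico_self ht
  set E := (1 + t) ^ (-(μ₁ / 2)) * Real.exp t with hE
  set F := Real.exp (p.conjExponent * t) * (1 + t) ^ (((n : ℝ) - 1) * (1 - p.conjExponent / 2))
    with hF
  have hE0 : 0 < E := by positivity
  have hF0 : 0 < F := by positivity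
  have hsource0 := source_nonneg p (fun x => (planeWave_pos 0 x).le) (u t)
  have hHolder := SupportedInBall.rpow_abs_pairing_le (hu t ht') hpq
    (h.memLp_loc t ht _ (isCompact_closedBall 0 _)) continuous_waveAvg waveAvg_nonneg
  have hpow : (c * ε * E) ^ p ≤ source p (planeWave 0) (u t) * (D * F) ^ (p - 1) :=
    calc (c * ε * E) ^ p ≤ |pairing waveAvg (u t)| ^ p :=
          Real.rpow_le_rpow (by positivity) ((hlower h hp hu hε ht').trans (le_abs_self _))
            hpq.nonneg
      _ ≤ _ := hHolder.trans (mul_le_mul_of_nonneg_left (Real.rpow_le_rpow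
          (integral_nonneg fun x => Real.rpow_nonneg (waveAvg_nonneg x) _) (hupper t ht.1.le)
          (by linarith)) hsource0)
  rw [Real.mul_rpow (by positivity) hE0.le, Real.mul_rpow hc.le hε.le,
    Real.mul_rpow hD.le hF0.le, hE, rpow_mul_exp_rpow_eq hpq μ₁ ht.1.le, ← hF] at hpow
  have hF1 : 0 < F ^ (p - 1) := Real.rpow_pos_of_pos hF0 _
  rw [div_mul_eq_mul_div, div_mul_eq_mul_div, div_le_iff₀ (by positivity)]
  exact le_of_mul_le_mul_right (by linarith) hF1

lemma exists_mul_rpow_mul_pairing_le_source (hR : 0 ≤ R) (hp : 1 < p) : ∃ c, 0 < c ∧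
    ∀ {μ₁ μ₂ : ℝ} {f g : L2 n} {ε T : ℝ} {u ut : ℝ → L2 n} {Du : ℝ → L2vec n} {t : ℝ},
      IsEnergySolution μ₁ μ₂ p f g ε T u ut Du → SupportedInCone R T u → t ∈ Ioo 0 T →
      c * (1 + t) ^ (-(n * (p - 1))) * |pairing (planeWave 0) (u t)| ^ p
        ≤ source p (planeWave 0) (u t) := by
  have hpq : p.HolderConjugate p.conjExponent := Real.HolderConjugate.conjExponent hp
  set v := volume.real (Metric.ball (0 : Rn n) 1)
  have hv : 0 < v := volume_real_unitBall_pos n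
  refine ⟨1 / ((1 + R) ^ n * v) ^ (p - 1), by positivity,
    fun {μ₁ μ₂ f g ε T u ut Du t} h hu ht => ?_⟩
  have ht1 : 0 < 1 + t := by linarith [ht.1]
  have hsource0 := source_nonneg p (fun x => (planeWave_pos 0 x).le) (u t)
  have hHolder := SupportedInBall.rpow_abs_pairing_le (hu t (Ioo_subset_Ico_self ht)) hpq
    (h.memLp_loc t ht _ (isCompact_closedBall 0 _)) (continuous_planeWave 0)
    fun x => (planeWave_pos 0 x).le
  have hball : ∫ x in Metric.closedBall (0 : Rn n) (t + R), planeWave 0 x ^ p.conjExponent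
      ≤ (1 + R) ^ n * v * (1 + t) ^ (n : ℝ) := by
    simp only [planeWave, inner_zero_left, Real.exp_zero, Real.one_rpow]
    rw [setIntegral_const, smul_eq_mul, mul_one,
      Measure.addHaar_real_closedBall _ _ (by linarith [ht.1]), finrank_euclideanSpace_fin,
      Real.rpow_natCast, mul_right_comm, ← mul_pow]
    gcongr
    · linarith [ht.1]
    · nlinarith [ht.1]
  have hpow := hHolder.trans (mul_le_mul_of_nonneg_left (Real.rpow_le_rpow
    (integral_nonneg fun x => Real.rpow_nonneg (planeWave_pos 0 x).le _) hball
    (sub_nonneg.2 hp.le)) hsource0)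
  rw [Real.mul_rpow (by positivity) (by positivity), ← Real.rpow_mul ht1.le] at hpow
  rw [Real.rpow_neg ht1.le, ← one_div, one_div_mul_one_div, div_mul_eq_mul_div, one_mul,
    div_le_iff₀ (by positivity)]
  exact hpow

end IsEnergySolution

/-! ### Comparison of the exponents -/

section Exponents

variable {p ν ν' μ₁ δ : ℝ} {n : ℕ}

lemma gammaF_le_gammaF (hp : 1 ≤ p) (hν : ν ≤ ν') : gammaF p ν' ≤ gammaF p ν := by
  have := mul_le_mul_of_nonneg_right hν (sub_nonneg.2 hp)
  rw [gammaF, gammaF]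
  linarith

lemma lt_pF_iff (hp : 1 < p) : (p : EReal) < pF ν ↔ 0 < gammaF p ν := by
  rw [gammaF, pF, sub_pos]
  split_ifs with hν
  · rw [EReal.coe_lt_coe_iff, ← sub_lt_iff_lt_add', lt_div_iff₀ hν, mul_comm]
  · exact iff_of_true (EReal.coe_lt_top p) (by nlinarith)

lemma dStar_nonneg (ν : ℝ) : 0 ≤ dStar ν := by
  rw [dStar]
  split_ifs with hν
  · have : 1 + ν ≤ √(ν ^ 2 + 10 * ν - 7) := Real.le_sqrt_of_sq_le (by nlinarith)
    linarith
  · exact le_rfl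

lemma two_add_dStar_mul (hν : 1 ≤ ν) : (2 + dStar ν) * (ν - 1 + dStar ν) = 4 * (ν - 1) := by
  rcases hν.eq_or_lt with rfl | hν
  · simp [dStar]
  · rw [dStar, if_pos hν]
    linear_combination Real.sq_sqrt (by nlinarith : 0 ≤ ν ^ 2 + 10 * ν - 7) / 4

lemma pS_eq_pF (hν : 1 ≤ ν) : pS ν = pF ((ν - 1 + dStar ν) / 2) := by
  have hd := dStar_nonneg ν
  have hquad := two_add_dStar_mul hν
  rcases hν.eq_or_lt with rfl | hν
  · simp [pS, pF, dStar]
  · rw [pS, pF, if_pos hν, if_pos (by linarith),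
      show ν + 1 + √(ν ^ 2 + 10 * ν - 7) = 2 * (ν + 1 + dStar ν) by
        rw [dStar, if_pos hν]; ring]
    congr 1
    have h₁ : ν - 1 ≠ 0 := by linarith
    have h₂ : ν - 1 + dStar ν ≠ 0 := by linarith
    field_simp
    linear_combination hquad

lemma two_mul_gammaS (hν : 1 ≤ ν) :
    2 * gammaS p ν = ((2 + dStar ν) * (p - 1) + 4) * gammaF p ((ν - 1 + dStar ν) / 2) := by
  rw [gammaS, gammaF]
  linear_combination (p - 1) ^ 2 / 2 * two_add_dStar_mul hν

lemma gammaS_pos (hν : 1 ≤ ν) (hp : 1 < p) (h : 0 < gammaF p ((ν - 1 + dStar ν) / 2)) :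
    0 < gammaS p ν := by
  have hd := dStar_nonneg ν
  have : 0 < p - 1 := sub_pos.2 hp
  have : 0 < 2 * gammaS p ν := two_mul_gammaS hν ▸ mul_pos (by positivity) h
  linarith

lemma heatDim_eq (n : ℕ) (μ₁ δ : ℝ) : heatDim n μ₁ δ = (n + μ₁ - 1 + (n - √δ)) / 2 := by
  rw [heatDim]
  ring

/-- Since `p_S(ν) = p_F((ν - 1 + d_*)/2)`, comparing `n - √δ` with `d_*(n + μ₁)` decides which of
the two exponents is the maximum. -/
lemma gammaF_pos_or_of_lt_pCrit (hν : 1 ≤ n + μ₁) (hp : 1 < p) (hpc : (p : EReal) < pCrit n μ₁ δ) :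
    0 < gammaF p (heatDim n μ₁ δ) ∨ 0 < gammaF p ((n + μ₁ - 1 + dStar (n + μ₁)) / 2) := by
  rwa [pCrit, pS_eq_pF hν, lt_max_iff, lt_pF_iff hp, lt_pF_iff hp] at hpc

lemma gammaS_pos_of_sqrt_le (hν : 1 ≤ n + μ₁) (hp : 1 < p) (hpc : (p : EReal) < pCrit n μ₁ δ)
    (hδ : √δ ≤ n - dStar (n + μ₁)) : 0 < gammaS p (n + μ₁) := by
  refine gammaS_pos hν hp ((gammaF_pos_or_of_lt_pCrit hν hp hpc).elim (fun h => ?_) id)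
  exact h.trans_le (gammaF_le_gammaF hp.le (by rw [heatDim_eq]; linarith))

lemma gammaF_pos_of_lt_sqrt (hν : 1 ≤ n + μ₁) (hp : 1 < p) (hpc : (p : EReal) < pCrit n μ₁ δ)
    (hδ : n - dStar (n + μ₁) < √δ) : 0 < gammaF p (heatDim n μ₁ δ) := by
  refine (gammaF_pos_or_of_lt_pCrit hν hp hpc).elim id fun h => ?_
  exact h.trans_le (gammaF_le_gammaF hp.le (by rw [heatDim_eq]; linarith))

lemma gammaS_pos_of_lt_pStar (hν : 1 ≤ n + μ₁) (hp : 1 < p) (hps : (p : EReal) < pStar n μ₁ δ)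
    (hδ : n - dStar (n + μ₁) < √δ) : 0 < gammaS p (n + μ₁) := by
  refine gammaS_pos hν hp ?_
  rcases hν.eq_or_lt with hν1 | hν1
  · simp [← hν1, dStar, gammaF]
  · rw [pStar, if_neg hν1.ne', EReal.coe_lt_coe_iff, ← sub_lt_iff_lt_add',
      lt_div_iff₀ (by linarith)] at hps
    have hd := dStar_nonneg (n + μ₁)
    have hlt : (2 + dStar (n + μ₁)) * ((n + μ₁ - 1 + dStar (n + μ₁)) * (p - 1))
        < (2 + dStar (n + μ₁)) * 4 := by
      rw [← mul_assoc, two_add_dStar_mul hν]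
      linarith
    have := lt_of_mul_lt_mul_left hlt (by positivity)
    rw [gammaF]
    linarith

lemma mul_eq_of_eq_pStar (hps : (p : EReal) = pStar n μ₁ δ) :
    (n + μ₁ - 1) * (p - 1) = n - √δ + 2 := by
  rw [pStar] at hps
  split_ifs at hps with hν
  · exact absurd hps (EReal.coe_ne_top p)
  · rw [EReal.coe_eq_coe_iff] at hps
    rw [hps, add_sub_cancel_left, mul_div_cancel₀ _ (sub_ne_zero.2 hν)]

lemma rStar_le (hμ₁ : 0 ≤ μ₁) (hδ : √δ < 1) : rStar μ₁ δ ≤ 1 + 4 / (μ₁ + 1 + √δ) := by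
  have hs : 0 ≤ √δ := Real.sqrt_nonneg δ
  have hle : 1 + 2 * ((2 - √δ) / (1 + μ₁ + √δ)) ≤ 1 + 4 / (μ₁ + 1 + √δ) := by
    rw [← mul_div_assoc, add_comm 1 μ₁]
    gcongr
    linarith
  rw [rStar]
  split_ifs with h₁ h₂
  · exact hle
  · rwa [← h₂]
  · set r := √(μ₁ ^ 2 + 16)
    have hr : r ^ 2 = μ₁ ^ 2 + 16 := Real.sq_sqrt (by positivity)
    have hroots : (√δ - (1 + μ₁ / 2 - r / 2)) * (√δ - (1 + μ₁ / 2 + r / 2)) ≤ 0 :=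
      mul_nonpos_of_nonneg_of_nonpos (sub_nonneg.2 (not_lt.1 h₁))
        (by linarith [Real.sqrt_nonneg (μ₁ ^ 2 + 16)])
    rw [← sub_le_iff_le_add', div_sub_one (by positivity), div_le_div_iff₀ (by positivity)
      (by positivity)]
    nlinarith

lemma gammaF_pos_of_lt_rStar (hμ₁ : 0 ≤ μ₁) (hδ : δ < 1) (h : p < rStar μ₁ δ) :
    0 < gammaF p ((μ₁ + 1 + √δ) / 2) := by
  have h₁ := h.trans_le (rStar_le hμ₁ ((Real.sqrt_lt' one_pos).2 (by simpa using hδ)))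
  have := Real.sqrt_nonneg δ
  rw [← sub_lt_iff_lt_add', lt_div_iff₀ (by linarith)] at h₁
  rw [gammaF]
  linarith

end Exponents

/-! ### Control of the survival time -/

/-- Nonnegative, nontrivial data on the degenerate line `h = (μ₁ - 1 + σ) / 2 • f + g = 0`, where
`σ` stands for `√δ`. -/
structure IsDegenerateData {n : ℕ} (μ₁ μ₂ σ : ℝ) (f g : L2 n) : Prop where
  nonneg_root : 0 ≤ σ
  sq_root : σ ^ 2 = (μ₁ - 1) ^ 2 - 4 * μ₂
  smul_add : ((μ₁ - 1 + σ) / 2) • f + g = 0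
  nonneg : 0 ≤ f
  ne_zero : f ≠ 0

/-- There is an energy solution supported in the cone `|x| ≤ t + R` which exists beyond time `τ`. -/
def SurvivesUpTo {n : ℕ} (μ₁ μ₂ p : ℝ) (f g : L2 n) (R ε τ : ℝ) : Prop :=
  ∃ T > τ, ∃ (u ut : ℝ → L2 n) (Du : ℝ → L2vec n),
    IsEnergySolution μ₁ μ₂ p f g ε T u ut Du ∧ SupportedInCone R T u

namespace SurvivesUpTo

variable {n : ℕ} {μ₁ μ₂ p σ R : ℝ} {f g : L2 n}

lemma supportedInBall {ε τ : ℝ} (h : SurvivesUpTo μ₁ μ₂ p f g R ε τ) (hε : 0 < ε) (hτ : 0 < τ) :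
    SupportedInBall R f := by
  obtain ⟨T, hT, u, ut, Du, hsol, hu⟩ := h
  exact hsol.supportedInBall_init (hτ.trans hT) hu hε.ne'

/-- The mean `pairing (planeWave 0) (u t)` of a solution, multiplied by `(1+t)^((μ₁-1+σ)/2)`,
starts with vanishing momentum because `h = 0`. -/
lemma exists_isBlowupSystem (hn : 1 ≤ n) (hR : 0 ≤ R) (hp : 1 < p)
    (hfg : IsDegenerateData μ₁ μ₂ σ f g) (hfR : SupportedInBall R f) :
    ∃ c, 0 < c ∧ ∀ ε τ, 0 < ε → SurvivesUpTo μ₁ μ₂ p f g R ε τ → ∃ M G N,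
      IsBlowupSystem σ ((1 + μ₁ - σ) / 2) (n - 1 - (n + μ₁ - 1) * p / 2)
        (-(n * (p - 1)) - (μ₁ - 1 + σ) / 2 * p) p c ε τ M G N := by
  obtain ⟨c₁, hc₁, hmean⟩ := IsEnergySolution.exists_mul_rpow_mul_pairing_le_source (n := n) hR hp
  obtain ⟨c₂, hc₂, hcone⟩ :=
    IsEnergySolution.exists_mul_rpow_le_source hn hR hp hfg.sq_root hfg.smul_add
      hfg.nonneg hfg.ne_zero hfR
  set c₀ := Real.exp (-R) * pairing (planeWave 0) f
  have hc₀ : 0 < c₀ := mul_pos (Real.exp_pos _)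
    (hfR.pairing_pos hfg.nonneg hfg.ne_zero (continuous_planeWave 0) (planeWave_pos 0))
  refine ⟨min c₀ (min c₁ c₂), by positivity, fun ε τ hε ⟨T, hT, u, ut, Du, hsol, hu⟩ => ?_⟩
  have hinit : ε * c₀ ≤ pairing (planeWave 0) (u 0) :=
    hsol.mul_exp_neg_mul_pairing_le hε.le hfg.nonneg hfR (by simp)
  obtain ⟨G, hG⟩ := hsol.exists_isMomentumSystem hp hu hfg.sq_root hfg.smul_add hT 0 (by nlinarith)
  refine ⟨_, G, _, hG, ?_, fun t ht => ?_, fun t ht => ?_⟩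
  · rw [add_zero, Real.one_rpow, one_mul]
    nlinarith [min_le_left c₀ (min c₁ c₂)]
  · have ht1 : 0 < 1 + t := by linarith [ht.1]
    have hM := hG.M_pos ht.1.le ht.2.le
    have hmean := hmean hsol hu (Ioo_subset_Ioo_right hT.le ht)
    set Y := pairing (planeWave 0) (u t)
    have hY : 0 < Y := pos_of_mul_pos_right hM (by positivity)
    rw [abs_of_pos hY] at hmean
    calc min c₀ (min c₁ c₂) * (1 + t) ^ (-(n * (p - 1)) - (μ₁ - 1 + σ) / 2 * p)
          * ((1 + t) ^ ((μ₁ - 1 + σ) / 2) * Y) ^ p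
        = min c₀ (min c₁ c₂) * (1 + t) ^ (-(n * (p - 1))) * Y ^ p := by
          rw [Real.mul_rpow (by positivity) hY.le, ← Real.rpow_mul ht1.le, Real.rpow_sub ht1]
          field_simp
      _ ≤ c₁ * (1 + t) ^ (-(n * (p - 1))) * Y ^ p := by
          gcongr
          exact (min_le_right _ _).trans (min_le_left _ _)
      _ ≤ _ := by simpa using hmean
  · calc min c₀ (min c₁ c₂) * ε ^ p * (1 + t) ^ (n - 1 - (n + μ₁ - 1) * p / 2)
        ≤ c₂ * ε ^ p * (1 + t) ^ (n - 1 - (n + μ₁ - 1) * p / 2) := by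
          have ht1 : 0 < 1 + t := by linarith [ht.1]
          gcongr
          exact (min_le_right _ _).trans (min_le_right _ _)
      _ ≤ _ := by simpa using hcone hsol hu hε (Ioo_subset_Ioo_right hT.le ht)

lemma exists_bound {Φ : ℝ → ℝ → ℝ} (hn : 1 ≤ n) (hR : 0 ≤ R) (hp : 1 < p)
    (hfg : IsDegenerateData μ₁ μ₂ σ f g)
    (hΦ : ∀ c, 0 < c → ∃ C : ℝ, ∀ (ε τ : ℝ) (M G N : ℝ → ℝ), 0 < ε → 15 ≤ τ →
      IsBlowupSystem σ ((1 + μ₁ - σ) / 2) (n - 1 - (n + μ₁ - 1) * p / 2)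
        (-(n * (p - 1)) - (μ₁ - 1 + σ) / 2 * p) p c ε τ M G N → Φ ε τ ≤ C) :
    ∃ C : ℝ, ∀ ε τ, 0 < ε → 15 ≤ τ → SurvivesUpTo μ₁ μ₂ p f g R ε τ → Φ ε τ ≤ C := by
  by_cases hfR : SupportedInBall R f
  · obtain ⟨c, hc, hsystem⟩ := exists_isBlowupSystem hn hR hp hfg hfR
    obtain ⟨C, hbound⟩ := hΦ c hc
    refine ⟨C, fun ε τ hε hτ h => ?_⟩
    obtain ⟨M, G, N, hMGN⟩ := hsystem ε τ hε h
    exact hbound ε τ M G N hε hτ hMGN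
  · exact ⟨1, fun ε τ hε hτ h => absurd (h.supportedInBall hε (by linarith)) hfR⟩

lemma exists_linear_bound (hn : 1 ≤ n) (hR : 0 ≤ R) (hp : 1 < p)
    (hfg : IsDegenerateData μ₁ μ₂ σ f g) :
    ∃ C : ℝ, ∀ ε τ, 0 < ε → 15 ≤ τ → SurvivesUpTo μ₁ μ₂ p f g R ε τ →
      ε * (1 + τ) ^ (gammaF p (n + (μ₁ - 1 + σ) / 2) / (p - 1)) ≤ C := by
  refine exists_bound hn hR hp hfg fun c hc => ?_
  obtain ⟨C, hbound⟩ := IsBlowupSystem.exists_linear_bound σ ((1 + μ₁ - σ) / 2)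
    (n - 1 - (n + μ₁ - 1) * p / 2) (-(n * (p - 1)) - (μ₁ - 1 + σ) / 2 * p) hp hc
  refine ⟨C, fun ε τ M G N _ hτ h => ?_⟩
  convert hbound ε τ M G N (by linarith) h using 4
  rw [gammaF]
  ring

lemma exists_wave_bound (hn : 1 ≤ n) (hR : 0 ≤ R) (hp : 1 < p)
    (hfg : IsDegenerateData μ₁ μ₂ σ f g) :
    ∃ C : ℝ, ∀ ε τ, 0 < ε → 15 ≤ τ → SurvivesUpTo μ₁ μ₂ p f g R ε τ →
      ε ^ p * (1 + τ) ^ (gammaS p (n + μ₁) / (2 * (p - 1))) ≤ C := by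
  refine exists_bound hn hR hp hfg fun c hc => ?_
  obtain ⟨C, hbound⟩ := IsBlowupSystem.exists_wave_bound σ ((1 + μ₁ - σ) / 2)
    (n - 1 - (n + μ₁ - 1) * p / 2) (-(n * (p - 1)) - (μ₁ - 1 + σ) / 2 * p) hp hc
  refine ⟨C, fun ε τ M G N hε hτ h => ?_⟩
  convert hbound ε τ M G N hε.le (by linarith) h using 3
  have hp1 : p - 1 ≠ 0 := by linarith
  rw [gammaS]
  field_simp
  ring

lemma exists_heat_bound (hn : 1 ≤ n) (hR : 0 ≤ R) (hp : 1 < p)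
    (hfg : IsDegenerateData μ₁ μ₂ σ f g) :
    ∃ C : ℝ, ∀ ε τ, 0 < ε → 15 ≤ τ → SurvivesUpTo μ₁ μ₂ p f g R ε τ →
      ε ^ p * (1 + τ) ^ (gammaF p (n + (μ₁ - 1 - σ) / 2) / (p - 1))
        * Real.log (1 + τ) ^ (1 - Real.sign σ) ≤ C := by
  refine exists_bound hn hR hp hfg fun c hc => ?_
  obtain ⟨C, hbound⟩ := IsBlowupSystem.exists_heat_bound ((1 + μ₁ - σ) / 2)
    (n - 1 - (n + μ₁ - 1) * p / 2) (-(n * (p - 1)) - (μ₁ - 1 + σ) / 2 * p) hfg.nonneg_root hp hc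
  refine ⟨C, fun ε τ M G N hε hτ h => ?_⟩
  convert hbound ε τ M G N hε.le hτ h using 4
  have hp1 : p - 1 ≠ 0 := by linarith
  rw [gammaF]
  field_simp
  ring

lemma exists_critical_bound (hn : 1 ≤ n) (hR : 0 ≤ R) (hp : 1 < p)
    (hfg : IsDegenerateData μ₁ μ₂ σ f g) (hcrit : (n + μ₁ - 1) * (p - 1) = n - σ + 2) :
    ∃ C : ℝ, ∀ ε τ, 0 < ε → 15 ≤ τ → SurvivesUpTo μ₁ μ₂ p f g R ε τ →
      ε ^ p * (1 + τ) ^ (gammaF p (n + (μ₁ - 1 - σ) / 2) / (p - 1))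
        * Real.log (1 + τ) ^ (2 - Real.sign σ) ≤ C := by
  refine exists_bound hn hR hp hfg fun c hc => ?_
  obtain ⟨C, hbound⟩ := IsBlowupSystem.exists_critical_bound
    (-(n * (p - 1)) - (μ₁ - 1 + σ) / 2 * p) hfg.nonneg_root hp hc
    (by linarith : (1 + μ₁ - σ) / 2 + (n - 1 - (n + μ₁ - 1) * p / 2) = -1)
  refine ⟨C, fun ε τ M G N hε hτ h => ?_⟩
  convert hbound ε τ M G N hε.le hτ h using 4
  have hp1 : p - 1 ≠ 0 := by linarith
  rw [gammaF]
  field_simp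
  ring

end SurvivesUpTo

/-! ### From survival times to lifespans -/

lemma strictMonoOn_rpow_mul_log {a c : ℝ} (ha : 0 < a) (hc : 0 ≤ c) :
    StrictMonoOn (fun s : ℝ => s ^ a * Real.log (1 + s) ^ c) (Ici 0) := by
  intro s (hs : 0 ≤ s) t _ hst
  have hpow : s ^ a < t ^ a := Real.rpow_lt_rpow hs hst ha
  have hlog : Real.log (1 + s) ^ c ≤ Real.log (1 + t) ^ c :=
    Real.rpow_le_rpow (Real.log_nonneg (by linarith))
      (Real.log_le_log (by linarith) (by linarith)) hc
  have hlog_pos : 0 < Real.log (1 + t) ^ c := Real.rpow_pos_of_pos (Real.log_pos (by linarith)) c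
  exact (mul_le_mul_of_nonneg_left hlog (by positivity)).trans_lt
    (mul_lt_mul_of_pos_right hpow hlog_pos)

lemma tendsto_rpow_mul_log_atTop {a c : ℝ} (ha : 0 < a) (hc : 0 ≤ c) :
    Tendsto (fun s : ℝ => s ^ a * Real.log (1 + s) ^ c) atTop atTop := by
  refine tendsto_atTop_mono' atTop ?_ (tendsto_rpow_atTop ha)
  filter_upwards [eventually_ge_atTop (Real.exp 1)] with s hs
  have hs0 : 0 < s := (Real.exp_pos 1).trans_le hs
  have hlog : 1 ≤ Real.log (1 + s) := (Real.le_log_iff_exp_le (by positivity)).2 (by linarith)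
  exact le_mul_of_one_le_right (by positivity) (Real.one_le_rpow hlog hc)

lemma existsUnique_mul_rpow_mul_log_eq_one {a c X : ℝ} (ha : 0 < a) (hc : 0 ≤ c) (hX : 0 < X) :
    ∃! s : ℝ, 0 < s ∧ X * s ^ a * Real.log (1 + s) ^ c = 1 := by
  set φ : ℝ → ℝ := fun s => s ^ a * Real.log (1 + s) ^ c with hφ
  have hφ_iff (s : ℝ) : X * s ^ a * Real.log (1 + s) ^ c = 1 ↔ φ s = X⁻¹ := by
    rw [hφ, ← mul_eq_one_iff_eq_inv₀ hX.ne', mul_assoc, mul_comm X]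
  have hφ_zero : φ 0 = 0 := by simp [hφ, Real.zero_rpow ha.ne']
  have hcont : ContinuousOn φ (Ici 0) :=
    (continuousOn_id.rpow_const fun _ _ => Or.inr ha.le).mul
      ((ContinuousOn.log (by fun_prop) fun s (hs : 0 ≤ s) => by positivity).rpow_const
        fun _ _ => Or.inr hc)
  obtain ⟨s, hs, hsX⟩ := isPreconnected_Ici.intermediate_value_Ici (self_mem_Ici)
    (le_principal_iff.2 (Ici_mem_atTop 0)) hcont (tendsto_rpow_mul_log_atTop ha hc)
    (mem_Ici.2 (hφ_zero.trans_le (inv_pos.2 hX).le))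
  have hs_ne : s ≠ 0 := by
    rintro rfl
    exact (inv_pos.2 hX).ne (hφ_zero.symm.trans hsX)
  refine ⟨s, ⟨lt_of_le_of_ne hs hs_ne.symm, (hφ_iff s).2 hsX⟩, fun t ⟨ht, htX⟩ => ?_⟩
  exact (strictMonoOn_rpow_mul_log ha hc).injOn ht.le hs (((hφ_iff t).1 htX).trans hsX.symm)

lemma one_le_of_mul_rpow_mul_log_eq_one {a c X s : ℝ} (ha : 0 < a) (hc : 0 ≤ c) (hX : 0 < X)
    (hX1 : X ≤ 1) (hs : 0 < s) (h : X * s ^ a * Real.log (1 + s) ^ c = 1) : 1 ≤ s := by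
  by_contra! hs1
  have hlt := strictMonoOn_rpow_mul_log ha hc hs.le (mem_Ici.2 zero_le_one) hs1
  have hlog : Real.log (1 + 1) ^ c ≤ 1 := Real.rpow_le_one (Real.log_nonneg (by norm_num))
    (by linarith [Real.log_le_sub_one_of_pos (by norm_num : (0 : ℝ) < 1 + 1)]) hc
  simp only [Real.one_rpow, one_mul] at hlt
  rw [mul_assoc] at h
  nlinarith

/-- Compares a survival time `τ` with the solution `s` of the lifespan equation: `τ > C s ≥ s` would
make the left-hand side of that equation exceed `C ^ a`. -/
lemma eventually_le_mul_of_rpow_mul_log_le {a c : ℝ} (ha : 0 < a) (hc : 0 ≤ c) (B : ℝ) :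
    ∀ᶠ C in atTop, ∀ X s τ : ℝ, 0 < X → 0 < s → X * s ^ a * Real.log (1 + s) ^ c = 1 →
      0 ≤ τ → X * (1 + τ) ^ a * Real.log (1 + τ) ^ c ≤ B → τ ≤ C * s := by
  filter_upwards [eventually_ge_atTop 1, (tendsto_rpow_atTop ha).eventually_gt_atTop B] with
    C hC hCB X s τ hX hs heq hτ hle
  by_contra! hlt
  have hsτ : s ≤ τ := (le_mul_of_one_le_left hs.le hC).trans hlt.le
  have hlog : 0 ≤ Real.log (1 + s) := Real.log_nonneg (by linarith)
  refine (hCB.trans_le ?_).not_ge hle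
  calc C ^ a = X * (C * s) ^ a * Real.log (1 + s) ^ c := by
        rw [Real.mul_rpow (by positivity) hs.le]
        linear_combination -C ^ a * heq
    _ ≤ X * (1 + τ) ^ a * Real.log (1 + τ) ^ c := by
        gcongr
        linarith

section Lifespan

variable {n : ℕ} {μ₁ μ₂ δ p σ R : ℝ} {f g : L2 n}

lemma lifespan_le_ofReal {ε B : ℝ} (hB : 15 ≤ B)
    (h : ∀ τ, 15 ≤ τ → SurvivesUpTo μ₁ μ₂ p f g R ε τ → τ ≤ B) :
    lifespan μ₁ μ₂ p f g R ε ≤ ENNReal.ofReal B := by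
  refine sSup_le ?_
  rintro _ ⟨T, -, rfl, u, ut, Du, hsol, hu⟩
  refine ENNReal.ofReal_le_ofReal ?_
  by_contra! hBT
  obtain ⟨τ, hBτ, hτT⟩ := exists_between hBT
  exact (h τ (hB.trans hBτ.le) ⟨T, hτT, u, ut, Du, hsol, hu⟩).not_gt hBτ

lemma eventually_lifespan_le {a c r : ℝ} (ha : 0 < a) (hc : 0 ≤ c) (hr : 0 ≤ r)
    (h : ∃ B : ℝ, ∀ ε τ, 0 < ε → 15 ≤ τ → SurvivesUpTo μ₁ μ₂ p f g R ε τ →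
      ε ^ r * (1 + τ) ^ a * Real.log (1 + τ) ^ c ≤ B) :
    ∀ᶠ C in atTop, ∀ ε s : ℝ, 0 < ε → ε ≤ 1 → 0 < s →
      ε ^ r * s ^ a * Real.log (1 + s) ^ c = 1 →
      lifespan μ₁ μ₂ p f g R ε ≤ ENNReal.ofReal (C * s) := by
  obtain ⟨B, hB⟩ := h
  filter_upwards [eventually_ge_atTop 15, eventually_le_mul_of_rpow_mul_log_le ha hc B] with C hC
    hle ε s hε hε1 hs heq
  have hX : 0 < ε ^ r := Real.rpow_pos_of_pos hε r
  have hX1 : ε ^ r ≤ 1 := Real.rpow_le_one hε.le hε1 hr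
  have hs1 := one_le_of_mul_rpow_mul_log_eq_one ha hc hX hX1 hs heq
  exact lifespan_le_ofReal (by nlinarith) fun τ hτ hsurv =>
    hle _ s τ hX hs heq (by linarith) (hB ε τ hε hτ hsurv)

lemma eventually_lifespan_le_rpow {a r : ℝ} (ha : 0 < a) (hr : 0 ≤ r)
    (h : ∃ B : ℝ, ∀ ε τ, 0 < ε → 15 ≤ τ → SurvivesUpTo μ₁ μ₂ p f g R ε τ →
      ε ^ r * (1 + τ) ^ a ≤ B) :
    ∀ᶠ C in atTop, ∀ ε : ℝ, 0 < ε → ε ≤ 1 →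
      lifespan μ₁ μ₂ p f g R ε ≤ ENNReal.ofReal (C * ε ^ (-r / a)) := by
  filter_upwards [eventually_lifespan_le (c := 0) ha le_rfl hr (by simpa using h)] with
    C hC ε hε hε1
  refine hC ε _ hε hε1 (by positivity) ?_
  rw [← Real.rpow_mul hε.le, div_mul_cancel₀ _ ha.ne', ← Real.rpow_add hε]
  simp

lemma eventually_lifespan_le_linear (hn : 1 ≤ n) (hR : 0 ≤ R) (hp : 1 < p)
    (hfg : IsDegenerateData μ₁ μ₂ σ f g) (hγ : 0 < gammaF p (n + (μ₁ - 1 + σ) / 2)) :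
    ∀ᶠ C in atTop, ∀ ε : ℝ, 0 < ε → ε ≤ 1 → lifespan μ₁ μ₂ p f g R ε
      ≤ ENNReal.ofReal (C * ε ^ (-(p - 1) / gammaF p (n + (μ₁ - 1 + σ) / 2))) := by
  have hbound := SurvivesUpTo.exists_linear_bound hn hR hp hfg
  have h := eventually_lifespan_le_rpow (div_pos hγ (sub_pos.2 hp)) zero_le_one
    (by simpa only [Real.rpow_one] using hbound)
  rwa [← neg_div_neg_eq, neg_neg, ← div_neg, one_div_div] at h

lemma eventually_waveBound (hn : 1 ≤ n) (hR : 0 ≤ R) (hp : 1 < p)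
    (hfg : IsDegenerateData μ₁ μ₂ σ f g) (hγ : 0 < gammaS p (n + μ₁)) :
    ∀ᶠ C in atTop, ∀ ε : ℝ, 0 < ε → ε ≤ 1 →
      WaveBound n μ₁ p C ε (lifespan μ₁ μ₂ p f g R ε) := by
  have : 0 < p - 1 := sub_pos.2 hp
  have h := eventually_lifespan_le_rpow (div_pos hγ (by positivity)) (by positivity)
    (SurvivesUpTo.exists_wave_bound hn hR hp hfg)
  rwa [div_div_eq_mul_div, show -p * (2 * (p - 1)) = -(2 * p * (p - 1)) by ring] at h

lemma eventually_mixedBound_of_bound {c : ℝ} (hp : 1 < p) (hc : 0 ≤ c)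
    (hγ : 0 < gammaF p (heatDim n μ₁ δ))
    (h : ∃ B : ℝ, ∀ ε τ, 0 < ε → 15 ≤ τ → SurvivesUpTo μ₁ μ₂ p f g R ε τ →
      ε ^ p * (1 + τ) ^ (gammaF p (heatDim n μ₁ δ) / (p - 1)) * Real.log (1 + τ) ^ c ≤ B) :
    ∀ᶠ C in atTop, ∀ ε : ℝ, 0 < ε → ε ≤ 1 →
      MixedBound n μ₁ δ p c C ε (lifespan μ₁ μ₂ p f g R ε) := by
  have ha := div_pos hγ (sub_pos.2 hp)
  filter_upwards [eventually_lifespan_le ha hc (by linarith) h] with C hC ε hε hε1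
  exact ⟨existsUnique_mul_rpow_mul_log_eq_one ha hc (Real.rpow_pos_of_pos hε p),
    fun s hs => hC ε s hε hε1 hs.1 hs.2⟩

lemma sign_sqrt (hδ : 0 ≤ δ) : Real.sign √δ = Real.sign δ := by
  rcases hδ.eq_or_lt with rfl | hδ
  · rw [Real.sqrt_zero]
  · rw [Real.sign_of_pos hδ, Real.sign_of_pos (Real.sqrt_pos.2 hδ)]

lemma sign_le_one (x : ℝ) : Real.sign x ≤ 1 := by
  rcases Real.sign_apply_eq x with h | h | h <;> rw [h] <;> norm_num

lemma eventually_mixedBound (hn : 1 ≤ n) (hR : 0 ≤ R) (hp : 1 < p) (hδ : 0 ≤ δ)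
    (hfg : IsDegenerateData μ₁ μ₂ √δ f g) (hγ : 0 < gammaF p (heatDim n μ₁ δ)) :
    ∀ᶠ C in atTop, ∀ ε : ℝ, 0 < ε → ε ≤ 1 →
      MixedBound n μ₁ δ p (1 - Real.sign δ) C ε (lifespan μ₁ μ₂ p f g R ε) :=
  eventually_mixedBound_of_bound hp (sub_nonneg.2 (sign_le_one δ)) hγ
    (sign_sqrt hδ ▸ SurvivesUpTo.exists_heat_bound hn hR hp hfg)

lemma eventually_mixedBound_critical (hn : 1 ≤ n) (hR : 0 ≤ R) (hp : 1 < p) (hδ : 0 ≤ δ)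
    (hfg : IsDegenerateData μ₁ μ₂ √δ f g) (hγ : 0 < gammaF p (heatDim n μ₁ δ))
    (hcrit : (n + μ₁ - 1) * (p - 1) = n - √δ + 2) :
    ∀ᶠ C in atTop, ∀ ε : ℝ, 0 < ε → ε ≤ 1 →
      MixedBound n μ₁ δ p (2 - Real.sign δ) C ε (lifespan μ₁ μ₂ p f g R ε) :=
  eventually_mixedBound_of_bound hp (by linarith [sign_le_one δ]) hγ
    (sign_sqrt hδ ▸ SurvivesUpTo.exists_critical_bound hn hR hp hfg hcrit)

end Lifespan

end ScaleInvWave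

open ScaleInvWave

theorem theorem1p3 (n : ℕ) (hn : 1 ≤ n) (μ₁ μ₂ δ p R : ℝ)
    (hμ₁ : 0 ≤ μ₁) (hδ_def : δ = ScaleInvWave.delta μ₁ μ₂) (hδ : 0 ≤ δ)
    (hp : 1 < p) (hpc : (p : EReal) < ScaleInvWave.pCrit n μ₁ δ)
    (f g : ScaleInvWave.L2 n) (hf : ScaleInvWave.MemH1 f)
    (hf_nonneg : 0 ≤ f) (hf_ne : f ≠ 0)
    (hh : ((μ₁ - 1 + Real.sqrt δ) / 2) • f + g = 0)
    (hR : 1 ≤ R) :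
    ∃ ε₄ : ℝ, 0 < ε₄ ∧ ∃ C : ℝ, 0 < C ∧ ∀ ε : ℝ, 0 < ε → ε ≤ ε₄ →
      (Real.sqrt δ ≤ n - ScaleInvWave.dStar (n + μ₁) →
        ScaleInvWave.WaveBound n μ₁ p C ε (ScaleInvWave.lifespan μ₁ μ₂ p f g R ε)) ∧
      (n - ScaleInvWave.dStar (n + μ₁) < Real.sqrt δ → Real.sqrt δ < n + 2 →
        ((p : EReal) < ScaleInvWave.pStar n μ₁ δ →
          ScaleInvWave.WaveBound n μ₁ p C ε (ScaleInvWave.lifespan μ₁ μ₂ p f g R ε)) ∧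
        ((p : EReal) = ScaleInvWave.pStar n μ₁ δ →
          ScaleInvWave.MixedBound n μ₁ δ p (2 - Real.sign δ) C ε
            (ScaleInvWave.lifespan μ₁ μ₂ p f g R ε)) ∧
        (ScaleInvWave.pStar n μ₁ δ < (p : EReal) →
          ScaleInvWave.MixedBound n μ₁ δ p (1 - Real.sign δ) C ε
            (ScaleInvWave.lifespan μ₁ μ₂ p f g R ε))) ∧
      (n + 2 ≤ Real.sqrt δ →
        ScaleInvWave.MixedBound n μ₁ δ p (1 - Real.sign δ) C ε
          (ScaleInvWave.lifespan μ₁ μ₂ p f g R ε)) ∧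
      (n = 1 → δ < 1 → p < ScaleInvWave.rStar μ₁ δ →
        ScaleInvWave.lifespan μ₁ μ₂ p f g R ε ≤ ENNReal.ofReal
          (C * ε ^ (-(p - 1) / ScaleInvWave.gammaF p ((μ₁ + 1 + Real.sqrt δ) / 2)))) := by
  have hfg : IsDegenerateData μ₁ μ₂ √δ f g :=
    ⟨Real.sqrt_nonneg δ, by rw [Real.sq_sqrt hδ, hδ_def, delta], hh, hf_nonneg, hf_ne⟩
  have hR0 : 0 ≤ R := zero_le_one.trans hR
  have hν : 1 ≤ (n : ℝ) + μ₁ := by linarith [(Nat.one_le_cast (α := ℝ)).2 hn]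
  have hwave := eventually_imp_distrib_left.2 (eventually_waveBound hn hR0 hp hfg)
  have hheat := eventually_imp_distrib_left.2 (eventually_mixedBound hn hR0 hp hδ hfg)
  have hcrit := eventually_imp_distrib_left.2 fun hγ => eventually_imp_distrib_left.2
    (eventually_mixedBound_critical hn hR0 hp hδ hfg hγ)
  have hlin := eventually_imp_distrib_left.2 (eventually_lifespan_le_linear hn hR0 hp hfg)
  obtain ⟨C, hC, hwave, hheat, hcrit, hlin⟩ :=
    ((eventually_gt_atTop 0).and (hwave.and (hheat.and (hcrit.and hlin)))).exists
  refine ⟨1, one_pos, C, hC, fun ε hε hε1 => ⟨fun h => ?_, fun h _ => ⟨fun hps => ?_, fun hps => ?_,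
    fun _ => ?_⟩, fun h => ?_, fun hn1 hδ1 hr => ?_⟩⟩
  · exact hwave (gammaS_pos_of_sqrt_le hν hp hpc h) ε hε hε1
  · exact hwave (gammaS_pos_of_lt_pStar hν hp hps h) ε hε hε1
  · exact hcrit (gammaF_pos_of_lt_sqrt hν hp hpc h) (mul_eq_of_eq_pStar hps) ε hε hε1
  · exact hheat (gammaF_pos_of_lt_sqrt hν hp hpc h) ε hε hε1
  · exact hheat (gammaF_pos_of_lt_sqrt hν hp hpc (by linarith [dStar_nonneg (n + μ₁)])) ε hε hε1
  · have hdim : (n : ℝ) + (μ₁ - 1 + √δ) / 2 = (μ₁ + 1 + √δ) / 2 := by rw [hn1]; push_cast; ring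
    rw [hdim] at hlin
    exact hlin (gammaF_pos_of_lt_rStar hμ₁ hδ1 hr) ε hε hε1
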